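/- Let $n\ge 1$, let $\mathbb B$ be the open unit ball of $\mathbb C^n$, and let $dV$ be Lebesgue measure on $\mathbb B$ normalized so that $V(\mathbb B)=1$. Let $\omega$ be a radial weight, that is, a positive function $\omega(z)=\omega(|z|)$ integrable on $\mathbb B$ with respect to $dV$. Put $\hat\omega(r)=\int_r^1\omega(t)\,dt$. Suppose $\omega\in\hat{\mathcal D}$ ($\omega$ is doubling): there is a constant $C>0$ with $\hat\omega(r)<C\,\hat\omega\big(\tfrac{1+r}2\big)$ for all $0\le r<1$. Let $0<p\le q<\infty$. The space $A^p_\omega$ consists of all holomorphic $f$ on $\mathbb B$ with $\|f\|_{A^p_\omega}^p=\int_{\mathbb B}|f|^p\omega\,dV<\infty$. For $a\in\mathbb B\setminus\{0\}$ let $$S_a=\Big\{z\in\mathbb B:\ |a|<|z|<1,\ \Big|1-\Big\langle \tfrac{z}{|z|},\tfrac{a}{|a|}\Big\rangle\Big|\le 1-|a|\Big\},$$ let $S_0=\mathbb B$, and write $\omega(E)=\int_E\omega\,dV$. A positive Borel measure $\mu$ on $\mathbb B$ is called a $q$-Carleson measure for $A^p_\omega$ if the identity operator $Id:A^p_\omega\to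 L^q_\mu$ is bounded, and a vanishing $q$-Carleson measure for $A^p_\omega$ if $Id:A^p_\omega\to L^q_\mu$ is compact, that is, bounded and such that the image of every bounded sequence has a subsequence converging in $L^q_\mu$. The following statements hold. (i) A positive Borel measure $\mu$ on $\mathbb B$ is a $q$-Carleson measure for $A^p_\omega$ if and only if $$\sup_{a\in\mathbb B}\frac{\mu(S_a)}{\omega(S_a)^{q/p}}<\infty.$$ Moreover, there is a constant $C>0$ depending only on $n,p,q,\omega$ such that every $q$-Carleson measure $\mu$ for $A^p_\omega$ satisfies $$C^{-1}\sup_{a\in\mathbb B}\frac{\mu(S_a)}{\omega(S_a)^{q/p}}\ \le\ \|Id\|^q_{A^p_\omega\to L^q_\mu}\ \le\ C\sup_{a\in\mathbb B}\frac{\mu(S_a)}{\omega(S_a)^{q/p}}.$$ (ii) A positive Borel measure $\mu$ on $\mathbb B$ that is finite on the compact subsets of $\mathbb B$ is a vanishing $q$-Carleson measure for $A^p_\omega$ if and only if $$\lim_{|a|\to1}\frac{\mu(S_a)}{\omega(S_a)^{q/p}}=0.$$ -/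

import Mathlib

open MeasureTheory Set Filter Topology
open scoped ENNReal NNReal

noncomputable section

namespace BergmanBall

/-- `ℂⁿ` with its Euclidean norm. -/
abbrev Cn (n : ℕ) : Type := EuclideanSpace ℂ (Fin n)

/-- The open unit ball of `ℂⁿ`. -/
abbrev unitBall (n : ℕ) : Set (Cn n) := Metric.ball 0 1

/-- The Lebesgue measure of the unit ball, normalized to total mass one. -/
def normVolume (n : ℕ) : Measure (Cn n) :=
  (volume (unitBall n))⁻¹ • volume.restrict (unitBall n)

/-- `ω` is the radial profile of a radial weight on the ball: `z ↦ ω ‖z‖` is positive and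
integrable there. The value at the single point `0` is irrelevant and left free. -/
structure IsRadialWeight (n : ℕ) (ω : ℝ → ℝ) : Prop where
  pos : ∀ r ∈ Ioo (0 : ℝ) 1, 0 < ω r
  aemeasurable : AEMeasurable ω (volume.restrict (Ioo (0 : ℝ) 1))
  integrable : Integrable (fun z : Cn n => ω ‖z‖) (normVolume n)

/-- The tail integral of `ω` over `(r, 1)`, as an element of `[0, ∞]`. -/
def tail (ω : ℝ → ℝ) (r : ℝ) : ℝ≥0∞ := ∫⁻ t in Ioo r 1, ENNReal.ofReal (ω t)

/-- Doubling weights. The strict inequality in `[0, ∞]` contains the finiteness of the tails. -/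
structure IsDoublingWeight (n : ℕ) (ω : ℝ → ℝ) : Prop extends IsRadialWeight n ω where
  doubling : ∃ C : ℝ≥0, 0 < C ∧ ∀ r ∈ Ico (0 : ℝ) 1, tail ω r < C * tail ω ((1 + r) / 2)

/-- The measure `ω dV` on the ball. -/
def weightMeasure (n : ℕ) (ω : ℝ → ℝ) : Measure (Cn n) :=
  (normVolume n).withDensity fun z => ENNReal.ofReal (ω ‖z‖)

/-- The (quasi-)norm `(∫ |f|^p ω dV)^(1/p)`, with values in `[0, ∞]`. -/
def bergmanNorm (n : ℕ) (ω : ℝ → ℝ) (p : ℝ) (f : Cn n → ℂ) : ℝ≥0∞ :=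
  eLpNorm f (ENNReal.ofReal p) (weightMeasure n ω)

/-- The weighted Bergman space: functions holomorphic in the ball with finite (quasi-)norm.
Values outside the ball play no role. -/
def bergmanSpace (n : ℕ) (ω : ℝ → ℝ) (p : ℝ) : Set (Cn n → ℂ) :=
  {f | DifferentiableOn ℂ f (unitBall n) ∧ bergmanNorm n ω p f < ∞}

/-- The nonisotropic ball in the unit sphere with centre `ξ` and radius `r`. -/
def nonisoBall {n : ℕ} (ξ : Cn n) (r : ℝ) : Set (Cn n) :=
  {η | η ∈ Metric.sphere (0 : Cn n) 1 ∧ ‖1 - inner ℂ η ξ‖ ≤ r ^ 2}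

open Classical in
/-- The Carleson block `S_a`, with `S_0` the whole ball. -/
def carlesonBlock {n : ℕ} (a : Cn n) : Set (Cn n) :=
  if a = 0 then unitBall n
  else {z | ‖a‖ < ‖z‖ ∧ ‖z‖ < 1 ∧
    ‖z‖⁻¹ • z ∈ nonisoBall (‖a‖⁻¹ • a) (Real.sqrt (1 - ‖a‖))}

/-- The quotient `μ(S_a) / ω(S_a)^(q/p)`. -/
def blockRatio {n : ℕ} (ω : ℝ → ℝ) (p q : ℝ) (μ : Measure (Cn n)) (a : Cn n) : ℝ≥0∞ :=
  μ (carlesonBlock a) / weightMeasure n ω (carlesonBlock a) ^ (q / p)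

/-- `μ` is carried by the ball, that is, `μ` is a Borel measure on the ball. -/
def IsMeasureOnBall {n : ℕ} (μ : Measure (Cn n)) : Prop := μ (unitBall n)ᶜ = 0

/-- The identity maps the Bergman space boundedly into `L^q(μ)`. -/
def IsCarleson {n : ℕ} (ω : ℝ → ℝ) (p q : ℝ) (μ : Measure (Cn n)) : Prop :=
  ∃ C : ℝ≥0, ∀ f ∈ bergmanSpace n ω p, MemLp f (ENNReal.ofReal q) μ ∧
    eLpNorm f (ENNReal.ofReal q) μ ≤ C * bergmanNorm n ω p f

/-- The operator (quasi-)norm of the identity from the Bergman space to `L^q(μ)`. -/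
def idNorm {n : ℕ} (ω : ℝ → ℝ) (p q : ℝ) (μ : Measure (Cn n)) : ℝ≥0∞ :=
  ⨆ f ∈ {f | f ∈ bergmanSpace n ω p ∧ bergmanNorm n ω p f ≤ 1}, eLpNorm f (ENNReal.ofReal q) μ

/-- The identity is a compact operator from the Bergman space into `L^q(μ)`: it is bounded, and
the image of every bounded sequence has a subsequence that converges in `L^q(μ)`. -/
def IsVanishingCarleson {n : ℕ} (ω : ℝ → ℝ) (p q : ℝ) (μ : Measure (Cn n)) : Prop :=
  IsCarleson ω p q μ ∧
  ∀ f : ℕ → Cn n → ℂ, (∀ k, f k ∈ bergmanSpace n ω p) →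
    (∃ M : ℝ≥0, ∀ k, bergmanNorm n ω p (f k) ≤ M) →
    ∃ φ : ℕ → ℕ, StrictMono φ ∧ ∃ g : Cn n → ℂ, MemLp g (ENNReal.ofReal q) μ ∧
      Tendsto (fun j => eLpNorm (f (φ j) - g) (ENNReal.ofReal q) μ) atTop (𝓝 0)

end BergmanBall

end

noncomputable section

namespace BergmanBall

/-! ### Nonisotropic geometry of Carleson blocks -/

section Geometry

/-! Write ν = ω dV. Three properties of ν carry the theorem, and `IsAdmissible` collects them: ν is
finite, it is doubling (with positive mass) on Carleson blocks, and it controls point values,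
|f(a)|^s ν(S_a) ≲ ∫ |f|^s dν for every s > 0 and every holomorphic f.

Doubling on blocks combines the doubling of the tail of ω with that of nonisotropic caps on the
sphere. For the point estimate ω has no pointwise regularity to rely on, so a value at depth h is
pushed towards the boundary: |f|^s has the sub-mean value property over a circular neighbourhood of
a, the sphere means of |f|^s increase with the radius, hence |f(a)|^s is controlled by the sphere
mean at any radius ρ ≥ 1 - h/8. Integrating over these ρ against ω produces a tail at 1 - h/8, which
doubling compares with the tail at 1 - h.

Sufficiency: applied to f times a high power of the kernel h/(1 - ⟨z,a⟩), the point estimate becomes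
local, and |f(a)|^s is dominated by averages of |f|^s over blocks containing a
(`enorm_rpow_le_of_average_le`). A Vitali covering argument, with superadditivity of x ↦ x^(q/p),
gives a weak-type estimate from ν to μ for the block maximal function (`measure_maximal_le`).
Truncation and the layer cake formula with s = p/2 turn it into the embedding
(`exists_lintegral_le`).

Necessity: normalized powers of the same kernel have norm at most one and are large on S_a
(`exists_normalized_testFun`, `measure_block_le`).

Compactness: if the ratios tend to zero, then μ restricted to a thin shell at the boundary has small
block ratios at all scales (`measure_block_inter_shell_le`), so the shell contributes little
uniformly on bounded sets, while on the remaining compact part a normal family argument and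
dominated convergence apply. Conversely the normalized kernels tend to zero pointwise as a
approaches the sphere, so compactness forces a subsequence to tend to zero in L^q(μ). -/

lemma norm_one_sub_inner_le_of_unit {E : Type*} [NormedAddCommGroup E] [InnerProductSpace ℂ E]
    {a b c : E} (ha : ‖a‖ = 1) (hb : ‖b‖ = 1) (hc : ‖c‖ = 1) :
    ‖1 - inner ℂ a b‖ ≤ 2 * (‖1 - inner ℂ a c‖ + ‖1 - inner ℂ c b‖) := by
  set x := inner ℂ a c with hx
  set y := inner ℂ c b with hy
  have hcc : inner ℂ c c = (1 : ℂ) := by simp [inner_self_eq_norm_sq_to_K, hc]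
  have hx1 : ‖x‖ ≤ 1 := by simpa [ha, hc] using norm_inner_le_norm (𝕜 := ℂ) a c
  have hy1 : ‖y‖ ≤ 1 := by simpa [hb, hc] using norm_inner_le_norm (𝕜 := ℂ) c b
  have hortho : ∀ v : E, ‖v‖ = 1 → ‖v - (inner ℂ c v) • c‖ ^ 2 = 1 - ‖inner ℂ c v‖ ^ 2 := by
    intro v hv
    have h := norm_sub_sq (𝕜 := ℂ) v ((inner ℂ c v) • c)
    rw [h, inner_smul_right, ← inner_conj_symm v c, Complex.mul_conj', norm_smul, hv, hc]
    rw [RCLike.re_eq_complex_re, ← Complex.ofReal_pow, Complex.ofReal_re]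
    ring
  -- Split a and b along c and its orthogonal complement. The orthogonal parts satisfy α² = 1 - |x|²
  -- ≤ 2|1 - x| and likewise for β, so αβ ≤ (α² + β²)/2 costs one more copy of |1 - x| + |1 - y|;
  -- this is the source of the factor 2.
  have hsplit : inner ℂ a b = x * y + inner ℂ (a - (inner ℂ c a) • c) (b - y • c) := by
    simp only [inner_sub_left, inner_sub_right, inner_smul_left, inner_smul_right, hcc,
      inner_conj_symm]
    rw [← hx, ← hy]; ring
  have hxa : ‖inner ℂ c a‖ = ‖x‖ := norm_inner_symm _ _
  set α := ‖a - (inner ℂ c a) • c‖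
  set β := ‖b - y • c‖
  have hα : α ^ 2 ≤ 2 * ‖1 - x‖ := by
    have h1 : α ^ 2 = 1 - ‖x‖ ^ 2 := by rw [← hxa]; exact hortho a ha
    have h2 : 1 - ‖x‖ ≤ ‖1 - x‖ := by simpa using norm_sub_norm_le (1 : ℂ) x
    nlinarith [norm_nonneg x]
  have hβ : β ^ 2 ≤ 2 * ‖1 - y‖ := by
    have h1 : β ^ 2 = 1 - ‖y‖ ^ 2 := hortho b hb
    have h2 : 1 - ‖y‖ ≤ ‖1 - y‖ := by simpa using norm_sub_norm_le (1 : ℂ) y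
    nlinarith [norm_nonneg y]
  have hαβ : ‖inner ℂ (a - (inner ℂ c a) • c) (b - y • c)‖ ≤ α * β := norm_inner_le_norm _ _
  have hxy : ‖1 - x * y‖ ≤ ‖1 - x‖ + ‖1 - y‖ := by
    have : 1 - x * y = (1 - x) + x * (1 - y) := by ring
    rw [this]
    refine (norm_add_le _ _).trans ?_
    rw [norm_mul]
    nlinarith [norm_nonneg (1 - y)]
  have : 1 - inner ℂ a b = (1 - x * y) - inner ℂ (a - (inner ℂ c a) • c) (b - y • c) := by
    rw [hsplit]; ring
  rw [this]
  refine (norm_sub_le _ _).trans ?_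
  nlinarith [sq_nonneg (α - β)]

variable {n : ℕ}

/-- The Carleson block of size `h` in the direction `ξ`. -/
def block (ξ : Cn n) (h : ℝ) : Set (Cn n) := carlesonBlock (max (1 - h) 0 • ξ)

/-- Clamping the radius at 0 makes every size h ≥ 1 give the whole ball, so enlargements of blocks
can be written without an upper limit on the size. -/
lemma block_of_one_le (ξ : Cn n) {h : ℝ} (hh : 1 ≤ h) : block ξ h = unitBall n := by
  simp [block, carlesonBlock, max_eq_right (sub_nonpos.2 hh)]

lemma mem_block {ξ z : Cn n} {h : ℝ} (hξ : ‖ξ‖ = 1) (h0 : 0 < h) (h1 : h < 1) :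
    z ∈ block ξ h ↔ 1 - h < ‖z‖ ∧ ‖z‖ < 1 ∧ ‖1 - inner ℂ (‖z‖⁻¹ • z) ξ‖ ≤ h := by
  have hpos : 0 < 1 - h := by linarith
  have hξ0 : ξ ≠ 0 := by rintro rfl; simp at hξ
  have hnorm : ‖(1 - h) • ξ‖ = 1 - h := by simp [norm_smul, hξ, abs_of_pos hpos]
  have hne : (1 - h) • ξ ≠ 0 := smul_ne_zero hpos.ne' hξ0
  rw [block, max_eq_left hpos.le, carlesonBlock, if_neg hne, hnorm, inv_smul_smul₀ hpos.ne',
    mem_ofPred_eq]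
  refine and_congr_right fun hz => and_congr_right fun _ => ?_
  have hz0 : 0 < ‖z‖ := hpos.trans hz
  rw [nonisoBall, mem_ofPred_eq, Real.sq_sqrt (by linarith only [h0])]
  have : ‖z‖⁻¹ • z ∈ Metric.sphere (0 : Cn n) 1 := by
    simp only [mem_sphere_zero_iff_norm]
    simp [norm_smul, hz0.ne']
  rw [sub_sub_cancel]
  exact and_iff_right this

lemma block_subset_unitBall {ξ : Cn n} {h : ℝ} (hξ : ‖ξ‖ = 1) (h0 : 0 < h) :
    block ξ h ⊆ unitBall n := by
  rcases lt_or_ge h 1 with h1 | h1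
  · intro z hz
    simpa using ((mem_block hξ h0 h1).1 hz).2.1
  · rw [block_of_one_le ξ h1]

lemma block_mono {ξ : Cn n} {h k : ℝ} (hξ : ‖ξ‖ = 1) (h0 : 0 < h) (hk : h ≤ k) :
    block ξ h ⊆ block ξ k := by
  rcases lt_or_ge k 1 with h1 | h1
  · intro z hz
    obtain ⟨a, b, c⟩ := (mem_block hξ h0 (hk.trans_lt h1)).1 hz
    exact (mem_block hξ (h0.trans_le hk) h1).2 ⟨by linarith, b, c.trans hk⟩
  · rw [block_of_one_le ξ h1]; exact block_subset_unitBall hξ h0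

lemma norm_inv_smul_self {z : Cn n} (hz : 0 < ‖z‖) : ‖‖z‖⁻¹ • z‖ = 1 := by
  simp [norm_smul, hz.ne']

lemma block_nonempty {ξ : Cn n} {h : ℝ} (hξ : ‖ξ‖ = 1) (h0 : 0 < h) : (block ξ h).Nonempty := by
  rcases lt_or_ge h 1 with h1 | h1
  · have hp : 0 < 1 - h / 2 := by linarith
    have hn : ‖(1 - h / 2) • ξ‖ = 1 - h / 2 := by simp [norm_smul, hξ, abs_of_pos hp]
    refine ⟨(1 - h / 2) • ξ, (mem_block hξ h0 h1).2 ⟨?_, ?_, ?_⟩⟩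
    · rw [hn]; linarith
    · rw [hn]; linarith
    · rw [hn, inv_smul_smul₀ hp.ne']
      simp [inner_self_eq_norm_sq_to_K, hξ, h0.le]
  · rw [block_of_one_le ξ h1]; exact ⟨0, by simp⟩

lemma norm_one_sub_inner_comm (a b : Cn n) : ‖1 - inner ℂ a b‖ = ‖1 - inner ℂ b a‖ := by
  rw [← inner_conj_symm, ← Complex.norm_conj]; simp

/-- Engulfing property for Vitali coverings. Two uses of the quasi-triangle inequality, through ξ
and then z, give 2(h + 2(h + k)) ≤ 16k when h ≤ 2k. -/
lemma block_subset_block {ξ η z : Cn n} {h k : ℝ} (hξ : ‖ξ‖ = 1) (hη : ‖η‖ = 1) (h0 : 0 < h)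
    (hk : h ≤ 2 * k) (hz : z ∈ block ξ h) (hz' : z ∈ block η k) : block ξ h ⊆ block η (16 * k) := by
  have k0 : 0 < k := by linarith
  rcases lt_or_ge (16 * k) 1 with h1 | h1
  · intro w hw
    rw [mem_block hξ h0 (by linarith)] at hz hw
    rw [mem_block hη k0 (by linarith)] at hz'
    have hw0 : 0 < ‖w‖ := by linarith [hw.1]
    have hz0 : 0 < ‖z‖ := by linarith [hz.1]
    refine (mem_block hη (by linarith) h1).2 ⟨by linarith [hw.1], hw.2.1, ?_⟩
    have e1 := norm_one_sub_inner_le_of_unit (norm_inv_smul_self hw0) hη hξ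
    have e2 := norm_one_sub_inner_le_of_unit hξ hη (norm_inv_smul_self hz0)
    have e3 := norm_one_sub_inner_comm ξ (‖z‖⁻¹ • z)
    linarith [hw.2.2, hz.2.2, hz'.2.2]
  · rw [block_of_one_le η h1]; exact block_subset_unitBall hξ h0

lemma one_sub_le_norm_one_sub_inner {z a : Cn n} : 1 - ‖z‖ * ‖a‖ ≤ ‖1 - inner ℂ z a‖ := by
  have h1 := norm_sub_norm_le (1 : ℂ) (inner ℂ z a)
  have h2 := norm_inner_le_norm (𝕜 := ℂ) z a
  simp only [norm_one] at h1
  linarith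

lemma le_norm_one_sub_inner {ξ z : Cn n} {h : ℝ} (hξ : ‖ξ‖ = 1) (h1 : h ≤ 1)
    (hz : ‖z‖ ≤ 1) : h ≤ ‖1 - inner ℂ z ((1 - h) • ξ)‖ := by
  refine le_trans ?_ one_sub_le_norm_one_sub_inner
  rw [norm_smul, hξ, Real.norm_of_nonneg (by linarith)]
  nlinarith [norm_nonneg z]

lemma inner_real_smul_right' (x y : Cn n) (r : ℝ) : inner ℂ x (r • y) = (r : ℂ) * inner ℂ x y := by
  rw [← inner_smul_right]; rfl

lemma inner_real_smul_left' (x y : Cn n) (r : ℝ) : inner ℂ (r • x) y = (r : ℂ) * inner ℂ x y := by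
  rw [← inner_conj_symm, inner_real_smul_right', map_mul, inner_conj_symm, Complex.conj_ofReal]

lemma inner_polar {z ξ : Cn n} (hz : 0 < ‖z‖) (r : ℝ) :
    inner ℂ z (r • ξ) = ((‖z‖ * r : ℝ) : ℂ) * inner ℂ (‖z‖⁻¹ • z) ξ := by
  rw [inner_real_smul_right', inner_real_smul_left']
  push_cast
  have : (‖z‖ : ℂ) ≠ 0 := by exact_mod_cast hz.ne'
  field_simp

/-- Together with `mem_block_of_norm_one_sub_inner_le` this identifies blocks, up to constants, with
sublevel sets of |1 - ⟨z, a⟩|, so that powers of the kernel can be summed over dyadic blocks. -/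
lemma norm_one_sub_inner_le_three_mul {ξ z : Cn n} {h : ℝ} (hξ : ‖ξ‖ = 1) (h0 : 0 < h)
    (h1 : h ≤ 1) (hz : z ∈ block ξ h) : ‖1 - inner ℂ z ((1 - h) • ξ)‖ ≤ 3 * h := by
  rcases h1.lt_or_eq with h1 | rfl
  · rw [mem_block hξ h0 h1] at hz
    obtain ⟨a, b, c⟩ := hz
    have hz0 : 0 < ‖z‖ := by linarith
    rw [inner_polar hz0]
    set x := inner ℂ (‖z‖⁻¹ • z) ξ
    have ht : 0 ≤ ‖z‖ * (1 - h) := mul_nonneg hz0.le (by linarith)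
    have hx : ‖x‖ ≤ 1 := by
      simpa [hξ, hz0.ne', norm_smul] using norm_inner_le_norm (𝕜 := ℂ) (‖z‖⁻¹ • z) ξ
    have e : 1 - ((‖z‖ * (1 - h) : ℝ) : ℂ) * x
        = (1 - x) + ((1 - ‖z‖ * (1 - h) : ℝ) : ℂ) * x := by push_cast; ring
    rw [e]
    refine (norm_add_le _ _).trans ?_
    have hc : 0 ≤ 1 - ‖z‖ * (1 - h) := by nlinarith
    rw [norm_mul, Complex.norm_real, Real.norm_of_nonneg hc]
    have := mul_le_mul_of_nonneg_left hx hc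
    nlinarith
  · simp

lemma mem_block_of_norm_one_sub_inner_le {ξ z : Cn n} {h k : ℝ} (hξ : ‖ξ‖ = 1) (h0 : 0 < h)
    (h1 : h ≤ 1) (hz : ‖z‖ < 1) (hN : ‖1 - inner ℂ z ((1 - h) • ξ)‖ ≤ k) : z ∈ block ξ (4 * k) := by
  have hk : 0 < k := h0.trans_le ((le_norm_one_sub_inner hξ h1 hz.le).trans hN)
  rcases lt_or_ge (4 * k) 1 with hk1 | hk1
  · have hb := (one_sub_le_norm_one_sub_inner (z := z) (a := (1 - h) • ξ)).trans hN
    rw [norm_smul, hξ, Real.norm_of_nonneg (by linarith), mul_one] at hb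
    have hz0 : 0 < ‖z‖ := by
      by_contra hc
      have : ‖z‖ = 0 := le_antisymm (not_lt.1 hc) (norm_nonneg z)
      rw [this] at hb; linarith
    refine (mem_block hξ (by linarith) hk1).2 ⟨by nlinarith, hz, ?_⟩
    rw [inner_polar hz0] at hN
    set x := inner ℂ (‖z‖⁻¹ • z) ξ
    have hx : ‖x‖ ≤ 1 := by
      simpa [hξ, hz0.ne', norm_smul] using norm_inner_le_norm (𝕜 := ℂ) (‖z‖⁻¹ • z) ξ
    have e : 1 - x
        = (1 - ((‖z‖ * (1 - h) : ℝ) : ℂ) * x) - ((1 - ‖z‖ * (1 - h) : ℝ) : ℂ) * x := by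
      push_cast; ring
    rw [e]
    refine (norm_sub_le _ _).trans ?_
    have hc : 0 ≤ 1 - ‖z‖ * (1 - h) := by nlinarith
    rw [norm_mul, Complex.norm_real, Real.norm_of_nonneg hc]
    have := mul_le_mul_of_nonneg_left hx hc
    nlinarith
  · rw [block_of_one_le ξ hk1]; simpa using hz

lemma exists_block_eq (hn : 1 ≤ n) {a : Cn n} (ha : a ∈ unitBall n) :
    ∃ ξ : Cn n, ‖ξ‖ = 1 ∧ ∃ h, 0 < h ∧ h ≤ 1 ∧ ‖a‖ = 1 - h ∧ a = (1 - h) • ξ ∧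
      carlesonBlock a = block ξ h := by
  have ha1 : ‖a‖ < 1 := by simpa using ha
  have key : ∀ ξ : Cn n, a = (1 - (1 - ‖a‖)) • ξ → carlesonBlock a = block ξ (1 - ‖a‖) := by
    intro ξ hξ
    rw [block, max_eq_left (by linarith [norm_nonneg a]), ← hξ]
  by_cases h0 : a = 0
  · subst h0
    refine ⟨EuclideanSpace.single ⟨0, hn⟩ 1, by simp, 1 - ‖(0 : Cn n)‖, by simp, by simp, by simp,
      by simp, key _ (by simp)⟩
  · have hp : 0 < ‖a‖ := norm_pos_iff.2 h0
    have e : a = (1 - (1 - ‖a‖)) • (‖a‖⁻¹ • a) := by simp [smul_smul, hp.ne']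
    exact ⟨‖a‖⁻¹ • a, norm_inv_smul_self hp, 1 - ‖a‖, by linarith, by linarith, by ring, e, key _ e⟩

lemma block_eq_carlesonBlock {ξ : Cn n} (hξ : ‖ξ‖ = 1) {h : ℝ} (h0 : 0 < h) :
    ∃ a ∈ unitBall n, ‖a‖ = max (1 - h) 0 ∧ carlesonBlock a = block ξ h := by
  have hm : ‖max (1 - h) 0 • ξ‖ = max (1 - h) 0 := by
    rw [norm_smul, hξ, Real.norm_of_nonneg (le_max_right _ _), mul_one]
  refine ⟨max (1 - h) 0 • ξ, ?_, hm, rfl⟩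
  simp only [Metric.mem_ball, dist_zero_right, hm]
  exact max_lt (by linarith) one_pos

lemma measurableSet_block {ξ : Cn n} (hξ : ‖ξ‖ = 1) {h : ℝ} (h0 : 0 < h) :
    MeasurableSet (block ξ h) := by
  rcases lt_or_ge h 1 with h1 | h1
  · have : block ξ h = {z | 1 - h < ‖z‖} ∩ ({z | ‖z‖ < 1} ∩
        {z | ‖1 - inner ℂ (‖z‖⁻¹ • z) ξ‖ ≤ h}) := by
      ext z; rw [mem_block hξ h0 h1]; rfl
    rw [this]
    have hm : Measurable fun z : Cn n => ‖z‖⁻¹ • z := by fun_prop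
    have hi : Measurable fun z : Cn n => ‖1 - inner ℂ (‖z‖⁻¹ • z) ξ‖ := by
      have : Continuous fun w : Cn n => ‖1 - inner ℂ w ξ‖ := by fun_prop
      exact this.measurable.comp hm
    exact (measurableSet_lt measurable_const measurable_norm).inter
      ((measurableSet_lt measurable_norm measurable_const).inter
        (measurableSet_le hi measurable_const))
  · rw [block_of_one_le ξ h1]; exact measurableSet_ball

/-- Kernel mass is controlled by the dyadic enlargements of a block. -/
lemma lintegral_mul_kernel_le (ν : Measure (Cn n)) (hν : ν (unitBall n)ᶜ = 0)
    {ξ : Cn n} {h M : ℝ} (hξ : ‖ξ‖ = 1) (h0 : 0 < h) (h1 : h ≤ 1) (hM : 0 < M)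
    {φ : Cn n → ℝ≥0∞} (hφ : AEMeasurable φ ν) :
    ∫⁻ z, φ z * ENNReal.ofReal (h / ‖1 - inner ℂ z ((1 - h) • ξ)‖) ^ M ∂ν ≤
      ∑' j : ℕ, (2⁻¹ : ℝ≥0∞) ^ (j * M) * ∫⁻ z in block ξ (8 * (2 ^ j * h)), φ z ∂ν := by
  have hms : ∀ j : ℕ, MeasurableSet (block ξ (8 * (2 ^ j * h))) := fun j =>
    measurableSet_block hξ (by positivity)
  have e : ∀ j : ℕ, (2⁻¹ : ℝ≥0∞) ^ (j * M) * ∫⁻ z in block ξ (8 * (2 ^ j * h)), φ z ∂ν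
      = ∫⁻ z, (block ξ (8 * (2 ^ j * h))).indicator (fun z => (2⁻¹ : ℝ≥0∞) ^ (j * M) * φ z) z ∂ν := by
    intro j
    rw [lintegral_indicator (hms j), lintegral_const_mul'']
    exact hφ.restrict
  simp_rw [e]
  rw [← lintegral_tsum]
  · refine lintegral_mono_ae ?_
    have hb : ∀ᵐ z ∂ν, z ∈ unitBall n := by
      rw [ae_iff]; exact hν
    filter_upwards [hb] with z hz
    have hz1 : ‖z‖ < 1 := by simpa using hz
    set N := ‖1 - inner ℂ z ((1 - h) • ξ)‖ with hN
    have hhN : h ≤ N := le_norm_one_sub_inner hξ h1 hz1.le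
    have hN0 : 0 < N := h0.trans_le hhN
    -- One term of the series suffices at each z: with 2^j ≤ N/h < 2^(j+1), the kernel is at most
    -- 2^(-j) and z lies in the block of size 4 · 2^(j+1) h, which explains the factor 8.
    obtain ⟨j, hj, hj'⟩ := exists_nat_pow_near (x := N / h) (y := (2 : ℝ))
      ((one_le_div h0).2 hhN) one_lt_two
    have hmem : z ∈ block ξ (8 * (2 ^ j * h)) := by
      have : N ≤ 2 ^ (j + 1) * h := by
        rw [div_lt_iff₀ h0] at hj'; exact hj'.le
      have := mem_block_of_norm_one_sub_inner_le hξ h0 h1 hz1 this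
      convert this using 2
      ring
    refine le_trans ?_ (ENNReal.le_tsum j)
    rw [indicator_of_mem hmem, mul_comm]
    gcongr
    rw [ENNReal.rpow_mul]
    gcongr
    rw [ENNReal.rpow_natCast, ← ENNReal.inv_pow]
    have : h / N ≤ ((2 : ℝ) ^ j)⁻¹ := by
      rw [le_div_iff₀ h0] at hj
      rw [div_le_iff₀ hN0, ← div_eq_inv_mul, le_div_iff₀ (by positivity)]
      linarith
    refine (ENNReal.ofReal_le_ofReal this).trans ?_
    rw [ENNReal.ofReal_inv_of_pos (by positivity), ENNReal.ofReal_pow (by norm_num)]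
    simp
  · intro j
    exact (hφ.const_mul _).indicator (hms j)

end Geometry

/-! ### Subharmonicity of powers of a holomorphic function -/

section SubMeanValue

open Real in
/-- Jensen's inequality for `log ‖f‖`, in the form of the sub-mean value property. -/
lemma log_norm_le_circleAverage {c : ℂ} {R : ℝ} {f : ℂ → ℂ} (hR : R ≠ 0)
    (hf : AnalyticOnNhd ℂ f (Metric.closedBall c |R|)) (hc : f c ≠ 0) :
    Real.log ‖f c‖ ≤ circleAverage (fun z => Real.log ‖f z‖) c R := by
  -- Jensen's formula writes the average as log ‖f c‖ plus a sum over zeros u of multiplicity times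
  -- log(R/|c - u|), so nonnegativity of the terms is enough. The term u = c is killed by the
  -- convention `log 0 = 0`.
  rw [hf.circleAverage_log_norm hR hc, le_add_iff_nonneg_left]
  refine finsum_nonneg fun u => ?_
  by_cases hu : u ∈ Metric.closedBall c |R|
  · refine mul_nonneg (mod_cast MeromorphicOn.AnalyticOnNhd.divisor_nonneg hf u) ?_
    rcases eq_or_ne u c with rfl | hne
    · simp
    · rw [← log_abs]
      refine log_nonneg ?_
      have hpos : 0 < ‖c - u‖ := norm_pos_iff.2 (sub_ne_zero.2 hne.symm)
      rw [abs_mul, abs_inv, abs_norm, ← div_eq_mul_inv, one_le_div hpos]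
      simpa [dist_eq_norm'] using hu
  · simp [hu]

-- Convexity of exp: |f|^s = exp(s log|f|) lies above its tangent at s log|f c|, namely A(1 +
-- s(log|f| - log|f c|)), and the average of the tangent is at least A by Jensen's inequality.
open Real in
lemma norm_rpow_le_circleAverage {c : ℂ} {R s : ℝ} {f : ℂ → ℂ} (hR : R ≠ 0) (hs : 0 < s)
    (hf : AnalyticOnNhd ℂ f (Metric.closedBall c |R|)) :
    ‖f c‖ ^ s ≤ circleAverage (fun z => ‖f z‖ ^ s) c R := by
  by_cases hc : f c = 0
  · rw [hc, norm_zero, zero_rpow hs.ne']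
    exact circleAverage_nonneg_of_nonneg fun z _ => by positivity
  have hsph := hf.mono Metric.sphere_subset_closedBall
  have hint := hsph.meromorphicOn.circleIntegrable_log_norm
  set A := ‖f c‖ ^ s with hA
  have hcpos : 0 < ‖f c‖ := norm_pos_iff.2 hc
  have hcont : ContinuousOn (fun z => ‖f z‖ ^ s) (Metric.sphere c |R|) :=
    (hsph.continuousOn.norm).rpow_const fun _ _ => Or.inr hs.le
  set φ : ℂ → ℝ := fun z => A * (1 + s * (Real.log ‖f z‖ - Real.log ‖f c‖)) with hφ
  have hφint : CircleIntegrable φ c R := by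
    have h1 : CircleIntegrable (fun z => Real.log ‖f z‖ - Real.log ‖f c‖) c R :=
      hint.sub (circleIntegrable_const _ _ _)
    have h2 : CircleIntegrable (fun z => 1 + s * (Real.log ‖f z‖ - Real.log ‖f c‖)) c R :=
      (circleIntegrable_const (1 : ℝ) c R).add (h1.const_smul (a := s))
    exact h2.const_smul (a := A)
  have hφavg : circleAverage φ c R
      = A * (1 + s * (circleAverage (fun z => Real.log ‖f z‖) c R - Real.log ‖f c‖)) := by
    have h1 : CircleIntegrable (fun z => Real.log ‖f z‖ - Real.log ‖f c‖) c R :=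
      hint.sub (circleIntegrable_const _ _ _)
    have e1 : circleAverage φ c R = A • circleAverage
        (fun z => 1 + s • (Real.log ‖f z‖ - Real.log ‖f c‖)) c R := by
      rw [← circleAverage_fun_smul]; rfl
    have h2 : CircleIntegrable (fun z => s • (Real.log ‖f z‖ - Real.log ‖f c‖)) c R :=
      h1.const_smul (a := s)
    rw [e1, circleAverage_fun_add (circleIntegrable_const _ _ _) h2, circleAverage_fun_smul,
      circleAverage_fun_sub hint (circleIntegrable_const _ _ _),
      circleAverage_const, circleAverage_const]
    simp
  have hlog := log_norm_le_circleAverage hR hf hc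
  have h1 : A ≤ circleAverage φ c R := by
    rw [hφavg]
    have : 0 ≤ A * (s * (circleAverage (fun z => Real.log ‖f z‖) c R - Real.log ‖f c‖)) := by
      have := sub_nonneg.2 hlog
      positivity
    linarith
  refine h1.trans ?_
  -- At a zero of f the identity |f|^s = exp(s log|f|) fails, since `Real.log 0 = 0`. The
  -- nonvanishing set is codiscrete, so circle averages do not see this.
  have hcod : f ⁻¹' {0}ᶜ ∈ Filter.codiscreteWithin (Metric.sphere c |R|) :=
    Filter.codiscreteWithin_mono Metric.sphere_subset_closedBall
      (hf.preimage_zero_mem_codiscreteWithin hc (by simp)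
        ((convex_closedBall c |R|).isConnected (by simp)))
  have hcongr : circleAverage (fun z => ‖f z‖ ^ s) c R
      = circleAverage (fun z => Real.exp (s * Real.log ‖f z‖)) c R := by
    refine circleAverage_congr_codiscreteWithin ?_ hR
    filter_upwards [hcod] with z hz
    rw [rpow_def_of_pos (norm_pos_iff.2 hz), mul_comm]
  rw [hcongr]
  have hexpint : CircleIntegrable (fun z => Real.exp (s * Real.log ‖f z‖)) c R := by
    refine CircleIntegrable.congr_codiscreteWithin (f₁ := fun z => ‖f z‖ ^ s) ?_
      hcont.circleIntegrable'
    filter_upwards [hcod] with z hz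
    rw [rpow_def_of_pos (norm_pos_iff.2 hz), mul_comm]
  refine circleAverage_mono hφint hexpint fun z _ => ?_
  have hAe : A = Real.exp (s * Real.log ‖f c‖) := by
    rw [hA, rpow_def_of_pos hcpos, mul_comm]
  have := Real.add_one_le_exp (s * Real.log ‖f z‖ - s * Real.log ‖f c‖)
  have h3 : Real.exp (s * Real.log ‖f z‖) = A * Real.exp (s * Real.log ‖f z‖ - s * Real.log ‖f c‖) := by
    rw [hAe, ← Real.exp_add]; ring_nf
  rw [h3, hφ]
  have hA0 : 0 ≤ A := by positivity
  exact mul_le_mul_of_nonneg_left (by linarith) hA0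

/-- The sub-mean value property on a circle, as a lower Lebesgue integral. -/
lemma enorm_rpow_le_lintegral {f : ℂ → ℂ} {s : ℝ} (hs : 0 < s) {U : Set ℂ} (hU : IsOpen U)
    (hf : DifferentiableOn ℂ f U) {c : ℂ} {r : ℝ} (hr : 0 ≤ r) (hb : Metric.closedBall c r ⊆ U) :
    ‖f c‖ₑ ^ s ≤ ENNReal.ofReal (2 * Real.pi)⁻¹ *
      ∫⁻ θ in Ioc 0 (2 * Real.pi), ‖f (c + r * Complex.exp (θ * Complex.I))‖ₑ ^ s := by
  have hpi := Real.two_pi_pos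
  rcases hr.eq_or_lt with rfl | hr
  · simp only [Complex.ofReal_zero, zero_mul, add_zero, lintegral_const, Measure.restrict_apply,
      MeasurableSet.univ, univ_inter, Real.volume_Ioc, sub_zero]
    rw [mul_comm, mul_assoc, ← ENNReal.ofReal_mul hpi.le, mul_inv_cancel₀ hpi.ne']
    simp
  have han : AnalyticOnNhd ℂ f (Metric.closedBall c |r|) := by
    rw [abs_of_pos hr]
    exact (hf.analyticOnNhd hU).mono hb
  have key := norm_rpow_le_circleAverage hr.ne' hs han
  have hcont : Continuous fun θ : ℝ => ‖f (circleMap c r θ)‖ ^ s := by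
    have : Continuous fun θ : ℝ => f (circleMap c r θ) := by
      refine han.continuousOn.comp_continuous (continuous_circleMap c r) fun θ => ?_
      rw [abs_of_pos hr]; exact circleMap_mem_closedBall c hr.le θ
    exact this.norm.rpow_const fun _ => Or.inr hs.le
  have e1 : ‖f c‖ₑ ^ s = ENNReal.ofReal (‖f c‖ ^ s) := by
    rw [← ofReal_norm, ENNReal.ofReal_rpow_of_nonneg (norm_nonneg _) hs.le]
  rw [e1]
  refine (ENNReal.ofReal_le_ofReal key).trans_eq ?_
  rw [Real.circleAverage_def, smul_eq_mul, ENNReal.ofReal_mul (by positivity),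
    intervalIntegral.integral_of_le hpi.le, ofReal_integral_eq_lintegral_ofReal]
  · congr 1
    refine lintegral_congr fun θ => ?_
    rw [← ofReal_norm, ENNReal.ofReal_rpow_of_nonneg (norm_nonneg _) hs.le]
    rfl
  · exact hcont.integrableOn_Ioc
  · exact Eventually.of_forall fun θ => by positivity

end SubMeanValue

/-! ### Polar coordinates and radial weights -/

section Polar

variable {n : ℕ}

/-- The surface measure of the unit sphere. -/
abbrev surf (n : ℕ) : Measure (Metric.sphere (0 : Cn n) 1) := (volume : Measure (Cn n)).toSphere

/-- The real dimension of `ℂⁿ`. -/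
abbrev rdim (n : ℕ) : ℕ := Module.finrank ℝ (Cn n)

lemma nontrivial_Cn (hn : 1 ≤ n) : Nontrivial (Cn n) := by
  have : Nonempty (Fin n) := ⟨⟨0, hn⟩⟩
  infer_instance

lemma lintegral_polar (hn : 1 ≤ n) {F : Cn n → ℝ≥0∞} (hF : Measurable F) :
    ∫⁻ z, F z = ∫⁻ r in Ioi (0 : ℝ), ENNReal.ofReal (r ^ (rdim n - 1)) *
      ∫⁻ ζ, F (r • (ζ : Cn n)) ∂(surf n) := by
  have := nontrivial_Cn hn
  have hmp := (volume : Measure (Cn n)).measurePreserving_homeomorphUnitSphereProd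
  have hG : Measurable fun p : Metric.sphere (0 : Cn n) 1 × Ioi (0 : ℝ) =>
      F ((p.2 : ℝ) • (p.1 : Cn n)) := by
    refine hF.comp ?_
    fun_prop
  calc ∫⁻ z, F z = ∫⁻ z in ({0}ᶜ : Set (Cn n)), F z := by
        rw [restrict_compl_singleton]
    _ = ∫⁻ z : ({0}ᶜ : Set (Cn n)), F z ∂(volume.comap Subtype.val) :=
        (lintegral_subtype_comap (measurableSet_singleton _).compl F).symm
    _ = ∫⁻ z : ({0}ᶜ : Set (Cn n)), (fun p : Metric.sphere (0 : Cn n) 1 × Ioi (0 : ℝ) =>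
          F ((p.2 : ℝ) • (p.1 : Cn n))) (homeomorphUnitSphereProd (Cn n) z)
          ∂(volume.comap Subtype.val) := by
        refine lintegral_congr fun z => ?_
        have hz : ‖(z : Cn n)‖ ≠ 0 := norm_ne_zero_iff.2 z.2
        simp [smul_smul, hz]
    _ = ∫⁻ p, F ((p.2 : ℝ) • (p.1 : Cn n))
          ∂((surf n).prod (Measure.volumeIoiPow (rdim n - 1))) := hmp.lintegral_comp hG
    _ = ∫⁻ r, ∫⁻ ζ, F ((r : ℝ) • (ζ : Cn n)) ∂(surf n) ∂(Measure.volumeIoiPow (rdim n - 1)) :=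
        lintegral_prod_symm _ hG.aemeasurable
    _ = _ := by
        have hm : Measurable fun r : ℝ => ∫⁻ ζ, F (r • (ζ : Cn n)) ∂(surf n) := by
          refine Measurable.lintegral_prod_right' (f := fun p : ℝ × Metric.sphere (0 : Cn n) 1 =>
            F (p.1 • (p.2 : Cn n))) (hF.comp ?_)
          fun_prop
        have hm' : Measurable fun r : Ioi (0 : ℝ) =>
            ∫⁻ ζ, F ((r : ℝ) • (ζ : Cn n)) ∂(surf n) := hm.comp measurable_subtype_coe
        rw [Measure.volumeIoiPow, lintegral_withDensity_eq_lintegral_mul _ (by fun_prop) hm']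
        exact lintegral_subtype_comap (μ := volume) measurableSet_Ioi
          (fun r : ℝ => ENNReal.ofReal (r ^ (rdim n - 1)) * ∫⁻ ζ, F (r • (ζ : Cn n)) ∂(surf n))

lemma norm_smul_sphere {r : ℝ} (hr : 0 ≤ r) (ζ : Metric.sphere (0 : Cn n) 1) :
    ‖r • (ζ : Cn n)‖ = r := by
  rw [norm_smul, Real.norm_of_nonneg hr, norm_eq_of_mem_sphere, mul_one]

lemma lintegral_ball_polar (hn : 1 ≤ n) {F : Cn n → ℝ≥0∞} (hF : Measurable F) :
    ∫⁻ z in unitBall n, F z = ∫⁻ r in Ioo (0 : ℝ) 1, ENNReal.ofReal (r ^ (rdim n - 1)) *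
      ∫⁻ ζ, F (r • (ζ : Cn n)) ∂(surf n) := by
  rw [← lintegral_indicator measurableSet_ball, lintegral_polar hn (hF.indicator measurableSet_ball),
    ← Ioi_inter_Iio, inter_comm, ← setLIntegral_indicator measurableSet_Iio]
  refine setLIntegral_congr_fun measurableSet_Ioi fun r hr => ?_
  have hr0 : 0 < r := hr
  by_cases h1 : r < 1
  · simp only [mem_Iio, h1, indicator_of_mem]
    congr 1
    refine lintegral_congr fun ζ => ?_
    rw [indicator_of_mem]
    simpa [norm_smul_sphere hr0.le] using h1
  · rw [indicator_of_notMem (by simpa using h1)]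
    have : ∀ ζ : Metric.sphere (0 : Cn n) 1,
        (unitBall n).indicator F (r • (ζ : Cn n)) = 0 := fun ζ => by
      rw [indicator_of_notMem]
      simpa [norm_smul_sphere hr0.le] using h1
    simp [this]

/-- The normalizing constant of the volume. -/
abbrev ballConst (n : ℕ) : ℝ≥0∞ := (volume (unitBall n))⁻¹

lemma ballConst_pos (n : ℕ) : 0 < ballConst n :=
  ENNReal.inv_pos.2 measure_ball_lt_top.ne

lemma lintegral_weightMeasure (hn : 1 ≤ n) {ω : ℝ → ℝ} (hω : IsRadialWeight n ω)
    {G : Cn n → ℝ≥0∞} (hG : Measurable G) :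
    ∫⁻ z, G z ∂(weightMeasure n ω) = ballConst n * ∫⁻ r in Ioo (0 : ℝ) 1,
      ENNReal.ofReal (ω r) * (ENNReal.ofReal (r ^ (rdim n - 1)) *
        ∫⁻ ζ, G (r • (ζ : Cn n)) ∂(surf n)) := by
  set w : ℝ → ℝ := hω.aemeasurable.mk ω with hw
  have hwm : Measurable w := hω.aemeasurable.measurable_mk
  have hae : ∀ᵐ r ∂(volume.restrict (Ioo (0 : ℝ) 1)), ω r = w r := hω.aemeasurable.ae_eq_mk
  -- ω is only almost everywhere measurable as a function of the radius, so it is replaced by a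
  -- measurable version. By polar coordinates, a null set of radii pulls back to a null set of the
  -- ball.
  have hae' : (fun z : Cn n => ENNReal.ofReal (ω ‖z‖)) =ᵐ[normVolume n]
      fun z => ENNReal.ofReal (w ‖z‖) := by
    obtain ⟨Z, hZ, hZm, hZ0⟩ := exists_measurable_superset_of_null (ae_iff.1 hae)
    have : ∀ᵐ z ∂(volume.restrict (unitBall n)), ω ‖z‖ = w ‖z‖ := by
      rw [ae_iff]
      refine measure_mono_null (t := (fun z : Cn n => ‖z‖) ⁻¹' Z) (fun z hz => hZ hz) ?_
      have hm := measurable_norm (α := Cn n) hZm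
      rw [← lintegral_indicator_one hm, lintegral_ball_polar hn (measurable_one.indicator hm)]
      refine (lintegral_congr_ae (g := fun _ => 0) ?_).trans (by simp)
      have hZae : ∀ᵐ r ∂(volume.restrict (Ioo (0 : ℝ) 1)), r ∉ Z := measure_eq_zero_iff_ae_notMem.1 hZ0
      filter_upwards [hZae, ae_restrict_mem measurableSet_Ioo] with r hr hr1
      have : ∀ ζ : Metric.sphere (0 : Cn n) 1,
          ((fun z : Cn n => ‖z‖) ⁻¹' Z).indicator (1 : Cn n → ℝ≥0∞) (r • (ζ : Cn n)) = 0 := by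
        intro ζ
        rw [indicator_of_notMem]
        simpa [norm_smul_sphere hr1.1.le] using hr
      simp [this]
    have h2 : ∀ᵐ z ∂(normVolume n), ω ‖z‖ = w ‖z‖ := Measure.ae_smul_measure this _
    filter_upwards [h2] with z hz
    rw [hz]
  have hwm' : Measurable fun z : Cn n => ENNReal.ofReal (w ‖z‖) := by fun_prop
  rw [weightMeasure, withDensity_congr_ae hae', lintegral_withDensity_eq_lintegral_mul _ hwm' hG,
    normVolume, lintegral_smul_measure, smul_eq_mul, lintegral_ball_polar hn (hwm'.mul hG)]
  congr 1
  refine lintegral_congr_ae ?_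
  filter_upwards [hae, ae_restrict_mem measurableSet_Ioo] with r hr hr1
  simp only [Pi.mul_apply, norm_smul_sphere hr1.1.le]
  have hGm : Measurable fun ζ : Metric.sphere (0 : Cn n) 1 => G (r • (ζ : Cn n)) :=
    hG.comp (by fun_prop)
  rw [lintegral_const_mul _ hGm, hr]
  ring

end Polar

/-! ### Doubling of nonisotropic caps -/

section Caps

variable {n : ℕ}

/-- The nonisotropic cap on the sphere. -/
def cap (ξ : Cn n) (h : ℝ) : Set (Metric.sphere (0 : Cn n) 1) :=
  {η | ‖1 - inner ℂ (η : Cn n) ξ‖ ≤ h}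

/-- A circular nonisotropic neighbourhood of the origin. -/
def ellip (ξ : Cn n) (h : ℝ) : Set (Cn n) := {v | ‖inner ℂ v ξ‖ < h ∧ ‖v‖ ^ 2 < h}

lemma measurableSet_cap (ξ : Cn n) (h : ℝ) : MeasurableSet (cap ξ h) := by
  have : Continuous fun η : Metric.sphere (0 : Cn n) 1 => ‖1 - inner ℂ (η : Cn n) ξ‖ := by fun_prop
  exact measurableSet_le this.measurable measurable_const

lemma cap_mono (ξ : Cn n) {h k : ℝ} (hk : h ≤ k) : cap ξ h ⊆ cap ξ k :=
  fun _ hη => le_trans hη hk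

lemma cap_eq_univ {ξ : Cn n} (hξ : ‖ξ‖ = 1) {h : ℝ} (hh : 2 ≤ h) : cap ξ h = univ := by
  refine eq_univ_of_forall fun η => ?_
  have h1 := norm_inner_le_norm (𝕜 := ℂ) (η : Cn n) ξ
  rw [norm_eq_of_mem_sphere, hξ] at h1
  have h2 := norm_sub_le (1 : ℂ) (inner ℂ (η : Cn n) ξ)
  rw [norm_one] at h2
  exact (show ‖1 - inner ℂ (η : Cn n) ξ‖ ≤ h by linarith)

lemma measurableSet_ellip (ξ : Cn n) (h : ℝ) : MeasurableSet (ellip ξ h) := by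
  have h1 : Continuous fun v : Cn n => ‖inner ℂ v ξ‖ := by fun_prop
  have h2 : Continuous fun v : Cn n => ‖v‖ ^ 2 := by fun_prop
  exact (measurableSet_lt h1.measurable measurable_const).inter
    (measurableSet_lt h2.measurable measurable_const)

lemma smul_mem_ellip {ξ v : Cn n} {h : ℝ} (hv : v ∈ ellip ξ h) {u : ℂ} (hu : ‖u‖ ≤ 1) :
    u • v ∈ ellip ξ h := by
  obtain ⟨h1, h2⟩ := hv
  refine ⟨?_, ?_⟩
  · rw [inner_smul_left, norm_mul, RCLike.norm_conj]
    nlinarith [norm_nonneg (inner ℂ v ξ), norm_nonneg u]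
  · rw [norm_smul, mul_pow]
    have : ‖u‖ ^ 2 ≤ 1 := pow_le_one₀ (norm_nonneg _) hu
    nlinarith [sq_nonneg ‖v‖]

/-- Halving a vector maps the set of parameter 2h into that of parameter h, so the homogeneity of
Lebesgue measure gives doubling without computing a volume. Caps inherit it by comparison. -/
lemma volume_ellip_two_mul_le (ξ : Cn n) (h : ℝ) :
    volume (ellip ξ (2 * h)) ≤ 2 ^ rdim n * volume (ellip ξ h) := by
  rcases le_or_gt h 0 with h0 | h0
  · have : ellip ξ (2 * h) = ∅ := by
      refine eq_empty_of_forall_notMem fun v hv => ?_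
      have := (norm_nonneg _).trans_lt hv.1
      linarith
    simp [this]
  have hsub : ellip ξ (2 * h) ⊆ (fun v => (2⁻¹ : ℝ) • v) ⁻¹' ellip ξ h := by
    rintro v ⟨h1, h2⟩
    refine ⟨?_, ?_⟩
    · rw [inner_real_smul_left', norm_mul]
      simp only [Complex.norm_real, norm_inv, Real.norm_ofNat]
      linarith
    · rw [norm_smul, mul_pow]
      simp only [norm_inv, Real.norm_ofNat]
      linarith
  refine (measure_mono hsub).trans_eq ?_
  rw [Measure.addHaar_preimage_smul _ (by norm_num)]
  congr 1
  rw [inv_pow, inv_inv, abs_of_pos (by positivity), ENNReal.ofReal_pow (by norm_num)]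
  simp

lemma volume_ellip_two_pow_mul_le (ξ : Cn n) (h : ℝ) (k : ℕ) :
    volume (ellip ξ (2 ^ k * h)) ≤ 2 ^ (k * rdim n) * volume (ellip ξ h) := by
  induction k with
  | zero => simp
  | succ k ih =>
    calc volume (ellip ξ (2 ^ (k + 1) * h)) = volume (ellip ξ (2 * (2 ^ k * h))) := by
          rw [pow_succ']; ring_nf
      _ ≤ 2 ^ rdim n * (2 ^ (k * rdim n) * volume (ellip ξ h)) :=
          (volume_ellip_two_mul_le _ _).trans (by gcongr)
      _ = _ := by rw [← mul_assoc, ← pow_add]; ring_nf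

lemma ellip_mono (ξ : Cn n) {h k : ℝ} (hk : h ≤ k) : ellip ξ h ⊆ ellip ξ k :=
  fun _ hv => ⟨hv.1.trans_le hk, hv.2.trans_le hk⟩

lemma volume_preimage_sub (a : Cn n) (A : Set (Cn n)) :
    volume ((fun z => z - a) ⁻¹' A) = volume A := by
  simpa only [sub_eq_add_neg] using measure_preimage_add_right volume (-a) A

/-- The cone over the cap, cut to radii in (1 - h/4, 1), lies in the translate of `ellip ξ (4 * h)`
by ξ. These radii exceed 1/2 because h ≤ 2, so the Jacobian costs only a power of 2. -/
lemma mul_surf_cap_le (hn : 1 ≤ n) {ξ : Cn n} (hξ : ‖ξ‖ = 1) {h : ℝ} (h0 : 0 < h) (h2 : h ≤ 2) :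
    ENNReal.ofReal h * surf n (cap ξ h) ≤ 2 ^ (rdim n + 1) * volume (ellip ξ (4 * h)) := by
  set A := (fun z => z - ξ) ⁻¹' ellip ξ (4 * h) with hA
  have hAm : MeasurableSet A := (measurable_sub_const ξ) (measurableSet_ellip _ _)
  have hmem : ∀ r ∈ Ioo (1 - h / 4) 1, ∀ η ∈ cap ξ h, r • (η : Cn n) ∈ A := by
    intro r hr η hη
    have hη' : ‖1 - inner ℂ (η : Cn n) ξ‖ ≤ h := hη
    have hr0 : 0 < r := by linarith [hr.1]
    refine ⟨?_, ?_⟩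
    · have e : inner ℂ (r • (η : Cn n) - ξ) ξ
          = -(((1 - r : ℝ) : ℂ) + (r : ℂ) * (1 - inner ℂ (η : Cn n) ξ)) := by
        rw [inner_sub_left, inner_real_smul_left', inner_self_eq_norm_sq_to_K, hξ]
        push_cast
        simp only [one_pow]
        ring
      rw [e, norm_neg]
      refine (norm_add_le _ _).trans_lt ?_
      rw [norm_mul, Complex.norm_real, Complex.norm_real, Real.norm_of_nonneg (by linarith [hr.2]),
        Real.norm_of_nonneg hr0.le]
      nlinarith [hr.1, hr.2, norm_nonneg (1 - inner ℂ (η : Cn n) ξ)]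
    · have e := norm_sub_sq (𝕜 := ℂ) (r • (η : Cn n)) ξ
      rw [norm_smul_sphere hr0.le, hξ, inner_real_smul_left', RCLike.re_eq_complex_re,
        Complex.re_ofReal_mul] at e
      have hre : 1 - (inner ℂ (η : Cn n) ξ).re ≤ h :=
        le_trans (by simpa using Complex.re_le_norm (1 - inner ℂ (η : Cn n) ξ)) hη'
      have h1 : (1 - r) ^ 2 < h / 8 := by nlinarith [hr.1, hr.2]
      have h2 : r * (1 - (inner ℂ (η : Cn n) ξ).re) ≤ h := by nlinarith [hr.2]
      rw [e]
      nlinarith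
  have hV : ENNReal.ofReal (h / 4) * (ENNReal.ofReal ((1 / 2) ^ (rdim n - 1)) * surf n (cap ξ h))
      ≤ volume A := by
    rw [← lintegral_indicator_one hAm, lintegral_polar hn (measurable_one.indicator hAm)]
    have hsub : Ioo (1 - h / 4) 1 ⊆ Ioi (0 : ℝ) := fun r hr => by
      have := hr.1
      simp only [mem_Ioi]; linarith
    refine le_trans ?_ (lintegral_mono_set hsub)
    calc _ = ∫⁻ r in Ioo (1 - h / 4) 1,
            ENNReal.ofReal ((1 / 2) ^ (rdim n - 1)) * surf n (cap ξ h) := by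
          rw [setLIntegral_const, Real.volume_Ioo, mul_comm]
          congr 2; ring
      _ ≤ _ := by
          refine setLIntegral_mono' measurableSet_Ioo fun r hr => ?_
          gcongr
          · linarith [hr.1]
          · rw [← lintegral_indicator_one (measurableSet_cap ξ h)]
            refine lintegral_mono fun η => ?_
            by_cases hη : η ∈ cap ξ h
            · rw [indicator_of_mem hη, indicator_of_mem (hmem r hr η hη)]; simp
            · rw [indicator_of_notMem hη]; exact zero_le
  rw [hA, volume_preimage_sub] at hV
  refine le_trans (le_of_eq ?_) (mul_le_mul_right hV (2 ^ (rdim n + 1)))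
  have hN : 1 ≤ rdim n := by
    have := nontrivial_Cn hn
    exact Module.finrank_pos
  have e2 : (2 : ℝ≥0∞) ^ (rdim n + 1) = ENNReal.ofReal (2 ^ (rdim n + 1)) := by
    rw [ENNReal.ofReal_pow (by norm_num)]; simp
  rw [e2, ← mul_assoc, ← mul_assoc, ← ENNReal.ofReal_mul (by positivity),
    ← ENNReal.ofReal_mul (by positivity)]
  congr 2
  obtain ⟨m, hm⟩ : ∃ m, rdim n = m + 1 := ⟨rdim n - 1, by omega⟩
  rw [hm]
  simp only [Nat.add_sub_cancel, one_div, inv_pow, pow_succ]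
  field_simp
  norm_num

/-- Translates of `ellip` by a point of the ball stay in a thin shell. -/
lemma norm_add_ellip_bounds {ξ v : Cn n} (hξ : ‖ξ‖ = 1) {h : ℝ} (h0 : 0 < h) (h1 : h ≤ 1)
    (hv : v ∈ ellip ξ (h / 4)) :
    1 - 5 * h / 4 < ‖(1 - h) • ξ + v‖ ∧ ‖(1 - h) • ξ + v‖ ≤ 1 - h / 8 ∧
      ‖1 - inner ℂ ((1 - h) • ξ + v) ξ‖ ≤ 5 * h / 4 := by
  obtain ⟨hv1, hv2⟩ := hv
  have e : inner ℂ ((1 - h) • ξ + v) ξ = ((1 - h : ℝ) : ℂ) + inner ℂ v ξ := by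
    rw [inner_add_left, inner_real_smul_left', inner_self_eq_norm_sq_to_K, hξ]; simp
  refine ⟨?_, ?_, ?_⟩
  · have hb : ‖inner ℂ ((1 - h) • ξ + v) ξ‖ ≤ ‖(1 - h) • ξ + v‖ := by
      have := norm_inner_le_norm (𝕜 := ℂ) ((1 - h) • ξ + v) ξ
      rwa [hξ, mul_one] at this
    have hc : (1 - h) - ‖inner ℂ v ξ‖ ≤ ‖inner ℂ ((1 - h) • ξ + v) ξ‖ := by
      rw [e]
      have := norm_sub_norm_le ((1 - h : ℝ) : ℂ) (-inner ℂ v ξ)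
      rwa [norm_neg, sub_neg_eq_add, Complex.norm_real, Real.norm_of_nonneg (by linarith)] at this
    linarith
  · have hs := norm_add_sq (𝕜 := ℂ) ((1 - h) • ξ) v
    rw [norm_smul, hξ, Real.norm_of_nonneg (by linarith : (0 : ℝ) ≤ 1 - h), inner_real_smul_left',
      RCLike.re_eq_complex_re, Complex.re_ofReal_mul] at hs
    have hre : (inner ℂ ξ v).re ≤ h / 4 := by
      refine (Complex.re_le_norm _).trans ?_
      rw [norm_inner_symm]; exact hv1.le
    refine abs_le_of_sq_le_sq' ?_ (by linarith) |>.2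
    rw [hs]
    nlinarith [mul_le_mul_of_nonneg_left hre (by linarith : (0 : ℝ) ≤ 1 - h)]
  · rw [e]
    have : 1 - (((1 - h : ℝ) : ℂ) + inner ℂ v ξ) = ((h : ℝ) : ℂ) - inner ℂ v ξ := by
      push_cast; ring
    rw [this]
    refine (norm_sub_le _ _).trans ?_
    rw [Complex.norm_real, Real.norm_of_nonneg h0.le]
    linarith

lemma lintegral_pow_le {a b : ℝ} (hb : b ≤ 1) {k : ℕ} {φ : ℝ → ℝ≥0∞} {c : ℝ≥0∞}
    (hφ : ∀ r ∈ Ioi (0 : ℝ), r ∈ Ioc a b → φ r ≤ c)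
    (hφ0 : ∀ r ∈ Ioi (0 : ℝ), r ∉ Ioc a b → φ r = 0) :
    ∫⁻ r in Ioi (0 : ℝ), ENNReal.ofReal (r ^ k) * φ r ≤ ENNReal.ofReal (b - a) * c := by
  calc _ ≤ ∫⁻ r in Ioi (0 : ℝ), (Ioc a b).indicator (fun _ => c) r := by
        refine setLIntegral_mono' measurableSet_Ioi fun r hr => ?_
        have hr0 : 0 < r := hr
        by_cases hm : r ∈ Ioc a b
        · rw [indicator_of_mem hm]
          have : ENNReal.ofReal (r ^ k) ≤ 1 := by
            rw [ENNReal.ofReal_le_one]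
            exact pow_le_one₀ hr0.le (hm.2.trans hb)
          calc _ ≤ 1 * c := by gcongr; exact hφ r hr hm
            _ = c := one_mul c
        · rw [hφ0 r hr hm]; simp
    _ ≤ ∫⁻ r, (Ioc a b).indicator (fun _ => c) r := setLIntegral_le_lintegral _ _
    _ = _ := by
        rw [lintegral_indicator_const measurableSet_Ioc, Real.volume_Ioc, mul_comm]

/-- Converse comparison: the translate of `ellip ξ (h / 4)` by (1 - h)ξ lies in a shell of thickness
5h/4, over the cap of size 5h/2. -/
lemma volume_ellip_le (hn : 1 ≤ n) {ξ : Cn n} (hξ : ‖ξ‖ = 1) {h : ℝ} (h0 : 0 < h) (h1 : h ≤ 1) :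
    volume (ellip ξ (h / 4)) ≤ ENNReal.ofReal (5 * h / 4) * surf n (cap ξ (5 * h / 2)) := by
  set a := (1 - h) • ξ
  set A := (fun z => z - a) ⁻¹' ellip ξ (h / 4) with hA
  have hAm : MeasurableSet A := (measurable_sub_const a) (measurableSet_ellip _ _)
  have hmem : ∀ r ∈ Ioi (0 : ℝ), ∀ η : Metric.sphere (0 : Cn n) 1, r • (η : Cn n) ∈ A →
      r ∈ Ioc (1 - 5 * h / 4) 1 ∧ η ∈ cap ξ (5 * h / 2) := by
    intro r hr η hη
    have hr0 : 0 < r := hr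
    have hb := norm_add_ellip_bounds hξ h0 h1 hη
    rw [add_sub_cancel, norm_smul_sphere hr0.le] at hb
    obtain ⟨b1, b2, b3⟩ := hb
    refine ⟨⟨b1, by linarith⟩, ?_⟩
    have hx : ‖inner ℂ (η : Cn n) ξ‖ ≤ 1 := by
      simpa [hξ] using norm_inner_le_norm (𝕜 := ℂ) (η : Cn n) ξ
    rw [inner_real_smul_left'] at b3
    have e : 1 - inner ℂ (η : Cn n) ξ = (1 - (r : ℂ) * inner ℂ (η : Cn n) ξ)
        - ((1 - r : ℝ) : ℂ) * inner ℂ (η : Cn n) ξ := by push_cast; ring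
    show ‖1 - inner ℂ (η : Cn n) ξ‖ ≤ 5 * h / 2
    rw [e]
    refine (norm_sub_le _ _).trans ?_
    rw [norm_mul, Complex.norm_real, Real.norm_of_nonneg (by linarith)]
    nlinarith [norm_nonneg (inner ℂ (η : Cn n) ξ)]
  rw [← volume_preimage_sub a, ← hA, ← lintegral_indicator_one hAm,
    lintegral_polar hn (measurable_one.indicator hAm)]
  have := lintegral_pow_le (a := 1 - 5 * h / 4) (b := 1) (k := rdim n - 1)
    (φ := fun r => ∫⁻ ζ, A.indicator (1 : Cn n → ℝ≥0∞) (r • (ζ : Cn n)) ∂(surf n))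
    (c := surf n (cap ξ (5 * h / 2))) le_rfl ?_ ?_
  · rwa [sub_sub_cancel] at this
  · intro r hr _
    rw [← lintegral_indicator_one (measurableSet_cap ξ _)]
    refine lintegral_mono fun η => ?_
    by_cases hη : r • (η : Cn n) ∈ A
    · rw [indicator_of_mem hη, indicator_of_mem (hmem r hr η hη).2]; simp
    · rw [indicator_of_notMem hη]; exact zero_le
  · intro r hr hr'
    refine (lintegral_congr (g := fun _ => 0) fun η => ?_).trans (by simp)
    exact indicator_of_notMem (fun hη => hr' (hmem r hr η hη).1) _

lemma surf_cap_two_mul_le (hn : 1 ≤ n) {ξ : Cn n} (hξ : ‖ξ‖ = 1) {h : ℝ} (h0 : 0 < h)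
    (h1 : h ≤ 1) : surf n (cap ξ (2 * h)) ≤ 2 ^ (8 * rdim n) * surf n (cap ξ h) := by
  have hN : 1 ≤ rdim n := by
    have := nontrivial_Cn hn
    exact Module.finrank_pos
  have a1 := mul_surf_cap_le hn hξ (h := 2 * h) (by linarith) (by linarith)
  have a2 := volume_ellip_two_pow_mul_le ξ (h / 10) 7
  -- The size 2h/5 makes the resulting cap exactly `cap ξ h`. Its set has parameter h/10, and seven
  -- doublings suffice because 8h ≤ 2^7 · h/10.
  have a3 := volume_ellip_le hn hξ (h := 2 * h / 5) (by linarith) (by linarith)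
  rw [show 2 * h / 5 / 4 = h / 10 by ring, show 5 * (2 * h / 5) / 4 = h / 2 by ring,
    show 5 * (2 * h / 5) / 2 = h by ring] at a3
  have a4 : volume (ellip ξ (4 * (2 * h))) ≤ volume (ellip ξ (2 ^ 7 * (h / 10))) :=
    measure_mono (ellip_mono ξ (by linarith))
  have hne : ENNReal.ofReal (2 * h) ≠ 0 := by simp [h0]
  have key : ENNReal.ofReal (2 * h) * surf n (cap ξ (2 * h)) ≤
      ENNReal.ofReal (2 * h) * (2 ^ (8 * rdim n) * surf n (cap ξ h)) := by
    calc _ ≤ 2 ^ (rdim n + 1) * (2 ^ (7 * rdim n) *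
          (ENNReal.ofReal (h / 2) * surf n (cap ξ h))) := by
          refine a1.trans ?_
          gcongr
          exact a4.trans (a2.trans (by gcongr))
      _ = (2 ^ (8 * rdim n) * surf n (cap ξ h)) * (2 * ENNReal.ofReal (h / 2)) := by
          rw [show 8 * rdim n = rdim n + 7 * rdim n by ring, pow_add 2 (rdim n) (7 * rdim n),
            pow_succ]
          ring
      _ ≤ (2 ^ (8 * rdim n) * surf n (cap ξ h)) * ENNReal.ofReal (2 * h) := by
          gcongr
          rw [← ENNReal.ofReal_ofNat 2, ← ENNReal.ofReal_mul (by norm_num)]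
          exact ENNReal.ofReal_le_ofReal (by linarith)
      _ = _ := mul_comm _ _
  exact (ENNReal.mul_le_mul_iff_right hne ENNReal.ofReal_ne_top).1 key

end Caps

/-! ### Sphere means: subharmonicity and monotonicity -/

section SphereMeans

variable {n : ℕ}

lemma enorm_rpow_eq_ofReal (x : ℂ) {s : ℝ} (hs : 0 ≤ s) : ‖x‖ₑ ^ s = ENNReal.ofReal (‖x‖ ^ s) := by
  rw [← ofReal_norm, ENNReal.ofReal_rpow_of_nonneg (norm_nonneg _) hs]

/-- Scalar multiplication by a unimodular number. -/
def rotation (n : ℕ) (u : Circle) : Cn n ≃ₗᵢ[ℝ] Cn n :=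
  LinearIsometryEquiv.mk
    { toFun := fun z => (u : ℂ) • z
      invFun := fun z => ((u⁻¹ : Circle) : ℂ) • z
      left_inv := fun z => by simp [smul_smul]
      right_inv := fun z => by simp [smul_smul]
      map_add' := fun x y => smul_add _ _ _
      map_smul' := fun c x => smul_comm _ _ _ } (fun z => by simp [norm_smul, Circle.norm_coe])

lemma measurePreserving_rotation (u : Circle) :
    MeasurePreserving (fun z : Cn n => (u : ℂ) • z) volume volume :=
  (rotation n u).measurePreserving

/-- The invariance is inherited from volume: extend G to the ball as z ↦ G(z/‖z‖), rotate there, and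
cancel the finite nonzero radial factor c. -/
lemma lintegral_sphere_rotation (hn : 1 ≤ n) {G : Cn n → ℝ≥0∞} (hG : Measurable G) (u : Circle) :
    ∫⁻ ζ, G ((u : ℂ) • (ζ : Cn n)) ∂(surf n) = ∫⁻ ζ, G (ζ : Cn n) ∂(surf n) := by
  set c : ℝ≥0∞ := ∫⁻ r in Ioo (0 : ℝ) 1, ENNReal.ofReal (r ^ (rdim n - 1)) with hc
  have hmeas : ∀ G : Cn n → ℝ≥0∞, Measurable G → Measurable fun z : Cn n => G (‖z‖⁻¹ • z) :=
    fun G hG => hG.comp (by fun_prop)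
  have key : ∀ G : Cn n → ℝ≥0∞, Measurable G →
      ∫⁻ z in unitBall n, G (‖z‖⁻¹ • z) = c * ∫⁻ ζ, G (ζ : Cn n) ∂(surf n) := by
    intro G hG
    rw [lintegral_ball_polar hn (hmeas G hG), hc, ← lintegral_mul_const _ (by fun_prop)]
    refine setLIntegral_congr_fun measurableSet_Ioo fun r hr => ?_
    congr 1
    refine lintegral_congr fun ζ => ?_
    rw [norm_smul_sphere hr.1.le, inv_smul_smul₀ hr.1.ne']
  have hGu : Measurable fun z : Cn n => G ((u : ℂ) • z) := hG.comp (by fun_prop)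
  have h1 := key _ hGu
  have h2 := key G hG
  have h3 : ∫⁻ z in unitBall n, G ((u : ℂ) • (‖z‖⁻¹ • z)) = ∫⁻ z in unitBall n, G (‖z‖⁻¹ • z) := by
    have hpre : (fun z : Cn n => (u : ℂ) • z) ⁻¹' unitBall n = unitBall n := by
      ext z; simp [norm_smul, Circle.norm_coe]
    rw [← (measurePreserving_rotation u).setLIntegral_comp_preimage measurableSet_ball (hmeas G hG),
      hpre]
    refine lintegral_congr fun z => ?_
    rw [norm_smul, Circle.norm_coe, one_mul, smul_comm]
  have hc0 : c ≠ 0 := by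
    rw [hc, Ne, lintegral_eq_zero_iff (by fun_prop)]
    intro h
    have : ∀ᵐ r ∂(volume.restrict (Ioo (0 : ℝ) 1)), False := by
      filter_upwards [h, ae_restrict_mem measurableSet_Ioo] with r hr hr1
      have : 0 < r ^ (rdim n - 1) := pow_pos hr1.1 _
      simp only [Pi.zero_apply, ENNReal.ofReal_eq_zero] at hr
      linarith
    rw [ae_iff] at this
    simp at this
  have hct : c ≠ ∞ := by
    refine ne_top_of_le_ne_top (b := 1) ENNReal.one_ne_top ?_
    calc c ≤ ∫⁻ _ in Ioo (0 : ℝ) 1, 1 := setLIntegral_mono' measurableSet_Ioo fun r hr => by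
          rw [ENNReal.ofReal_le_one]; exact pow_le_one₀ hr.1.le hr.2.le
      _ = 1 := by simp
  rw [h1, h2] at h3
  exact (ENNReal.mul_right_inj hc0 hct).1 h3

/-- The `s`-mean of `f` over the sphere of radius `|l|`. -/
def sphereMean (f : Cn n → ℂ) (s : ℝ) (l : ℂ) : ℝ := ∫ ζ, ‖f (l • (ζ : Cn n))‖ ^ s ∂(surf n)

lemma smul_sphere_mem_ball {l : ℂ} (hl : ‖l‖ < 1) (ζ : Metric.sphere (0 : Cn n) 1) :
    l • (ζ : Cn n) ∈ unitBall n := by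
  simpa [norm_smul] using hl

variable {f : Cn n → ℂ} {s : ℝ}

lemma continuousOn_sphereMean (hs : 0 < s) (hf : ContinuousOn f (unitBall n)) :
    ContinuousOn (sphereMean f s) (Metric.ball 0 1) := by
  rw [continuousOn_iff_continuous_domRestrict]
  have hc : Continuous fun p : Metric.ball (0 : ℂ) 1 × Metric.sphere (0 : Cn n) 1 =>
      ‖f ((p.1 : ℂ) • (p.2 : Cn n))‖ ^ s := by
    have : Continuous fun p : Metric.ball (0 : ℂ) 1 × Metric.sphere (0 : Cn n) 1 =>
        f ((p.1 : ℂ) • (p.2 : Cn n)) :=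
      hf.comp_continuous (by fun_prop) fun p => smul_sphere_mem_ball (mem_ball_zero_iff.1 p.1.2) p.2
    exact this.norm.rpow_const fun _ => Or.inr hs.le
  have : LocallyCompactSpace (Metric.ball (0 : ℂ) 1) := Metric.isOpen_ball.locallyCompactSpace
  have := continuous_parametric_integral_of_continuous (μ := surf n)
    (f := fun (l : Metric.ball (0 : ℂ) 1) (ζ : Metric.sphere (0 : Cn n) 1) =>
      ‖f ((l : ℂ) • (ζ : Cn n))‖ ^ s) hc isCompact_univ
  simp only [Measure.restrict_univ] at this
  exact this

lemma ofReal_sphereMean (hs : 0 < s) (hf : ContinuousOn f (unitBall n)) {l : ℂ} (hl : ‖l‖ < 1) :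
    ENNReal.ofReal (sphereMean f s l) = ∫⁻ ζ, ‖f (l • (ζ : Cn n))‖ₑ ^ s ∂(surf n) := by
  have hc : Continuous fun ζ : Metric.sphere (0 : Cn n) 1 => ‖f (l • (ζ : Cn n))‖ ^ s := by
    have : Continuous fun ζ : Metric.sphere (0 : Cn n) 1 => f (l • (ζ : Cn n)) :=
      hf.comp_continuous (by fun_prop) fun p => smul_sphere_mem_ball hl p
    exact this.norm.rpow_const fun _ => Or.inr hs.le
  rw [sphereMean, ofReal_integral_eq_lintegral_ofReal]
  · simp_rw [enorm_rpow_eq_ofReal _ hs.le]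
  · exact hc.integrable_of_hasCompactSupport (HasCompactSupport.of_compactSpace _)
  · exact Eventually.of_forall fun _ => by positivity

lemma measurable_indicator_ball (hf : ContinuousOn f (unitBall n)) (s : ℝ) :
    Measurable ((unitBall n).indicator fun z => ‖f z‖ₑ ^ s) := by
  classical
  have h : Measurable ((unitBall n).indicator f) := by
    have := ContinuousOn.measurable_piecewise hf (continuousOn_const (c := (0 : ℂ))
      (s := (unitBall n)ᶜ)) measurableSet_ball
    convert this using 1
    ext z
    by_cases hz : z ∈ unitBall n <;> simp [hz, indicator_of_mem, indicator_of_notMem]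
  have h2 : Measurable ((unitBall n).indicator (fun z => ‖(unitBall n).indicator f z‖ₑ ^ s)) :=
    (h.enorm.pow_const s).indicator measurableSet_ball
  convert h2 using 1
  ext z
  by_cases hz : z ∈ unitBall n <;> simp [hz, indicator_of_mem, indicator_of_notMem]

lemma sphereMean_eq_norm (hn : 1 ≤ n) (hs : 0 < s) (hf : ContinuousOn f (unitBall n)) {l : ℂ}
    (hl : ‖l‖ < 1) : sphereMean f s l = sphereMean f s (‖l‖ : ℂ) := by
  have hnn : ∀ l, 0 ≤ sphereMean f s l := fun l => integral_nonneg fun _ => by positivity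
  have hl' : ‖((‖l‖ : ℝ) : ℂ)‖ < 1 := by simpa using hl
  rw [← ENNReal.ofReal_eq_ofReal_iff (hnn _) (hnn _), ofReal_sphereMean hs hf hl,
    ofReal_sphereMean hs hf hl']
  obtain ⟨u, hu⟩ : ∃ u : Circle, l = (‖l‖ : ℂ) * u := by
    refine ⟨Circle.exp (Complex.arg l), ?_⟩
    rw [Circle.coe_exp]
    exact (Complex.norm_mul_exp_arg_mul_I l).symm
  set H := (unitBall n).indicator fun z => ‖f z‖ₑ ^ s with hH
  have hHm : Measurable fun z : Cn n => H ((‖l‖ : ℂ) • z) :=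
    (measurable_indicator_ball hf s).comp (by fun_prop)
  have key := lintegral_sphere_rotation hn hHm u
  have e : ∀ (k : ℂ) (hk : ‖k‖ < 1) (ζ : Metric.sphere (0 : Cn n) 1),
      H (k • (ζ : Cn n)) = ‖f (k • (ζ : Cn n))‖ₑ ^ s :=
    fun k hk ζ => indicator_of_mem (smul_sphere_mem_ball hk ζ) _
  simp_rw [smul_smul, ← hu, e l hl, e _ hl'] at key
  exact key

lemma differentiableOn_slice (hf : DifferentiableOn ℂ f (unitBall n)) (a v : Cn n) :
    DifferentiableOn ℂ (fun l : ℂ => f (a + l • v)) {l | a + l • v ∈ unitBall n} := by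
  refine hf.comp (Differentiable.differentiableOn ?_) fun l hl => hl
  fun_prop

lemma isOpen_slice (a v : Cn n) : IsOpen {l : ℂ | a + l • v ∈ unitBall n} :=
  Metric.isOpen_ball.preimage (by fun_prop)

/-- Each slice l ↦ f(lζ) is holomorphic on the disc, so its s-th power obeys the sub-mean value
inequality; integrating over ζ and exchanging the integrals passes this to the mean. -/
lemma sphereMean_le_integral (hs : 0 < s) (hf : DifferentiableOn ℂ f (unitBall n)) {c : ℂ} {r : ℝ}
    (hr : 0 ≤ r) (hcr : ‖c‖ + r < 1) :
    sphereMean f s c ≤ (2 * Real.pi)⁻¹ *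
      ∫ θ in (0 : ℝ)..2 * Real.pi, sphereMean f s (c + r * Complex.exp (θ * Complex.I)) := by
  have hpi := Real.two_pi_pos
  have hfc := hf.continuousOn
  have hnn : ∀ l, 0 ≤ sphereMean f s l := fun l => integral_nonneg fun _ => by positivity
  have hlt : ∀ θ : ℝ, ‖c + r * Complex.exp (θ * Complex.I)‖ < 1 := fun θ => by
    refine (norm_add_le _ _).trans_lt ?_
    rw [norm_mul, Complex.norm_exp_ofReal_mul_I, Complex.norm_real, Real.norm_of_nonneg hr]
    linarith
  have hcθ : Continuous fun θ : ℝ => sphereMean f s (c + r * Complex.exp (θ * Complex.I)) :=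
    (continuousOn_sphereMean hs hfc).comp_continuous (by fun_prop) fun θ => by simpa using hlt θ
  have hrhs : 0 ≤ (2 * Real.pi)⁻¹ *
      ∫ θ in (0 : ℝ)..2 * Real.pi, sphereMean f s (c + r * Complex.exp (θ * Complex.I)) :=
    mul_nonneg (by positivity) (intervalIntegral.integral_nonneg hpi.le fun θ _ => hnn _)
  rw [← ENNReal.ofReal_le_ofReal_iff hrhs, ofReal_sphereMean hs hfc (by linarith),
    ENNReal.ofReal_mul (by positivity), intervalIntegral.integral_of_le hpi.le,
    ofReal_integral_eq_lintegral_ofReal hcθ.integrableOn_Ioc (Eventually.of_forall fun θ => hnn _)]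
  simp_rw [fun θ : ℝ => ofReal_sphereMean hs hfc (hlt θ)]
  have hjoint : Continuous fun p : ℝ × Metric.sphere (0 : Cn n) 1 =>
      ‖f ((c + r * Complex.exp (p.1 * Complex.I)) • (p.2 : Cn n))‖ₑ ^ s := by
    have : Continuous fun p : ℝ × Metric.sphere (0 : Cn n) 1 =>
        f ((c + r * Complex.exp (p.1 * Complex.I)) • (p.2 : Cn n)) :=
      hfc.comp_continuous (by fun_prop) fun p => smul_sphere_mem_ball (hlt p.1) p.2
    exact ENNReal.continuous_rpow_const.comp this.enorm
  rw [lintegral_lintegral_swap hjoint.measurable.aemeasurable,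
    ← lintegral_const_mul' _ _ ENNReal.ofReal_ne_top]
  · refine lintegral_mono fun ζ => ?_
    have hd := differentiableOn_slice hf 0 (ζ : Cn n)
    simp only [zero_add] at hd
    refine enorm_rpow_le_lintegral hs (f := fun l : ℂ => f (l • (ζ : Cn n)))
      (by simpa using isOpen_slice 0 (ζ : Cn n)) hd hr ?_
    intro l hl
    refine smul_sphere_mem_ball ?_ ζ
    have h1 : ‖l - c‖ ≤ r := by simpa [dist_eq_norm] using hl
    have h2 : ‖l‖ ≤ ‖c‖ + ‖l - c‖ := by simpa using norm_add_le c (l - c)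
    linarith

/-- A maximum principle for radial subharmonic functions. If the mean at a exceeded the mean at b,
take a maximizer t on [0, b]: the circle about t through b stays in the closed disc of radius b,
where by radiality the mean is at most its value at t, and it is strictly smaller at the point b.
This contradicts the sub-mean value inequality at t. -/
lemma sphereMean_mono (hn : 1 ≤ n) (hs : 0 < s) (hf : DifferentiableOn ℂ f (unitBall n)) {a b : ℝ}
    (ha : 0 ≤ a) (hab : a ≤ b) (hb : b < 1) :
    sphereMean f s (a : ℂ) ≤ sphereMean f s (b : ℂ) := by
  have hpi := Real.two_pi_pos
  have hcont := continuousOn_sphereMean hs hf.continuousOn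
  have hcr : ContinuousOn (fun t : ℝ => sphereMean f s (t : ℂ)) (Icc 0 b) :=
    hcont.comp Complex.continuous_ofReal.continuousOn fun t ht => by
      simp only [Metric.mem_ball, dist_zero_right, Complex.norm_real, Real.norm_of_nonneg ht.1]
      linarith [ht.2]
  obtain ⟨t, ht, hmax⟩ := isCompact_Icc.exists_isMaxOn (nonempty_Icc.2 (ha.trans hab)) hcr
  have hta : sphereMean f s (a : ℂ) ≤ sphereMean f s (t : ℂ) := hmax ⟨ha, hab⟩
  by_contra hlt
  have hbt : sphereMean f s (b : ℂ) < sphereMean f s (t : ℂ) := (not_le.1 hlt).trans_le hta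
  have htn : ‖(t : ℂ)‖ = t := by rw [Complex.norm_real, Real.norm_of_nonneg ht.1]
  have hsub := sphereMean_le_integral hs hf (c := (t : ℂ)) (r := b - t) (by linarith [ht.2])
    (by rw [htn]; linarith)
  set g : ℝ → ℝ := fun θ => sphereMean f s ((t : ℂ) + (b - t : ℝ) * Complex.exp (θ * Complex.I))
    with hg
  have hnorm : ∀ θ : ℝ, ‖(t : ℂ) + (b - t : ℝ) * Complex.exp (θ * Complex.I)‖ ≤ b := fun θ => by
    refine (norm_add_le _ _).trans ?_
    rw [norm_mul, Complex.norm_exp_ofReal_mul_I, Complex.norm_real (b - t),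
      Real.norm_of_nonneg (by linarith [ht.2]), htn]
    linarith
  have hgc : Continuous g := hcont.comp_continuous (by fun_prop) fun θ => by
    simpa using (hnorm θ).trans_lt hb
  have hgle : ∀ θ, g θ ≤ sphereMean f s (t : ℂ) := fun θ => by
    rw [hg]
    simp only
    rw [sphereMean_eq_norm hn hs hf.continuousOn ((hnorm θ).trans_lt hb)]
    exact hmax ⟨norm_nonneg _, hnorm θ⟩
  have hg0 : g 0 < sphereMean f s (t : ℂ) := by
    simpa [hg] using hbt
  have hlt := intervalIntegral.integral_lt_integral_of_continuousOn_of_le_of_exists_lt hpi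
    hgc.continuousOn (continuousOn_const (c := sphereMean f s (t : ℂ))) (fun θ _ => hgle θ)
    ⟨0, ⟨le_rfl, hpi.le⟩, hg0⟩
  rw [intervalIntegral.integral_const, sub_zero, smul_eq_mul] at hlt
  have := mul_lt_mul_of_pos_left hlt (inv_pos.2 hpi)
  rw [inv_mul_cancel_left₀ hpi.ne'] at this
  exact absurd hsub (not_le.2 this)

end SphereMeans

/-! ### Point values controlled by sphere means -/

section Growth

variable {n : ℕ} {f : Cn n → ℂ} {s : ℝ}

lemma preimage_rotation_ellip (ξ : Cn n) (h : ℝ) (u : Circle) :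
    (fun z : Cn n => (u : ℂ) • z) ⁻¹' ellip ξ h = ellip ξ h := by
  have key : ∀ (w : ℂ), ‖w‖ = 1 → ∀ v ∈ ellip ξ h, w • v ∈ ellip ξ h :=
    fun w hw v hv => smul_mem_ellip hv hw.le
  ext v
  rw [mem_preimage]
  constructor
  · intro hv
    have h2 := key (u : ℂ)⁻¹ (by rw [norm_inv, Circle.norm_coe, inv_one]) _ hv
    have h3 : (u : ℂ) ≠ 0 := Circle.coe_ne_zero u
    rwa [inv_smul_smul₀ h3] at h2
  · exact key _ (Circle.norm_coe u) v

/-- The set is circular, so each of its vectors v spans a disc a + lv, |l| ≤ 1, on which the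
one-variable inequality applies. After integrating over v, rotation invariance of volume makes the
angular average disappear. -/
lemma enorm_rpow_mul_volume_le (hs : 0 < s) (hf : DifferentiableOn ℂ f (unitBall n)) {a : Cn n}
    {ξ : Cn n} {h : ℝ} (hsub : ∀ v ∈ ellip ξ h, a + v ∈ unitBall n) :
    ‖f a‖ₑ ^ s * volume (ellip ξ h) ≤
      ∫⁻ v in ellip ξ h, (unitBall n).indicator (fun z => ‖f z‖ₑ ^ s) (a + v) := by
  have hpi := Real.two_pi_pos
  set E := ellip ξ h with hE
  have hEm : MeasurableSet E := measurableSet_ellip ξ h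
  set H := (unitBall n).indicator (fun z => ‖f z‖ₑ ^ s) with hH
  have hHm : Measurable H := measurable_indicator_ball hf.continuousOn s
  set k := ENNReal.ofReal (2 * Real.pi)⁻¹ with hk
  have hexp : ∀ θ : ℝ, Complex.exp (θ * Complex.I) = (Circle.exp θ : ℂ) := fun θ =>
    (Circle.coe_exp θ).symm
  have hpt : ∀ v ∈ E, ‖f a‖ₑ ^ s ≤ k * ∫⁻ θ in Ioc 0 (2 * Real.pi),
      H (a + Complex.exp ((θ : ℝ) * Complex.I) • v) := by
    intro v hv
    have hball : Metric.closedBall (0 : ℂ) 1 ⊆ {l | a + l • v ∈ unitBall n} := fun l hl =>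
      hsub _ (smul_mem_ellip hv (by simpa using hl))
    have := enorm_rpow_le_lintegral hs (isOpen_slice a v) (differentiableOn_slice hf a v)
      zero_le_one hball
    simp only [zero_smul, add_zero, zero_add, Complex.ofReal_one, one_mul] at this
    refine this.trans_eq ?_
    congr 1
    refine lintegral_congr fun θ => ?_
    rw [hH, indicator_of_mem]
    exact hsub _ (smul_mem_ellip hv (Complex.norm_exp_ofReal_mul_I θ).le)
  have hrot : ∀ θ : ℝ, ∫⁻ v in E, H (a + Complex.exp (θ * Complex.I) • v)
      = ∫⁻ v in E, H (a + v) := by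
    intro θ
    have hpre := preimage_rotation_ellip ξ h (Circle.exp θ)
    have := (measurePreserving_rotation (n := n) (Circle.exp θ)).setLIntegral_comp_preimage hEm
      (f := fun v => H (a + v)) (hHm.comp (measurable_const_add a))
    rw [hpre] at this
    simp_rw [hexp]
    exact this
  calc ‖f a‖ₑ ^ s * volume E = ∫⁻ _ in E, ‖f a‖ₑ ^ s := by rw [setLIntegral_const]
    _ ≤ ∫⁻ v in E, k * ∫⁻ θ in Ioc 0 (2 * Real.pi),
          H (a + Complex.exp ((θ : ℝ) * Complex.I) • v) := setLIntegral_mono' hEm hpt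
    _ = k * ∫⁻ θ in Ioc 0 (2 * Real.pi), ∫⁻ v in E,
          H (a + Complex.exp ((θ : ℝ) * Complex.I) • v) := by
        rw [lintegral_const_mul' _ _ ENNReal.ofReal_ne_top, lintegral_lintegral_swap]
        refine (hHm.comp (g := H) (f := fun p : Cn n × ℝ =>
          a + Complex.exp ((p.2 : ℝ) * Complex.I) • p.1) ?_).aemeasurable
        exact Continuous.measurable (by fun_prop)
    _ = ∫⁻ v in E, H (a + v) := by
        simp_rw [hrot]
        rw [setLIntegral_const, Real.volume_Ioc, sub_zero, mul_comm, mul_assoc, hk,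
          ← ENNReal.ofReal_mul hpi.le, mul_inv_cancel₀ hpi.ne', ENNReal.ofReal_one, mul_one]

/-- The translated set meets only radii in (1 - 5h/4, 1 - h/8], an interval of length 9h/8, and at
each of them the sphere mean is at most the mean at ρ. -/
lemma enorm_rpow_mul_volume_ellip_le (hn : 1 ≤ n) (hs : 0 < s)
    (hf : DifferentiableOn ℂ f (unitBall n)) {ξ : Cn n} (hξ : ‖ξ‖ = 1) {h : ℝ} (h0 : 0 < h)
    (h1 : h ≤ 1) {ρ : ℝ} (hρ : 1 - h / 8 ≤ ρ) (hρ1 : ρ < 1) :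
    ‖f ((1 - h) • ξ)‖ₑ ^ s * volume (ellip ξ (h / 4)) ≤
      ENNReal.ofReal (9 * h / 8) * ∫⁻ ζ, ‖f (ρ • (ζ : Cn n))‖ₑ ^ s ∂(surf n) := by
  set a := (1 - h) • ξ with ha
  have hmean : ∀ t : ℝ, 0 ≤ t → t < 1 → ∫⁻ ζ, ‖f (t • (ζ : Cn n))‖ₑ ^ s ∂(surf n)
      = ENNReal.ofReal (sphereMean f s (t : ℂ)) := fun t ht ht1 => by
    rw [ofReal_sphereMean hs hf.continuousOn
      (by rwa [Complex.norm_real, Real.norm_of_nonneg ht])]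
    rfl
  set H := (unitBall n).indicator (fun z => ‖f z‖ₑ ^ s) with hH
  have hHm : Measurable H := measurable_indicator_ball hf.continuousOn s
  set A := (fun z => z - a) ⁻¹' ellip ξ (h / 4) with hA
  have hAm : MeasurableSet A := (measurable_sub_const a) (measurableSet_ellip _ _)
  refine (enorm_rpow_mul_volume_le hs hf (h := h / 4) fun v hv => ?_).trans ?_
  · have := (norm_add_ellip_bounds hξ h0 h1 hv).2.1
    rw [mem_ball_zero_iff]
    linarith
  have e : ∫⁻ v in ellip ξ (h / 4), H (a + v) = ∫⁻ z, A.indicator H z := by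
    rw [← lintegral_indicator (measurableSet_ellip _ _), ← lintegral_add_left_eq_self (A.indicator H) a]
    refine lintegral_congr fun v => ?_
    by_cases hv : v ∈ ellip ξ (h / 4)
    · rw [indicator_of_mem hv, indicator_of_mem]
      simpa [hA] using hv
    · rw [indicator_of_notMem hv, indicator_of_notMem]
      simpa [hA] using hv
  rw [e, lintegral_polar hn (hHm.indicator hAm)]
  have hmem : ∀ r ∈ Ioi (0 : ℝ), ∀ η : Metric.sphere (0 : Cn n) 1, r • (η : Cn n) ∈ A →
      r ∈ Ioc (1 - 5 * h / 4) (1 - h / 8) := by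
    intro r hr η hη
    have hr0 : 0 < r := hr
    have hb := norm_add_ellip_bounds hξ h0 h1 hη
    rw [add_sub_cancel, norm_smul_sphere hr0.le] at hb
    exact ⟨hb.1, hb.2.1⟩
  have := lintegral_pow_le (a := 1 - 5 * h / 4) (b := 1 - h / 8) (k := rdim n - 1)
    (φ := fun r => ∫⁻ ζ, A.indicator H (r • (ζ : Cn n)) ∂(surf n))
    (c := ∫⁻ ζ, ‖f (ρ • (ζ : Cn n))‖ₑ ^ s ∂(surf n)) (by linarith) ?_ ?_
  · rwa [show 1 - h / 8 - (1 - 5 * h / 4) = 9 * h / 8 by ring] at this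
  · intro r hr hr'
    have hr0 : 0 < r := hr
    calc _ ≤ ∫⁻ ζ, ‖f (r • (ζ : Cn n))‖ₑ ^ s ∂(surf n) := by
          refine lintegral_mono fun η => ?_
          exact (indicator_le_self _ _ _).trans (indicator_le_self _ _ _)
      _ ≤ _ := by
          rw [hmean r hr0.le (by linarith [hr'.2]), hmean ρ (by linarith) hρ1]
          exact ENNReal.ofReal_le_ofReal (sphereMean_mono hn hs hf hr0.le (hr'.2.trans hρ) hρ1)
  · intro r hr hr'
    refine (lintegral_congr (g := fun _ => 0) fun η => ?_).trans (by simp)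
    exact indicator_of_notMem (fun hη => hr' (hmem r hr η hη)) _

/-- The growth estimate for sphere means. -/
lemma enorm_rpow_mul_surf_cap_le (hn : 1 ≤ n) (hs : 0 < s)
    (hf : DifferentiableOn ℂ f (unitBall n)) {ξ : Cn n} (hξ : ‖ξ‖ = 1) {h : ℝ} (h0 : 0 < h)
    (h1 : h ≤ 1) {ρ : ℝ} (hρ : 1 - h / 8 ≤ ρ) (hρ1 : ρ < 1) :
    ‖f ((1 - h) • ξ)‖ₑ ^ s * surf n (cap ξ (2 * h)) ≤
      2 ^ (6 * rdim n + 1) * ∫⁻ ζ, ‖f (ρ • (ζ : Cn n))‖ₑ ^ s ∂(surf n) := by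
  set X := ‖f ((1 - h) • ξ)‖ₑ ^ s
  set I := ∫⁻ ζ, ‖f (ρ • (ζ : Cn n))‖ₑ ^ s ∂(surf n)
  have a1 := mul_surf_cap_le hn hξ (h := 2 * h) (by linarith) (by linarith)
  have a2 := volume_ellip_two_pow_mul_le ξ (h / 4) 5
  rw [show 2 ^ 5 * (h / 4) = 4 * (2 * h) by ring] at a2
  have a3 := enorm_rpow_mul_volume_ellip_le hn hs hf hξ h0 h1 hρ hρ1
  have hne : ENNReal.ofReal (2 * h) ≠ 0 := by simp [h0]
  refine (ENNReal.mul_le_mul_iff_right hne ENNReal.ofReal_ne_top).1 ?_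
  calc ENNReal.ofReal (2 * h) * (X * surf n (cap ξ (2 * h)))
      = X * (ENNReal.ofReal (2 * h) * surf n (cap ξ (2 * h))) := by ring
    _ ≤ X * (2 ^ (rdim n + 1) * (2 ^ (5 * rdim n) * volume (ellip ξ (h / 4)))) := by
        exact mul_le_mul_right (a1.trans (mul_le_mul_right a2 _)) X
    _ = 2 ^ (6 * rdim n + 1) * (X * volume (ellip ξ (h / 4))) := by
        rw [show 6 * rdim n + 1 = (rdim n + 1) + 5 * rdim n by ring, pow_add 2 (rdim n + 1)]
        ring
    _ ≤ 2 ^ (6 * rdim n + 1) * (ENNReal.ofReal (2 * h) * I) := by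
        refine mul_le_mul_right (a3.trans (mul_le_mul_left (ENNReal.ofReal_le_ofReal ?_) I)) _
        linarith
    _ = _ := by ring

end Growth

/-! ### Doubling and growth for the weighted measure -/

section Weight

variable {n : ℕ} {ω : ℝ → ℝ}

/-- The radial tail of `ω dV`. -/
def radialTail (n : ℕ) (ω : ℝ → ℝ) (r : ℝ) : ℝ≥0∞ :=
  ∫⁻ t in Ioo r 1, ENNReal.ofReal (ω t) * ENNReal.ofReal (t ^ (rdim n - 1))

lemma radialTail_antitone : Antitone (radialTail n ω) := fun _ _ hab =>
  lintegral_mono_set (Ioo_subset_Ioo_left hab)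

lemma radialTail_pos (hω : IsRadialWeight n ω) {r : ℝ} (h0 : 0 ≤ r) (h1 : r < 1) :
    0 < radialTail n ω r := by
  have hae : AEMeasurable (fun t => ENNReal.ofReal (ω t) * ENNReal.ofReal (t ^ (rdim n - 1)))
      (volume.restrict (Ioo r 1)) := by
    have hm : Measurable fun t : ℝ => ENNReal.ofReal (t ^ (rdim n - 1)) := by fun_prop
    refine AEMeasurable.mul ?_ hm.aemeasurable
    exact (hω.aemeasurable.mono_measure
      (Measure.restrict_mono (Ioo_subset_Ioo_left h0) le_rfl)).ennreal_ofReal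
  rw [pos_iff_ne_zero, radialTail, Ne, lintegral_eq_zero_iff' hae]
  intro h
  have : ∀ᵐ t ∂(volume.restrict (Ioo r 1)), False := by
    filter_upwards [h, ae_restrict_mem measurableSet_Ioo] with t ht ht1
    have ht0 : 0 < t := h0.trans_lt ht1.1
    have h1 : 0 < ENNReal.ofReal (ω t) := ENNReal.ofReal_pos.2 (hω.pos t ⟨ht0, ht1.2⟩)
    have h2 : 0 < ENNReal.ofReal (t ^ (rdim n - 1)) := ENNReal.ofReal_pos.2 (pow_pos ht0 _)
    exact (ENNReal.mul_pos h1.ne' h2.ne').ne' ht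
  rw [ae_iff] at this
  simp only [not_false_eq_true, ofPred_true, Measure.restrict_apply_univ, Real.volume_Ioo,
    ENNReal.ofReal_eq_zero] at this
  linarith

/-- The Jacobian t^(N-1) is at most 1, and at least 2^(-(N-1)) for t ≥ 1/2; hence doubling passes
from `tail` to `radialTail` as long as 1 - h ≥ 1/2. -/
lemma exists_radialTail_doubling (hω : IsDoublingWeight n ω) :
    ∃ C : ℝ≥0, ∀ h, 0 < h → h ≤ 1 / 2 → radialTail n ω (1 - 2 * h) ≤ C * radialTail n ω (1 - h) := by
  obtain ⟨C, -, hC⟩ := hω.doubling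
  refine ⟨C * 2 ^ (rdim n - 1), fun h h0 h1 => ?_⟩
  have h2 := (hC (1 - 2 * h) ⟨by linarith, by linarith⟩).le
  rw [show (1 + (1 - 2 * h)) / 2 = 1 - h by ring] at h2
  have h3 : radialTail n ω (1 - 2 * h) ≤ tail ω (1 - 2 * h) := by
    refine setLIntegral_mono' measurableSet_Ioo fun t ht => ?_
    calc _ ≤ ENNReal.ofReal (ω t) * 1 := by
          refine mul_le_mul_right ?_ _
          rw [ENNReal.ofReal_le_one]
          exact pow_le_one₀ (by linarith [ht.1]) ht.2.le
      _ = _ := mul_one _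
  have h4 : tail ω (1 - h) ≤ 2 ^ (rdim n - 1) * radialTail n ω (1 - h) := by
    rw [radialTail, ← lintegral_const_mul' _ _ (by simp)]
    refine setLIntegral_mono' measurableSet_Ioo fun t ht => ?_
    have ht2 : 1 ≤ 2 * t := by linarith [ht.1]
    have e : (1 : ℝ≥0∞) ≤ 2 ^ (rdim n - 1) * ENNReal.ofReal (t ^ (rdim n - 1)) := by
      rw [ENNReal.ofReal_pow (by linarith), ← mul_pow]
      refine one_le_pow₀ ?_
      rw [← ENNReal.ofReal_ofNat 2, ← ENNReal.ofReal_mul (by norm_num), ENNReal.one_le_ofReal]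
      exact ht2
    calc ENNReal.ofReal (ω t) = ENNReal.ofReal (ω t) * 1 := (mul_one _).symm
      _ ≤ ENNReal.ofReal (ω t) * (2 ^ (rdim n - 1) * ENNReal.ofReal (t ^ (rdim n - 1))) :=
          mul_le_mul_right e _
      _ = _ := by ring
  calc _ ≤ C * tail ω (1 - h) := h3.trans h2
    _ ≤ C * (2 ^ (rdim n - 1) * radialTail n ω (1 - h)) := mul_le_mul_right h4 _
    _ = _ := by push_cast; ring

lemma weightMeasure_compl_ball : weightMeasure n ω (unitBall n)ᶜ = 0 := by
  refine withDensity_absolutelyContinuous _ _ ?_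
  rw [normVolume, Measure.smul_apply, Measure.restrict_apply measurableSet_ball.compl]
  simp

lemma isFiniteMeasure_weightMeasure (hω : IsRadialWeight n ω) :
    IsFiniteMeasure (weightMeasure n ω) := by
  refine ⟨?_⟩
  rw [weightMeasure, withDensity_apply _ MeasurableSet.univ, Measure.restrict_univ]
  exact hω.integrable.lintegral_lt_top

lemma weightMeasure_ball (hn : 1 ≤ n) (hω : IsRadialWeight n ω) :
    weightMeasure n ω (unitBall n) = ballConst n * (radialTail n ω 0 * surf n univ) := by
  rw [← lintegral_indicator_one measurableSet_ball,
    lintegral_weightMeasure hn hω (measurable_one.indicator measurableSet_ball), radialTail,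
    ← lintegral_mul_const' _ _ (measure_ne_top _ _)]
  congr 1
  refine setLIntegral_congr_fun measurableSet_Ioo fun r hr => ?_
  rw [mul_assoc]
  congr 2
  rw [← lintegral_one]
  refine lintegral_congr fun ζ => ?_
  rw [indicator_of_mem]
  · rfl
  · simpa [norm_smul_sphere hr.1.le] using hr.2

lemma weightMeasure_block (hn : 1 ≤ n) (hω : IsRadialWeight n ω) {ξ : Cn n} (hξ : ‖ξ‖ = 1) {h : ℝ}
    (h0 : 0 < h) (h1 : h < 1) : weightMeasure n ω (block ξ h) =
      ballConst n * (radialTail n ω (1 - h) * surf n (cap ξ h)) := by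
  have hm := measurableSet_block hξ h0
  rw [← lintegral_indicator_one hm,
    lintegral_weightMeasure hn hω (measurable_one.indicator hm), radialTail,
    ← lintegral_mul_const' _ _ (measure_ne_top _ _)]
  congr 1
  have hsub : Ioo (1 - h) 1 = Ioi (1 - h) ∩ Ioo 0 1 := by
    ext t; simp only [mem_Ioo, mem_inter_iff, mem_Ioi]
    constructor
    · rintro ⟨a, b⟩; exact ⟨a, by linarith, b⟩
    · rintro ⟨a, b, c⟩; exact ⟨a, c⟩
  rw [hsub, ← setLIntegral_indicator measurableSet_Ioi]
  refine setLIntegral_congr_fun measurableSet_Ioo fun r hr => ?_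
  have hiff : ∀ ζ : Metric.sphere (0 : Cn n) 1, r • (ζ : Cn n) ∈ block ξ h ↔
      1 - h < r ∧ ζ ∈ cap ξ h := fun ζ => by
    rw [mem_block hξ h0 h1, norm_smul_sphere hr.1.le, inv_smul_smul₀ hr.1.ne']
    exact ⟨fun H => ⟨H.1, H.2.2⟩, fun H => ⟨H.1, hr.2, H.2⟩⟩
  by_cases hr1 : 1 - h < r
  · rw [indicator_of_mem (show r ∈ Ioi (1 - h) from hr1), mul_assoc,
      ← lintegral_indicator_one (measurableSet_cap ξ h)]
    congr 2
    refine lintegral_congr fun ζ => ?_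
    by_cases hζ : ζ ∈ cap ξ h
    · rw [indicator_of_mem hζ, indicator_of_mem ((hiff ζ).2 ⟨hr1, hζ⟩)]; rfl
    · rw [indicator_of_notMem hζ, indicator_of_notMem fun H => hζ ((hiff ζ).1 H).2]
  · rw [indicator_of_notMem (show r ∉ Ioi (1 - h) from hr1),
      lintegral_congr (g := fun _ => 0) fun ζ =>
        indicator_of_notMem (fun H => hr1 ((hiff ζ).1 H).1) _]
    simp

lemma surf_cap_pos (hn : 1 ≤ n) {ξ : Cn n} (hξ : ‖ξ‖ = 1) {h : ℝ} (h0 : 0 < h) :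
    0 < surf n (cap ξ h) := by
  set k := min (2 * h / 5) 1 with hk
  have k0 : 0 < k := lt_min (by linarith) one_pos
  have hopen : IsOpen (ellip ξ (k / 4)) := by
    have h1 : Continuous fun v : Cn n => ‖inner ℂ v ξ‖ := by fun_prop
    have h2 : Continuous fun v : Cn n => ‖v‖ ^ 2 := by fun_prop
    exact (isOpen_lt h1 continuous_const).inter (isOpen_lt h2 continuous_const)
  have hV : 0 < volume (ellip ξ (k / 4)) :=
    hopen.measure_pos _ ⟨0, by simp [ellip, k0]⟩
  have := hV.trans_le (volume_ellip_le hn hξ k0 (min_le_right _ _))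
  have h2 : 0 < surf n (cap ξ (5 * k / 2)) := by
    rw [pos_iff_ne_zero]
    intro h0
    rw [h0, mul_zero] at this
    exact lt_irrefl _ this
  refine h2.trans_le (measure_mono (cap_mono ξ ?_))
  linarith [min_le_left (2 * h / 5) 1]

lemma weightMeasure_block_pos (hn : 1 ≤ n) (hω : IsRadialWeight n ω) {ξ : Cn n} (hξ : ‖ξ‖ = 1)
    {h : ℝ} (h0 : 0 < h) : 0 < weightMeasure n ω (block ξ h) := by
  set k := min h (1 / 2) with hk
  have k0 : 0 < k := lt_min h0 (by norm_num)
  have k1 : k < 1 := (min_le_right _ _).trans_lt (by norm_num)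
  refine lt_of_lt_of_le ?_ (measure_mono (block_mono hξ k0 (min_le_left _ _)))
  rw [weightMeasure_block hn hω hξ k0 k1]
  exact ENNReal.mul_pos (ballConst_pos n).ne' (ENNReal.mul_pos
    (radialTail_pos hω (by linarith) (by linarith)).ne' (surf_cap_pos hn hξ k0).ne').ne'

/-- The cap is enlarged to size 2h in order to include h = 1, where the block is the whole ball:
`cap ξ 2` is the whole sphere, as it must be. -/
lemma weightMeasure_block_le (hn : 1 ≤ n) (hω : IsRadialWeight n ω) {ξ : Cn n} (hξ : ‖ξ‖ = 1)
    {h : ℝ} (h0 : 0 < h) (h1 : h ≤ 1) : weightMeasure n ω (block ξ h) ≤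
      ballConst n * (radialTail n ω (1 - h) * surf n (cap ξ (2 * h))) := by
  rcases h1.lt_or_eq with h1 | rfl
  · rw [weightMeasure_block hn hω hξ h0 h1]
    gcongr
    exact cap_mono ξ (by linarith)
  · rw [block_of_one_le ξ le_rfl, weightMeasure_ball hn hω, cap_eq_univ hξ (by norm_num), sub_self]

/-- Blocks are doubling for the weighted measure. -/
lemma exists_weightMeasure_block_doubling (hn : 1 ≤ n) (hω : IsDoublingWeight n ω) :
    ∃ D : ℝ≥0, 1 ≤ D ∧ ∀ ξ : Cn n, ‖ξ‖ = 1 → ∀ h, 0 < h →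
      weightMeasure n ω (block ξ (2 * h)) ≤ D * weightMeasure n ω (block ξ h) := by
  obtain ⟨C, hC⟩ := exists_radialTail_doubling hω
  refine ⟨max 1 (2 ^ (16 * rdim n) * C), le_max_left _ _, fun ξ hξ h h0 => ?_⟩
  rcases le_or_gt 1 h with h1 | h1
  · rw [block_of_one_le ξ h1, block_of_one_le ξ (by linarith)]
    refine le_mul_of_one_le_left zero_le ?_
    exact_mod_cast le_max_left _ _
  suffices weightMeasure n ω (block ξ (2 * h)) ≤
      ((2 ^ (16 * rdim n) * C : ℝ≥0) : ℝ≥0∞) * weightMeasure n ω (block ξ h) from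
    this.trans (mul_le_mul_left (by exact_mod_cast le_max_right _ _) _)
  rw [weightMeasure_block hn hω.toIsRadialWeight hξ h0 h1]
  push_cast
  rcases le_or_gt h (1 / 2) with h2 | h2
  · have c1 := surf_cap_two_mul_le hn hξ (h := 2 * h) (by linarith) (by linarith)
    have c2 := surf_cap_two_mul_le hn hξ h0 h1.le
    calc _ ≤ _ := weightMeasure_block_le hn hω.toIsRadialWeight hξ (by linarith) (by linarith)
      _ ≤ ballConst n * ((C * radialTail n ω (1 - h)) *
            (2 ^ (8 * rdim n) * (2 ^ (8 * rdim n) * surf n (cap ξ h)))) :=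
          mul_le_mul_right (mul_le_mul' (hC h h0 h2) (c1.trans (mul_le_mul_right c2 _))) _
      _ = _ := by
          rw [show 16 * rdim n = 8 * rdim n + 8 * rdim n by ring, pow_add]
          ring
  -- For 1/2 < h < 1 the doubled block is the whole ball, so fixed scales suffice: the sphere is
  -- compared with `cap ξ (1 / 2)` and the tail at 0 with the tail at 1/2.
  · have c1 := surf_cap_two_mul_le hn hξ (h := 1) one_pos le_rfl
    have c2 := surf_cap_two_mul_le hn hξ (h := 1 / 2) (by norm_num) (by norm_num)
    rw [cap_eq_univ hξ (by norm_num)] at c1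
    rw [show (2 : ℝ) * (1 / 2) = 1 by norm_num] at c2
    have c3 := hC (1 / 2) (by norm_num) le_rfl
    rw [show (1 : ℝ) - 2 * (1 / 2) = 0 by norm_num] at c3
    rw [block_of_one_le ξ (by linarith), weightMeasure_ball hn hω.toIsRadialWeight]
    calc _ ≤ ballConst n * ((C * radialTail n ω (1 - h)) *
            (2 ^ (8 * rdim n) * (2 ^ (8 * rdim n) * surf n (cap ξ h)))) := by
          refine mul_le_mul_right (mul_le_mul' (c3.trans (mul_le_mul_right ?_ _))
            (c1.trans (mul_le_mul_right (c2.trans (mul_le_mul_right ?_ _)) _))) _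
          · exact radialTail_antitone (by linarith)
          · exact measure_mono (cap_mono ξ (by linarith))
      _ = _ := by
          rw [show 16 * rdim n = 8 * rdim n + 8 * rdim n by ring, pow_add]
          ring

lemma ae_weightMeasure_mem_ball : ∀ᵐ z ∂(weightMeasure n ω), z ∈ unitBall n := by
  rw [ae_iff]; exact weightMeasure_compl_ball

/-- A global growth estimate for holomorphic functions. -/
lemma exists_enorm_rpow_mul_weightMeasure_le (hn : 1 ≤ n) (hω : IsDoublingWeight n ω) :
    ∃ C : ℝ≥0, ∀ (s : ℝ) (f : Cn n → ℂ), 0 < s → DifferentiableOn ℂ f (unitBall n) →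
      ∀ ξ : Cn n, ‖ξ‖ = 1 → ∀ h, 0 < h → h ≤ 1 →
        ‖f ((1 - h) • ξ)‖ₑ ^ s * weightMeasure n ω (block ξ h) ≤
          C * ∫⁻ z, ‖f z‖ₑ ^ s ∂(weightMeasure n ω) := by
  obtain ⟨C, hC⟩ := exists_radialTail_doubling hω
  refine ⟨C ^ 3 * 2 ^ (6 * rdim n + 1), fun s f hs hf ξ hξ h h0 h1 => ?_⟩
  -- Three doublings bring the tail from 1 - h to 1 - h/8, the radius beyond which every sphere mean
  -- controls the value at (1 - h)ξ.
  have hW : radialTail n ω (1 - h) ≤ C ^ 3 * radialTail n ω (1 - h / 8) := by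
    have c1 := hC (h / 2) (by linarith) (by linarith)
    have c2 := hC (h / 4) (by linarith) (by linarith)
    have c3 := hC (h / 8) (by linarith) (by linarith)
    rw [show 2 * (h / 2) = h by ring] at c1
    rw [show 2 * (h / 4) = h / 2 by ring] at c2
    rw [show 2 * (h / 8) = h / 4 by ring] at c3
    refine (c1.trans (mul_le_mul_right (c2.trans (mul_le_mul_right c3 _)) _)).trans_eq ?_
    ring
  set X := ‖f ((1 - h) • ξ)‖ₑ ^ s with hX
  have hXt : X ≠ ∞ := ENNReal.rpow_ne_top_of_nonneg hs.le enorm_ne_top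
  set H := (unitBall n).indicator (fun z => ‖f z‖ₑ ^ s) with hH
  have hHm : Measurable H := measurable_indicator_ball hf.continuousOn s
  have hint : ∫⁻ z, ‖f z‖ₑ ^ s ∂(weightMeasure n ω) = ∫⁻ z, H z ∂(weightMeasure n ω) := by
    refine lintegral_congr_ae ?_
    filter_upwards [ae_weightMeasure_mem_ball] with z hz
    rw [hH, indicator_of_mem hz]
  have hmain : (X * surf n (cap ξ (2 * h))) * radialTail n ω (1 - h / 8) ≤
      2 ^ (6 * rdim n + 1) * ∫⁻ r in Ioo (0 : ℝ) 1, ENNReal.ofReal (ω r) *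
        (ENNReal.ofReal (r ^ (rdim n - 1)) * ∫⁻ ζ, H (r • (ζ : Cn n)) ∂(surf n)) := by
    have hsub : Ioo (1 - h / 8) 1 ⊆ Ioo 0 1 := Ioo_subset_Ioo_left (by linarith)
    rw [← lintegral_const_mul' _ _ (by simp), radialTail,
      ← lintegral_const_mul' _ _ (ENNReal.mul_ne_top hXt (measure_ne_top _ _))]
    refine le_trans ?_ (lintegral_mono_set hsub)
    refine setLIntegral_mono' measurableSet_Ioo fun r hr => ?_
    have hr0 : 0 < r := by linarith [hr.1]
    have e : ∫⁻ ζ, H (r • (ζ : Cn n)) ∂(surf n) = ∫⁻ ζ, ‖f (r • (ζ : Cn n))‖ₑ ^ s ∂(surf n) := by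
      refine lintegral_congr fun ζ => ?_
      rw [hH, indicator_of_mem]
      simpa [norm_smul_sphere hr0.le] using hr.2
    have g := enorm_rpow_mul_surf_cap_le hn hs hf hξ h0 h1 hr.1.le hr.2
    rw [e]
    calc _ ≤ _ := mul_le_mul_left g _
      _ = _ := by ring
  rw [hint, lintegral_weightMeasure hn hω.toIsRadialWeight hHm]
  calc X * weightMeasure n ω (block ξ h)
      ≤ X * (ballConst n * ((C ^ 3 * radialTail n ω (1 - h / 8)) * surf n (cap ξ (2 * h)))) :=
        mul_le_mul_right ((weightMeasure_block_le hn hω.toIsRadialWeight hξ h0 h1).trans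
          (mul_le_mul_right (mul_le_mul_left hW _) _)) _
    _ = C ^ 3 * ballConst n * ((X * surf n (cap ξ (2 * h))) * radialTail n ω (1 - h / 8)) := by ring
    _ ≤ _ := mul_le_mul_right hmain _
    _ = _ := by push_cast; ring

end Weight

lemma inv_two_rpow_mul_le {D : ℝ≥0} {M : ℝ} (hM : 2 * (D : ℝ≥0∞) ≤ 2 ^ M) :
    (2⁻¹ : ℝ≥0∞) ^ M * D ≤ 2⁻¹ := by
  have h2M0 : (2 : ℝ≥0∞) ^ M ≠ 0 := by simp [ENNReal.rpow_eq_zero_iff]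
  have h2Mt : (2 : ℝ≥0∞) ^ M ≠ ∞ := by simp [ENNReal.rpow_eq_top_iff]
  rw [ENNReal.inv_rpow, mul_comm, ← div_eq_mul_inv, ENNReal.div_le_iff h2M0 h2Mt]
  calc (D : ℝ≥0∞) = 2⁻¹ * (2 * D) := by
        rw [← mul_assoc, ENNReal.inv_mul_cancel (by norm_num) (by norm_num), one_mul]
    _ ≤ 2⁻¹ * 2 ^ M := mul_le_mul_right hM _

/-! ### Admissible measures and kernel estimates -/

section Admissible

variable {n : ℕ}

/-- Measures on the ball that are doubling on blocks and control holomorphic functions. -/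
structure IsAdmissible (ν : Measure (Cn n)) (D C : ℝ≥0) : Prop where
  finite : ν univ < ∞
  compl_ball : ν (unitBall n)ᶜ = 0
  block_pos : ∀ ξ : Cn n, ‖ξ‖ = 1 → ∀ h, 0 < h → 0 < ν (block ξ h)
  one_le : 1 ≤ D
  doubling : ∀ ξ : Cn n, ‖ξ‖ = 1 → ∀ h, 0 < h → ν (block ξ (2 * h)) ≤ D * ν (block ξ h)
  growth : ∀ (s : ℝ) (f : Cn n → ℂ), 0 < s → DifferentiableOn ℂ f (unitBall n) →
    ∀ ξ : Cn n, ‖ξ‖ = 1 → ∀ h, 0 < h → h ≤ 1 →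
      ‖f ((1 - h) • ξ)‖ₑ ^ s * ν (block ξ h) ≤ C * ∫⁻ z, ‖f z‖ₑ ^ s ∂ν

lemma exists_isAdmissible_weightMeasure {ω : ℝ → ℝ} (hn : 1 ≤ n) (hω : IsDoublingWeight n ω) :
    ∃ D C : ℝ≥0, IsAdmissible (weightMeasure n ω) D C := by
  obtain ⟨D, hD, hD'⟩ := exists_weightMeasure_block_doubling hn hω
  obtain ⟨C, hC⟩ := exists_enorm_rpow_mul_weightMeasure_le hn hω
  exact ⟨D, C, (isFiniteMeasure_weightMeasure hω.toIsRadialWeight).measure_univ_lt_top,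
    weightMeasure_compl_ball,
    fun ξ hξ h h0 => weightMeasure_block_pos hn hω.toIsRadialWeight hξ h0, hD, hD', hC⟩

/-- The test function attached to the point `(1 - h) ξ`. -/
def testFun (ξ : Cn n) (h : ℝ) (m : ℕ) (z : Cn n) : ℂ :=
  ((h : ℂ) / (1 - inner ℂ ((1 - h) • ξ) z)) ^ m

variable {ξ : Cn n} {h : ℝ}

lemma differentiableOn_testFun (hξ : ‖ξ‖ = 1) (h0 : 0 < h) (h1 : h ≤ 1) (m : ℕ) :
    DifferentiableOn ℂ (testFun ξ h m) (unitBall n) := by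
  have hd : Differentiable ℂ fun z : Cn n => 1 - inner ℂ ((1 - h) • ξ) z :=
    (differentiable_const _).sub (innerSL ℂ ((1 - h) • ξ)).differentiable
  unfold testFun
  simp_rw [div_eq_mul_inv]
  refine DifferentiableOn.fun_pow (DifferentiableOn.const_mul
    (DifferentiableOn.fun_inv hd.differentiableOn fun z hz => ?_) _) m
  have hz1 : ‖z‖ < 1 := by simpa using hz
  have := le_norm_one_sub_inner hξ h1 hz1.le
  rw [norm_one_sub_inner_comm] at this
  exact norm_pos_iff.1 (h0.trans_le this)

lemma norm_testFun (h0 : 0 < h) (m : ℕ) (z : Cn n) :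
    ‖testFun ξ h m z‖ = (h / ‖1 - inner ℂ z ((1 - h) • ξ)‖) ^ m := by
  rw [testFun, norm_pow, norm_div, norm_one_sub_inner_comm, Complex.norm_real,
    Real.norm_of_nonneg h0.le]

lemma enorm_testFun_rpow (h0 : 0 < h) (m : ℕ) (s : ℝ) (z : Cn n) :
    ‖testFun ξ h m z‖ₑ ^ s =
      ENNReal.ofReal (h / ‖1 - inner ℂ z ((1 - h) • ξ)‖) ^ (m * s) := by
  rw [← ofReal_norm, norm_testFun h0, ENNReal.ofReal_pow (by positivity), ← ENNReal.rpow_natCast,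
    ← ENNReal.rpow_mul]

namespace IsAdmissible

variable {ν : Measure (Cn n)} {D C : ℝ≥0}

lemma ae_mem_ball (H : IsAdmissible ν D C) : ∀ᵐ z ∂ν, z ∈ unitBall n := by
  rw [ae_iff]; exact H.compl_ball

lemma block_ne_top (H : IsAdmissible ν D C) (ξ : Cn n) (h : ℝ) : ν (block ξ h) ≠ ∞ :=
  ((measure_mono (subset_univ _)).trans_lt H.finite).ne

lemma doubling_pow (H : IsAdmissible ν D C) (hξ : ‖ξ‖ = 1) (h0 : 0 < h) (k : ℕ) :
    ν (block ξ (2 ^ k * h)) ≤ D ^ k * ν (block ξ h) := by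
  induction k with
  | zero => simp
  | succ k ih =>
    rw [pow_succ', mul_assoc]
    refine (H.doubling ξ hξ _ (by positivity)).trans ?_
    rw [pow_succ', mul_assoc]
    gcongr

/-- Each dyadic enlargement costs a factor D and gains 2^(-M); the condition 2D ≤ 2^M leaves a
geometric series of ratio at most 1/2. The D^3 pays for the initial factor 8. -/
lemma tsum_block_le (H : IsAdmissible ν D C) (hξ : ‖ξ‖ = 1) (h0 : 0 < h) {M : ℝ}
    (hM : 2 * (D : ℝ≥0∞) ≤ 2 ^ M) :
    ∑' j : ℕ, (2⁻¹ : ℝ≥0∞) ^ (j * M) * ν (block ξ (8 * (2 ^ j * h))) ≤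
      2 * D ^ 3 * ν (block ξ h) := by
  have hterm : ∀ j : ℕ, (2⁻¹ : ℝ≥0∞) ^ (j * M) * ν (block ξ (8 * (2 ^ j * h))) ≤
      (2⁻¹ : ℝ≥0∞) ^ j * (D ^ 3 * ν (block ξ h)) := by
    intro j
    have e : (8 : ℝ) * (2 ^ j * h) = 2 ^ (j + 3) * h := by rw [pow_add]; ring
    have hb := inv_two_rpow_mul_le hM
    calc (2⁻¹ : ℝ≥0∞) ^ (j * M) * ν (block ξ (8 * (2 ^ j * h)))
        ≤ ((2⁻¹ : ℝ≥0∞) ^ M) ^ j * (D ^ (j + 3) * ν (block ξ h)) := by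
          rw [e, ← ENNReal.rpow_natCast ((2⁻¹ : ℝ≥0∞) ^ M) j, ← ENNReal.rpow_mul, mul_comm M]
          exact mul_le_mul_right (H.doubling_pow hξ h0 _) _
      _ = ((2⁻¹ : ℝ≥0∞) ^ M * D) ^ j * (D ^ 3 * ν (block ξ h)) := by
          rw [pow_add, mul_pow]; ring
      _ ≤ _ := by gcongr
  refine (ENNReal.tsum_le_tsum hterm).trans_eq ?_
  rw [ENNReal.tsum_mul_right, ENNReal.tsum_geometric, ENNReal.one_sub_inv_two, inv_inv]
  ring

lemma exists_exponent (D : ℝ≥0) {s : ℝ} (hs : 0 < s) :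
    ∃ m : ℕ, 0 < m ∧ 2 * (D : ℝ≥0∞) ≤ 2 ^ (m * s) := by
  obtain ⟨k, hk⟩ := pow_unbounded_of_one_lt (2 * D : ℝ≥0) one_lt_two
  obtain ⟨m, hm⟩ := exists_nat_ge ((k : ℝ) / s)
  refine ⟨m + 1, Nat.succ_pos _, ?_⟩
  have hk' : 2 * (D : ℝ≥0∞) ≤ 2 ^ k := by exact_mod_cast hk.le
  refine hk'.trans ?_
  rw [← ENNReal.rpow_natCast]
  refine ENNReal.rpow_le_rpow_of_exponent_le (by norm_num) ?_
  rw [div_le_iff₀ hs] at hm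
  push_cast
  nlinarith

lemma lintegral_testFun_le (H : IsAdmissible ν D C) (hξ : ‖ξ‖ = 1) (h0 : 0 < h) (h1 : h ≤ 1)
    {m : ℕ} (hm0 : 0 < m) {p : ℝ} (hp : 0 < p) (hm : 2 * (D : ℝ≥0∞) ≤ 2 ^ (m * p)) :
    ∫⁻ z, ‖testFun ξ h m z‖ₑ ^ p ∂ν ≤ 2 * D ^ 3 * ν (block ξ h) := by
  have hm0' : (0 : ℝ) < m := by exact_mod_cast hm0
  have := lintegral_mul_kernel_le ν H.compl_ball hξ h0 h1 (mul_pos hm0' hp)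
    (φ := fun _ => 1) aemeasurable_const
  simp only [one_mul, lintegral_one, Measure.restrict_apply_univ] at this
  simp_rw [enorm_testFun_rpow h0 m p]
  exact this.trans (H.tsum_block_le hξ h0 hm)

lemma aemeasurable_enorm_rpow (H : IsAdmissible ν D C) {f : Cn n → ℂ}
    (hf : ContinuousOn f (unitBall n)) (s : ℝ) : AEMeasurable (fun z => ‖f z‖ₑ ^ s) ν := by
  refine ⟨_, measurable_indicator_ball hf s, ?_⟩
  filter_upwards [H.ae_mem_ball] with z hz
  rw [indicator_of_mem hz]

/-- A holomorphic function is controlled by its averages over the blocks above a point. -/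
lemma enorm_rpow_le_of_average_le (H : IsAdmissible ν D C) {f : Cn n → ℂ}
    (hf : DifferentiableOn ℂ f (unitBall n)) {m : ℕ} (hm0 : 0 < m) {s : ℝ} (hs : 0 < s)
    (hm : 2 * (D : ℝ≥0∞) ≤ 2 ^ (m * s)) (hξ : ‖ξ‖ = 1) (h0 : 0 < h) (h1 : h ≤ 1) {t : ℝ≥0∞}
    (ht : ∀ j : ℕ, ∫⁻ z in block ξ (8 * (2 ^ j * h)), ‖f z‖ₑ ^ s ∂ν ≤
      t * ν (block ξ (8 * (2 ^ j * h)))) :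
    ‖f ((1 - h) • ξ)‖ₑ ^ s ≤ 2 ^ (m * s) * (C * (2 * D ^ 3)) * t := by
  have hm0' : (0 : ℝ) < m := by exact_mod_cast hm0
  set a := (1 - h) • ξ with ha
  -- At its own point the kernel h/|1 - ⟨a, a⟩| is at least 1/2, so multiplying f by the test
  -- function loses only 2^m there.
  have hNa : ‖1 - inner ℂ a a‖ ≤ 2 * h := by
    have e : 1 - inner ℂ a a = ((2 * h - h ^ 2 : ℝ) : ℂ) := by
      rw [inner_self_eq_norm_sq_to_K, ha, norm_smul, hξ, Real.norm_of_nonneg (by linarith)]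
      push_cast
      ring_nf
      simp
    rw [e, Complex.norm_real, Real.norm_of_nonneg (by nlinarith)]
    nlinarith
  have ha1 : ‖a‖ ≤ 1 := by
    rw [ha, norm_smul, hξ, Real.norm_of_nonneg (by linarith)]; linarith
  have hNa0 : 0 < ‖1 - inner ℂ a a‖ := h0.trans_le (le_norm_one_sub_inner hξ h1 ha1)
  have hka : (2⁻¹ : ℝ≥0∞) ^ (m * s) ≤ ‖testFun ξ h m a‖ₑ ^ s := by
    rw [enorm_testFun_rpow h0 m s]
    refine ENNReal.rpow_le_rpow ?_ (by positivity)
    have e2 : (2⁻¹ : ℝ≥0∞) = ENNReal.ofReal (2⁻¹) := by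
      rw [ENNReal.ofReal_inv_of_pos (by norm_num), ENNReal.ofReal_ofNat]
    rw [e2]
    refine ENNReal.ofReal_le_ofReal ?_
    rw [le_div_iff₀ hNa0]
    linarith
  -- The growth estimate is global; applied to f times the test function it becomes a rapidly
  -- weighted sum of integrals of |f|^s over the dyadic blocks, to which `ht` applies.
  have hg := H.growth s (fun z => f z * testFun ξ h m z) hs
    (hf.mul (differentiableOn_testFun hξ h0 h1 m)) ξ hξ h h0 h1
  have hK := lintegral_mul_kernel_le ν H.compl_ball hξ h0 h1 (mul_pos hm0' hs)
    (H.aemeasurable_enorm_rpow hf.continuousOn s)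
  have hsum : ∑' j : ℕ, (2⁻¹ : ℝ≥0∞) ^ (j * (m * s)) *
      ∫⁻ z in block ξ (8 * (2 ^ j * h)), ‖f z‖ₑ ^ s ∂ν ≤ t * (2 * D ^ 3 * ν (block ξ h)) := by
    calc _ ≤ ∑' j : ℕ, t * ((2⁻¹ : ℝ≥0∞) ^ (j * (m * s)) * ν (block ξ (8 * (2 ^ j * h)))) := by
          refine ENNReal.tsum_le_tsum fun j => ?_
          exact (mul_le_mul_right (ht j) _).trans_eq (mul_left_comm _ _ _)
      _ ≤ _ := by
          rw [ENNReal.tsum_mul_left]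
          exact mul_le_mul_right (H.tsum_block_le hξ h0 hm) _
  have e1 : ∀ z, ‖f z * testFun ξ h m z‖ₑ ^ s = ‖f z‖ₑ ^ s *
      ENNReal.ofReal (h / ‖1 - inner ℂ z ((1 - h) • ξ)‖) ^ (m * s) := fun z => by
    rw [enorm_mul, ENNReal.mul_rpow_of_nonneg _ _ hs.le, enorm_testFun_rpow h0 m s]
  simp_rw [e1] at hg
  rw [← ha] at hg
  rw [enorm_testFun_rpow h0 m s, ← ha] at hka
  have hB0 := (H.block_pos ξ hξ h h0).ne'
  have hBt := H.block_ne_top ξ h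
  have hmain : (2⁻¹ : ℝ≥0∞) ^ (m * s) * (‖f a‖ₑ ^ s) * ν (block ξ h) ≤
      (C * (2 * D ^ 3) * t) * ν (block ξ h) := by
    calc _ ≤ ‖f a‖ₑ ^ s * ENNReal.ofReal (h / ‖1 - inner ℂ a a‖) ^ (m * s) * ν (block ξ h) := by
          rw [mul_comm ((2⁻¹ : ℝ≥0∞) ^ (m * s))]
          exact mul_le_mul_left (mul_le_mul_right hka _) _
      _ ≤ _ := hg
      _ ≤ C * (t * (2 * D ^ 3 * ν (block ξ h))) := mul_le_mul_right (hK.trans hsum) _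
      _ = _ := by ring
  have hmain2 := (ENNReal.mul_le_mul_iff_left hB0 hBt).1 hmain
  have h20 : (2 : ℝ≥0∞) ^ (m * s) ≠ 0 := by simp [ENNReal.rpow_eq_zero_iff]
  have h2t : (2 : ℝ≥0∞) ^ (m * s) ≠ ∞ := by
    simp only [Ne, ENNReal.rpow_eq_top_iff]
    simp
  calc ‖f a‖ₑ ^ s = 2 ^ (m * s) * ((2⁻¹ : ℝ≥0∞) ^ (m * s) * (‖f a‖ₑ ^ s)) := by
        rw [← mul_assoc, ENNReal.inv_rpow, ENNReal.mul_inv_cancel h20 h2t, one_mul]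
    _ ≤ 2 ^ (m * s) * (C * (2 * D ^ 3) * t) := mul_le_mul_right hmain2 _
    _ = _ := by ring

end IsAdmissible

end Admissible

/-- Superadditivity of x ↦ x^r for r ≥ 1. Through it the assumption p ≤ q enters the covering
arguments. -/
lemma tsum_rpow_le_rpow_tsum {ι : Type*} (x : ι → ℝ≥0∞) {r : ℝ} (hr : 1 ≤ r) :
    ∑' i, x i ^ r ≤ (∑' i, x i) ^ r := by
  have hr' : 0 ≤ r - 1 := by linarith
  have e : ∀ y : ℝ≥0∞, y ^ r = y * y ^ (r - 1) := fun y => by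
    conv_lhs => rw [show r = 1 + (r - 1) by ring]
    rw [ENNReal.rpow_add_of_nonneg _ _ zero_le_one hr', ENNReal.rpow_one]
  calc ∑' i, x i ^ r ≤ ∑' i, x i * (∑' i, x i) ^ (r - 1) := by
        refine ENNReal.tsum_le_tsum fun i => ?_
        rw [e]
        exact mul_le_mul_right (ENNReal.rpow_le_rpow (ENNReal.le_tsum i) hr') _
    _ = _ := by rw [ENNReal.tsum_mul_right, ← e]

/-! ### Vitali coverings by blocks -/

section Covering

variable {n : ℕ}

/-- `μ` is dominated on blocks by `A` times the `r`-th power of `ν`. -/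
def BlockBound (μ ν : Measure (Cn n)) (A : ℝ≥0∞) (r : ℝ) : Prop :=
  ∀ ξ : Cn n, ‖ξ‖ = 1 → ∀ h, 0 < h → μ (block ξ h) ≤ A * ν (block ξ h) ^ r

namespace IsAdmissible

variable {μ ν : Measure (Cn n)} {D C : ℝ≥0} {A : ℝ≥0∞} {r : ℝ}

/-- A finite measure charges only countably many disjoint sets, and every block is charged; this
makes the families selected by Vitali's lemma usable with σ-additivity. -/
lemma countable_of_pairwiseDisjoint (H : IsAdmissible ν D C) {u : Set (Cn n × ℝ)}
    (hu : ∀ i ∈ u, ‖i.1‖ = 1 ∧ 0 < i.2) (hd : u.PairwiseDisjoint fun i => block i.1 i.2) :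
    u.Countable := by
  have : IsFiniteMeasure ν := ⟨H.finite⟩
  have h1 : Set.Countable {i : u | 0 < ν (block i.1.1 i.1.2)} :=
    Measure.countable_meas_pos_of_disjoint_iUnion
      (fun i => measurableSet_block (hu i.1 i.2).1 (hu i.1 i.2).2)
      (fun i j hij => hd i.2 j.2 fun h => hij (Subtype.ext h))
  have h2 : {i : u | 0 < ν (block i.1.1 i.1.2)} = univ :=
    eq_univ_of_forall fun i => H.block_pos _ (hu i.1 i.2).1 _ (hu i.1 i.2).2
  rw [h2, countable_univ_iff] at h1
  exact h1

/-- The measure of a set covered by enlargements of disjoint blocks. -/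
lemma measure_le_of_covering (H : IsAdmissible ν D C) (hr : 1 ≤ r) {u : Set (Cn n × ℝ)}
    (hu : ∀ i ∈ u, ‖i.1‖ = 1 ∧ 0 < i.2) (hd : u.PairwiseDisjoint fun i => block i.1 i.2)
    (hμ : ∀ i ∈ u, μ (block i.1 (16 * i.2)) ≤ A * ν (block i.1 (16 * i.2)) ^ r)
    {E : Set (Cn n)} (hE : E ⊆ ⋃ i ∈ u, block i.1 (16 * i.2)) {S : ℝ≥0∞}
    (hS : ∑' i : u, ν (block i.1.1 i.1.2) ≤ S) : μ E ≤ A * ((D ^ 4) ^ r * S ^ r) := by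
  have hc := H.countable_of_pairwiseDisjoint hu hd
  have hr0 : 0 ≤ r := by linarith
  calc μ E ≤ ∑' i : u, μ (block i.1.1 (16 * i.1.2)) :=
        (measure_mono hE).trans (measure_biUnion_le _ hc _)
    _ ≤ ∑' i : u, A * (D ^ 4) ^ r * ν (block i.1.1 i.1.2) ^ r := by
        refine ENNReal.tsum_le_tsum fun i => (hμ i.1 i.2).trans ?_
        rw [mul_assoc, ← ENNReal.mul_rpow_of_nonneg _ _ hr0]
        refine mul_le_mul_right (ENNReal.rpow_le_rpow ?_ hr0) _
        -- The engulfing factor 16 is four doublings.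
        have := H.doubling_pow (hu i.1 i.2).1 (hu i.1 i.2).2 4
        norm_num at this
        exact this
    _ = A * (D ^ 4) ^ r * ∑' i : u, ν (block i.1.1 i.1.2) ^ r := ENNReal.tsum_mul_left
    _ ≤ A * (D ^ 4) ^ r * S ^ r := mul_le_mul_right
        ((tsum_rpow_le_rpow_tsum _ hr).trans (ENNReal.rpow_le_rpow hS hr0)) _
    _ = _ := mul_assoc _ _ _

/-- The weak type estimate for the maximal function over blocks. -/
lemma measure_maximal_le (H : IsAdmissible ν D C) (hr : 1 ≤ r) (hμ : BlockBound μ ν A r)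
    (g : Cn n → ℝ≥0∞) {t : ℝ≥0∞} (ht0 : t ≠ 0) (htt : t ≠ ∞) :
    μ {z | ∃ ξ h, ‖ξ‖ = 1 ∧ 0 < h ∧ h ≤ 1 ∧ z ∈ block ξ h ∧
      t * ν (block ξ h) < ∫⁻ w in block ξ h, g w ∂ν} ≤
      A * ((D ^ 4) ^ r * (t⁻¹ * ∫⁻ w, g w ∂ν) ^ r) := by
  set T : Set (Cn n × ℝ) := {i | ‖i.1‖ = 1 ∧ 0 < i.2 ∧ i.2 ≤ 1 ∧
    t * ν (block i.1 i.2) < ∫⁻ w in block i.1 i.2, g w ∂ν} with hT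
  -- Vitali's selection with ratio 2: each block meets a selected one whose size is at least half
  -- its own, so the selected block enlarged 16 times contains it.
  obtain ⟨u, huT, hd, hcov⟩ := Vitali.exists_disjoint_subfamily_covering_enlargement
    (fun i : Cn n × ℝ => block i.1 i.2) T (fun i => i.2) 2 one_lt_two (fun i hi => hi.2.1.le) 1
    (fun i hi => hi.2.2.1) (fun i hi => block_nonempty hi.1 hi.2.1)
  have hu : ∀ i ∈ u, ‖i.1‖ = 1 ∧ 0 < i.2 := fun i hi => ⟨(huT hi).1, (huT hi).2.1⟩
  have hc := H.countable_of_pairwiseDisjoint hu hd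
  refine H.measure_le_of_covering hr hu hd (fun i hi => hμ _ (hu i hi).1 _ ?_) ?_ ?_
  · linarith [(hu i hi).2]
  · rintro z ⟨ξ, h, hξ, h0, h1, hz, hlt⟩
    obtain ⟨b, hb, ⟨w, hw1, hw2⟩, hδ⟩ := hcov (ξ, h) ⟨hξ, h0, h1, hlt⟩
    exact mem_biUnion hb (block_subset_block hξ (hu b hb).1 h0 hδ hw1 hw2 hz)
  · calc ∑' i : u, ν (block i.1.1 i.1.2)
        ≤ ∑' i : u, t⁻¹ * ∫⁻ w in block i.1.1 i.1.2, g w ∂ν := by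
          refine ENNReal.tsum_le_tsum fun i => ?_
          rw [mul_comm, ← div_eq_mul_inv, ENNReal.le_div_iff_mul_le (Or.inl ht0) (Or.inl htt),
            mul_comm]
          exact (huT i.2).2.2.2.le
      _ = t⁻¹ * ∫⁻ w in ⋃ i ∈ u, block i.1 i.2, g w ∂ν := by
          rw [ENNReal.tsum_mul_left, lintegral_biUnion hc
            (fun i hi => measurableSet_block (hu i hi).1 (hu i hi).2) hd]
      _ ≤ _ := mul_le_mul_right (setLIntegral_le_lintegral _ _) _

/-- Control on small blocks gives control on larger blocks near the boundary. -/
lemma measure_block_inter_shell_le (H : IsAdmissible ν D C) (hr : 1 ≤ r) {k : ℝ} (k0 : 0 < k)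
    (k1 : k < 1) (hμ : ∀ η : Cn n, ‖η‖ = 1 → μ (block η k) ≤ A * ν (block η k) ^ r)
    {ξ : Cn n} (hξ : ‖ξ‖ = 1) {h : ℝ} (hk : k ≤ h) :
    μ (block ξ h ∩ {z | 1 - k < ‖z‖}) ≤
      A * ((D ^ 4) ^ r * ((D ^ 4) ^ r * ν (block ξ h) ^ r)) := by
  have hr0 : 0 ≤ r := by linarith
  have h0 : 0 < h := k0.trans_le hk
  -- The blocks have the common size k/16, so their enlargements have exactly the size k covered by
  -- the hypothesis. They point in the directions of the points to be covered.
  set T : Set (Cn n × ℝ) := {i | i.2 = k / 16 ∧ ∃ z ∈ block ξ h, 1 - k < ‖z‖ ∧ i.1 = ‖z‖⁻¹ • z}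
    with hT
  have hself : ∀ z : Cn n, z ∈ block ξ h → 1 - k < ‖z‖ → z ∈ block (‖z‖⁻¹ • z) k := by
    intro z hz hkz
    have hz0 : 0 < ‖z‖ := by linarith
    have hz1 : ‖z‖ < 1 := by simpa using block_subset_unitBall hξ h0 hz
    refine (mem_block (norm_inv_smul_self hz0) k0 k1).2 ⟨hkz, hz1, ?_⟩
    rw [inner_self_eq_norm_sq_to_K, norm_inv_smul_self hz0]
    simp [k0.le]
  have hTu : ∀ i ∈ T, ‖i.1‖ = 1 ∧ 0 < i.2 := by
    rintro i ⟨hi, z, hz, hkz, hiz⟩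
    exact ⟨by rw [hiz]; exact norm_inv_smul_self (by linarith), by rw [hi]; linarith⟩
  obtain ⟨u, huT, hd, hcov⟩ := Vitali.exists_disjoint_subfamily_covering_enlargement
    (fun i : Cn n × ℝ => block i.1 i.2) T (fun _ => 1) 2 one_lt_two (fun i hi => zero_le_one) 1
    (fun i hi => le_rfl) (fun i hi => block_nonempty (hTu i hi).1 (hTu i hi).2)
  have hu : ∀ i ∈ u, ‖i.1‖ = 1 ∧ 0 < i.2 := fun i hi => hTu i (huT hi)
  have hc := H.countable_of_pairwiseDisjoint hu hd
  have e16 : ∀ i ∈ u, 16 * i.2 = k := fun i hi => by rw [(huT hi).1]; ring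
  rw [← ENNReal.mul_rpow_of_nonneg _ _ hr0]
  refine H.measure_le_of_covering hr hu hd (fun i hi => ?_) ?_ ?_
  · rw [e16 i hi]; exact hμ _ (hu i hi).1
  · rintro z ⟨hz, hkz⟩
    have hkz : 1 - k < ‖z‖ := hkz
    have hz0 : 0 < ‖z‖ := by linarith
    obtain ⟨b, hb, ⟨w, hw1, hw2⟩, -⟩ := hcov (‖z‖⁻¹ • z, k / 16) ⟨rfl, z, hz, hkz, rfl⟩
    refine mem_biUnion hb ?_
    have hzn := norm_inv_smul_self hz0
    have hz1 : ‖z‖ < 1 := by simpa using block_subset_unitBall hξ h0 hz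
    have hb2 : b.2 = k / 16 := (huT hb).1
    simp only [hb2] at hw2
    rw [e16 b hb, mem_block (hu b hb).1 k0 k1]
    rw [mem_block hzn (by linarith) (by linarith)] at hw1
    rw [mem_block (hu b hb).1 (by linarith) (by linarith)] at hw2
    refine ⟨hkz, hz1, ?_⟩
    have hw0 : 0 < ‖w‖ := by linarith [hw1.1]
    have e1 := norm_one_sub_inner_le_of_unit hzn (hu b hb).1 (norm_inv_smul_self hw0)
    have e2 := norm_one_sub_inner_comm (‖z‖⁻¹ • z) (‖w‖⁻¹ • w)
    linarith [hw1.2.2, hw2.2.2]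
  · calc ∑' i : u, ν (block i.1.1 i.1.2) = ν (⋃ i ∈ u, block i.1 i.2) :=
          (measure_biUnion hc hd fun i hi => measurableSet_block (hu i hi).1 (hu i hi).2).symm
      -- Enlarged to size k, each selected block contains the point z of `block ξ h` that defines
      -- its direction; since k ≤ h, engulfing places it in `block ξ (16 * h)`.
      _ ≤ ν (block ξ (16 * h)) := by
          refine measure_mono (iUnion₂_subset fun i hi => ?_)
          obtain ⟨hi2, z, hz, hkz, hiz⟩ := huT hi
          have hzi : z ∈ block i.1 k := by rw [hiz]; exact hself z hz hkz
          refine (block_mono (hu i hi).1 (hu i hi).2 ?_).trans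
            (block_subset_block (hu i hi).1 hξ k0 (by linarith) hzi hz)
          rw [hi2]; linarith
      _ ≤ D ^ 4 * ν (block ξ h) := by
          have := H.doubling_pow hξ h0 4
          norm_num at this
          exact this

end IsAdmissible

end Covering

/-! ### The embedding estimate by truncation -/

section Embedding

variable {n : ℕ}

lemma exists_polar (hn : 1 ≤ n) {z : Cn n} (hz : z ∈ unitBall n) :
    ∃ ξ : Cn n, ‖ξ‖ = 1 ∧ ∃ h : ℝ, 0 < h ∧ h ≤ 1 ∧ z = (1 - h) • ξ := by
  obtain ⟨ξ, hξ, h, h0, h1, -, hz', -⟩ := exists_block_eq hn hz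
  exact ⟨ξ, hξ, h, h0, h1, hz'⟩

lemma smul_mem_block {ξ : Cn n} (hξ : ‖ξ‖ = 1) {h k : ℝ} (h0 : 0 < h) (h1 : h ≤ 1) (hk : h < k) :
    (1 - h) • ξ ∈ block ξ k := by
  have hn : ‖(1 - h) • ξ‖ = 1 - h := by
    rw [norm_smul, hξ, Real.norm_of_nonneg (by linarith), mul_one]
  rcases lt_or_ge k 1 with hk1 | hk1
  · refine (mem_block hξ (by linarith) hk1).2 ⟨by rw [hn]; linarith, by rw [hn]; linarith, ?_⟩
    rw [hn, inv_smul_smul₀ (by linarith), inner_self_eq_norm_sq_to_K, hξ]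
    simp only [Complex.coe_algebraMap, Complex.ofReal_one, one_pow, sub_self, norm_zero]
    linarith
  · rw [block_of_one_le ξ hk1, mem_ball_zero_iff, hn]
    linarith

lemma block_min_one (ξ : Cn n) (h : ℝ) : block ξ (min h 1) = block ξ h := by
  rcases le_total h 1 with h1 | h1
  · rw [min_eq_left h1]
  · rw [min_eq_right h1, block_of_one_le ξ h1, block_of_one_le ξ le_rfl]

namespace IsAdmissible

variable {ν : Measure (Cn n)} {D C : ℝ≥0}

/-- Points where a holomorphic function is large lie in blocks with large averages of the
truncated function. -/
lemma exists_average_of_lt (hn : 1 ≤ n) (H : IsAdmissible ν D C) {f : Cn n → ℂ}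
    (hf : DifferentiableOn ℂ f (unitBall n)) {m : ℕ} (hm0 : 0 < m) {s : ℝ} (hs : 0 < s)
    (hm : 2 * (D : ℝ≥0∞) ≤ 2 ^ (m * s)) {z : Cn n} (hz : z ∈ unitBall n) {τ : ℝ≥0∞}
    {g : Cn n → ℝ≥0∞} (hg : ∀ᵐ w ∂ν, ‖f w‖ₑ ^ s ≤ g w + τ)
    (hlt : 2 ^ (m * s) * (C * (2 * D ^ 3)) * (2 * τ) < ‖f z‖ₑ ^ s) :
    ∃ ξ h, ‖ξ‖ = 1 ∧ 0 < h ∧ h ≤ 1 ∧ z ∈ block ξ h ∧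
      τ * ν (block ξ h) < ∫⁻ w in block ξ h, g w ∂ν := by
  obtain ⟨ξ, hξ, h, h0, h1, rfl⟩ := exists_polar hn hz
  by_contra hcon
  -- If no block through z has a large average of g, all averages of |f|^s are at most 2τ: one τ
  -- from g and one from the truncation error. Sizes above 1 are replaced by 1, which gives the same
  -- set.
  refine absurd (H.enorm_rpow_le_of_average_le hf hm0 hs hm hξ h0 h1 (t := 2 * τ) fun j => ?_)
    (not_le.2 hlt)
  have hpow : (1 : ℝ) ≤ 2 ^ j := one_le_pow₀ one_le_two
  set k := 8 * (2 ^ j * h) with hk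
  have hhk : h < k := by nlinarith
  have havg : ∫⁻ w in block ξ k, g w ∂ν ≤ τ * ν (block ξ k) := by
    by_contra hlt'
    refine hcon ⟨ξ, min k 1, hξ, lt_min (by linarith) one_pos, min_le_right _ _, ?_, ?_⟩
    · rw [block_min_one]; exact smul_mem_block hξ h0 h1 hhk
    · rw [block_min_one]; exact not_le.1 hlt'
  calc ∫⁻ w in block ξ k, ‖f w‖ₑ ^ s ∂ν ≤ ∫⁻ w in block ξ k, (g w + τ) ∂ν :=
        lintegral_mono_ae (ae_restrict_of_ae hg)
    _ = ∫⁻ w in block ξ k, g w ∂ν + τ * ν (block ξ k) := by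
        rw [lintegral_add_right _ measurable_const, setLIntegral_const]
    _ ≤ τ * ν (block ξ k) + τ * ν (block ξ k) := by gcongr
    _ = _ := by ring

/-- The sufficiency part of the Carleson embedding theorem, with constants. -/
theorem exists_lintegral_le (hn : 1 ≤ n) (H : IsAdmissible ν D C) {p r : ℝ} (hp : 0 < p)
    (hr : 1 ≤ r) : ∃ K : ℝ≥0, ∀ (μ : Measure (Cn n)) (A : ℝ≥0∞), μ (unitBall n)ᶜ = 0 → A ≠ ∞ →
      BlockBound μ ν A r → ∀ f : Cn n → ℂ, DifferentiableOn ℂ f (unitBall n) →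
        ∫⁻ z, ‖f z‖ₑ ^ p ∂ν ≠ ∞ →
          ∫⁻ z, ‖f z‖ₑ ^ (p * r) ∂μ ≤ K * A * (∫⁻ z, ‖f z‖ₑ ^ p ∂ν) ^ r := by
  -- With V = |f|^(p/2), the integral of |f|^p is that of V², and the target is V^(2r): the
  -- weak-type estimate at exponent 1 is used strictly below the exponent 2, which leaves room for
  -- truncation.
  set s := p / 2 with hs
  have hs0 : 0 < s := by positivity
  have hr0 : 0 < r := by linarith
  have : IsFiniteMeasure ν := ⟨H.finite⟩
  obtain ⟨m, hm0, hm⟩ := exists_exponent D hs0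
  set K₀ : ℝ≥0∞ := 2 ^ (m * s) * (C * (2 * D ^ 3)) * 2 with hK₀
  have hK₀t : K₀ ≠ ∞ := by
    have h2t : (2 : ℝ≥0∞) ^ (m * s) ≠ ∞ := by
      simp only [Ne, ENNReal.rpow_eq_top_iff]
      simp
    rw [hK₀]
    finiteness
  -- The truncation level for the superlevel set V > t is τ = t/κ. Then K₀τ ≤ t, so this set lies
  -- where the maximal function of the truncation exceeds τ; the added 1 keeps κ positive.
  set κ : ℝ := K₀.toReal + 1 with hκ
  have hκ0 : 0 < κ := by positivity
  have hK₀κ : K₀ ≤ ENNReal.ofReal κ := by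
    rw [← ENNReal.ofReal_toReal hK₀t]
    exact ENNReal.ofReal_le_ofReal (by linarith)
  have hKt : ENNReal.ofReal (2 * r) * ((D : ℝ≥0∞) ^ 4) ^ r * ENNReal.ofReal κ ^ (2 * r) ≠ ∞ := by
    have h1 : ((D : ℝ≥0∞) ^ 4) ^ r ≠ ∞ := ENNReal.rpow_ne_top_of_nonneg hr0.le (by finiteness)
    have h2 : ENNReal.ofReal κ ^ (2 * r) ≠ ∞ :=
      ENNReal.rpow_ne_top_of_nonneg (by positivity) ENNReal.ofReal_ne_top
    finiteness
  refine ⟨(ENNReal.ofReal (2 * r) * ((D : ℝ≥0∞) ^ 4) ^ r * ENNReal.ofReal κ ^ (2 * r)).toNNReal,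
    fun μ A hμ0 hAt hμ f hf hI => ?_⟩
  rw [ENNReal.coe_toNNReal hKt]
  set I := ∫⁻ z, ‖f z‖ₑ ^ p ∂ν with hIdef
  set V := (unitBall n).indicator (fun z => ‖f z‖ₑ ^ s) with hV
  have hVm : Measurable V := measurable_indicator_ball hf.continuousOn s
  have hVb : ∀ z ∈ unitBall n, V z = ‖f z‖ₑ ^ s := fun z hz => indicator_of_mem hz _
  have hVt : ∀ z, V z ≠ ∞ := fun z => by
    rw [hV]
    by_cases hz : z ∈ unitBall n
    · rw [indicator_of_mem hz]; exact ENNReal.rpow_ne_top_of_nonneg hs0.le enorm_ne_top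
    · rw [indicator_of_notMem hz]; exact ENNReal.zero_ne_top
  set v : Cn n → ℝ := fun z => (V z).toReal with hv
  have hvm : Measurable v := hVm.ennreal_toReal
  have hvV : ∀ z, ENNReal.ofReal (v z) = V z := fun z => ENNReal.ofReal_toReal (hVt z)
  have hμb : ∀ᵐ z ∂μ, z ∈ unitBall n := by rw [ae_iff]; exact hμ0
  have hIV : I = ∫⁻ z, V z * V z ∂ν := by
    refine lintegral_congr_ae ?_
    filter_upwards [H.ae_mem_ball] with z hz
    rw [hVb z hz, ← ENNReal.rpow_add_of_nonneg _ _ hs0.le hs0.le]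
    congr 1; rw [hs]; ring
  have hlhs : ∫⁻ z, ‖f z‖ₑ ^ (p * r) ∂μ = ∫⁻ z, ENNReal.ofReal (v z ^ (2 * r)) ∂μ := by
    refine lintegral_congr_ae ?_
    filter_upwards [hμb] with z hz
    rw [← ENNReal.ofReal_rpow_of_nonneg ENNReal.toReal_nonneg (by positivity), hvV, hVb z hz,
      ← ENNReal.rpow_mul]
    congr 1; rw [hs]; ring
  set S : Set (ℝ × Cn n) := {x | ENNReal.ofReal (x.1 / κ) < V x.2} with hS
  have hSm : MeasurableSet S := by
    refine measurableSet_lt ?_ (hVm.comp measurable_snd)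
    fun_prop
  set G : ℝ → Cn n → ℝ≥0∞ := fun t z => S.indicator (fun x => V x.2) (t, z) with hG
  have hGm : Measurable (Function.uncurry G) := (hVm.comp measurable_snd).indicator hSm
  have hr1 : 0 ≤ r - 1 := by linarith
  have hlevel : ∀ t ∈ Ioi (0 : ℝ), μ {z | t < v z} * ENNReal.ofReal (t ^ (2 * r - 1)) ≤
      A * (D ^ 4) ^ r * ENNReal.ofReal κ ^ (2 * r - 1) * I ^ (r - 1) * ∫⁻ z, G t z ∂ν := by
    intro t ht
    have ht0 : 0 < t := ht
    set τ := ENNReal.ofReal (t / κ) with hτ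
    have hτ0 : τ ≠ 0 := by rw [hτ]; simp; positivity
    have hτt : τ ≠ ∞ := ENNReal.ofReal_ne_top
    have hsub : {z | t < v z} ⊆ {z | ∃ ξ h, ‖ξ‖ = 1 ∧ 0 < h ∧ h ≤ 1 ∧ z ∈ block ξ h ∧
        τ * ν (block ξ h) < ∫⁻ w in block ξ h, G t w ∂ν} := by
      intro z hz
      have hz : t < v z := hz
      have hzb : z ∈ unitBall n := by
        by_contra hzn
        have : v z = 0 := by rw [hv]; simp only [hV, indicator_of_notMem hzn, ENNReal.toReal_zero]
        linarith
      refine exists_average_of_lt hn H hf hm0 hs0 hm hzb ?_ ?_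
      · filter_upwards [H.ae_mem_ball] with w hw
        rw [← hVb w hw, hG]
        by_cases hwS : (t, w) ∈ S
        · simp only [indicator_of_mem hwS]; exact le_self_add
        · have : V w ≤ τ := not_lt.1 hwS
          exact this.trans le_add_self
      · rw [← mul_assoc, ← hVb z hzb, ← hvV]
        calc K₀ * τ ≤ ENNReal.ofReal κ * τ := mul_le_mul_left hK₀κ _
          _ = ENNReal.ofReal t := by
              rw [hτ, ← ENNReal.ofReal_mul hκ0.le, mul_div_cancel₀ _ hκ0.ne']
          _ < ENNReal.ofReal (v z) := (ENNReal.ofReal_lt_ofReal_iff (ht0.trans hz)).2 hz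
    set X := τ⁻¹ * ∫⁻ z, G t z ∂ν with hX
    have hw : μ {z | t < v z} ≤ A * ((D ^ 4) ^ r * X ^ r) :=
      (measure_mono hsub).trans (H.measure_maximal_le hr hμ (G t) hτ0 hτt)
    -- Where V > τ one has V ≤ V²/τ. This crude bound is used for r - 1 of the r factors of X; the
    -- last factor is kept exact for the integration in t.
    have hXle : X ≤ τ⁻¹ ^ 2 * I := by
      rw [hX, pow_two, mul_assoc, hIV]
      refine mul_le_mul_right ?_ _
      rw [← lintegral_const_mul' _ _ (ENNReal.inv_ne_top.2 hτ0)]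
      refine lintegral_mono fun z => ?_
      by_cases hzS : (t, z) ∈ S
      · simp only [hG, indicator_of_mem hzS]
        have hle : τ ≤ V z := le_of_lt hzS
        calc V z = τ⁻¹ * τ * V z := by rw [ENNReal.inv_mul_cancel hτ0 hτt, one_mul]
          _ ≤ τ⁻¹ * V z * V z := mul_le_mul_left (mul_le_mul_right hle _) _
          _ = _ := mul_assoc _ _ _
      · simp only [hG, indicator_of_notMem hzS]; exact zero_le
    have hXr : X ^ r = X * X ^ (r - 1) := by
      conv_lhs => rw [show r = 1 + (r - 1) by ring]
      rw [ENNReal.rpow_add_of_nonneg _ _ zero_le_one hr1, ENNReal.rpow_one]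
    -- The total power of τ⁻¹ is 1 + 2(r - 1) = 2r - 1, which cancels the layer cake weight t^(2r-1)
    -- and leaves only κ.
    have hpow : τ⁻¹ * (τ⁻¹ ^ 2) ^ (r - 1) * ENNReal.ofReal (t ^ (2 * r - 1)) =
        ENNReal.ofReal κ ^ (2 * r - 1) := by
      have h2r : 0 ≤ 2 * r - 1 := by linarith
      have e1 : τ⁻¹ * (τ⁻¹ ^ 2) ^ (r - 1) = τ⁻¹ ^ (2 * r - 1) := by
        rw [← ENNReal.rpow_natCast, ← ENNReal.rpow_mul]
        nth_rewrite 1 [← ENNReal.rpow_one τ⁻¹]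
        rw [← ENNReal.rpow_add_of_nonneg _ _ zero_le_one (by positivity)]
        congr 1; push_cast; ring
      rw [e1, ← ENNReal.ofReal_rpow_of_nonneg ht0.le h2r, ← ENNReal.mul_rpow_of_nonneg _ _ h2r]
      congr 1
      rw [hτ, ← ENNReal.ofReal_inv_of_pos (by positivity), ← ENNReal.ofReal_mul (by positivity)]
      congr 1
      field_simp
    calc μ {z | t < v z} * ENNReal.ofReal (t ^ (2 * r - 1))
        ≤ A * ((D ^ 4) ^ r * (X * (τ⁻¹ ^ 2 * I) ^ (r - 1))) * ENNReal.ofReal (t ^ (2 * r - 1)) := by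
          refine mul_le_mul_left (hw.trans ?_) _
          rw [hXr]
          exact mul_le_mul_right (mul_le_mul_right (mul_le_mul_right
            (ENNReal.rpow_le_rpow hXle hr1) _) _) _
      _ = A * (D ^ 4) ^ r * (τ⁻¹ * (τ⁻¹ ^ 2) ^ (r - 1) * ENNReal.ofReal (t ^ (2 * r - 1))) *
            I ^ (r - 1) * ∫⁻ z, G t z ∂ν := by
          rw [ENNReal.mul_rpow_of_nonneg _ _ hr1, hX]; ring
      _ = _ := by rw [hpow]
  -- For fixed z the truncation is active only for 0 < t < κ v(z), so the integral in t is at most κ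
  -- V(z)².
  have hfub : ∫⁻ t in Ioi (0 : ℝ), ∫⁻ z, G t z ∂ν ≤ ENNReal.ofReal κ * I := by
    rw [lintegral_lintegral_swap hGm.aemeasurable, hIV, ← lintegral_const_mul' _ _ ENNReal.ofReal_ne_top]
    refine lintegral_mono fun z => ?_
    calc ∫⁻ t in Ioi (0 : ℝ), G t z ≤ ∫⁻ t in Ioi (0 : ℝ), (Ioo 0 (κ * v z)).indicator
          (fun _ => V z) t := by
          refine setLIntegral_mono' measurableSet_Ioi fun t ht => ?_
          by_cases htS : (t, z) ∈ S
          · have h1 : ENNReal.ofReal (t / κ) < ENNReal.ofReal (v z) := by rw [hvV]; exact htS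
            have h2 : t / κ < v z := by
              by_contra hle
              exact absurd (ENNReal.ofReal_le_ofReal (not_lt.1 hle)) (not_le.2 h1)
            rw [div_lt_iff₀ hκ0] at h2
            have h3 : t ∈ Ioo 0 (κ * v z) := ⟨ht, by linarith⟩
            rw [indicator_of_mem h3, hG]
            simp only [indicator_of_mem htS]; exact le_rfl
          · simp only [hG, indicator_of_notMem htS]; exact zero_le
      _ ≤ ∫⁻ t, (Ioo 0 (κ * v z)).indicator (fun _ => V z) t := setLIntegral_le_lintegral _ _
      _ = _ := by
          rw [lintegral_indicator_const measurableSet_Ioo, Real.volume_Ioo, sub_zero,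
            ENNReal.ofReal_mul hκ0.le, hvV]
          ring
  have hIr : I ^ r = I ^ (r - 1) * I := by
    conv_lhs => rw [show r = (r - 1) + 1 by ring]
    rw [ENNReal.rpow_add_of_nonneg _ _ hr1 zero_le_one, ENNReal.rpow_one]
  have hκr : ENNReal.ofReal κ ^ (2 * r) = ENNReal.ofReal κ ^ (2 * r - 1) * ENNReal.ofReal κ := by
    conv_lhs => rw [show 2 * r = (2 * r - 1) + 1 by ring]
    rw [ENNReal.rpow_add_of_nonneg _ _ (by linarith) zero_le_one, ENNReal.rpow_one]
  have hc1 : ((D : ℝ≥0∞) ^ 4) ^ r ≠ ∞ := ENNReal.rpow_ne_top_of_nonneg hr0.le (by finiteness)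
  have hc2 : ENNReal.ofReal κ ^ (2 * r - 1) ≠ ∞ :=
    ENNReal.rpow_ne_top_of_nonneg (by linarith) ENNReal.ofReal_ne_top
  have hc3 : I ^ (r - 1) ≠ ∞ := ENNReal.rpow_ne_top_of_nonneg hr1 hI
  rw [hlhs, lintegral_rpow_eq_lintegral_meas_lt_mul μ
    (Eventually.of_forall fun z => ENNReal.toReal_nonneg) hvm.aemeasurable (by positivity)]
  calc _ ≤ ENNReal.ofReal (2 * r) * ∫⁻ t in Ioi (0 : ℝ), A * (D ^ 4) ^ r *
          ENNReal.ofReal κ ^ (2 * r - 1) * I ^ (r - 1) * ∫⁻ z, G t z ∂ν :=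
        mul_le_mul_right (setLIntegral_mono' measurableSet_Ioi hlevel) _
    _ ≤ ENNReal.ofReal (2 * r) * (A * (D ^ 4) ^ r *
          ENNReal.ofReal κ ^ (2 * r - 1) * I ^ (r - 1) * (ENNReal.ofReal κ * I)) := by
        rw [lintegral_const_mul' _ _ (by finiteness)]
        exact mul_le_mul_right (mul_le_mul_right hfub _) _
    _ = _ := by rw [hIr, hκr]; ring

end IsAdmissible

end Embedding

lemma le_rpow_one_div_iff {x y : ℝ≥0∞} {z : ℝ} (hz : 0 < z) : x ≤ y ^ (1 / z) ↔ x ^ z ≤ y := by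
  rw [one_div, ENNReal.le_rpow_inv_iff hz]

lemma eLpNorm_ofReal_rpow {α : Type*} [MeasurableSpace α] (μ : Measure α) (f : α → ℂ) {q : ℝ}
    (hq : 0 < q) : eLpNorm f (ENNReal.ofReal q) μ ^ q = ∫⁻ z, ‖f z‖ₑ ^ q ∂μ := by
  rw [eLpNorm_eq_lintegral_rpow_enorm_toReal (by simpa using hq) ENNReal.ofReal_ne_top,
    ENNReal.toReal_ofReal hq.le, ← ENNReal.rpow_mul, one_div_mul_cancel hq.ne', ENNReal.rpow_one]

/-! ### Normalized test functions -/

section TestFunctions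

variable {n : ℕ}

namespace IsAdmissible

variable {ν : Measure (Cn n)} {D C : ℝ≥0}

/-- With 2^k ≤ 1/h < 2^(k+1), the ball costs k + 1 doublings while h^M ≤ 2^(-kM). The surplus 2^(-k)
≤ 2h leaves a spare factor h, which makes the normalized kernels decay pointwise. -/
lemma rpow_mul_measure_ball_le (H : IsAdmissible ν D C) {ξ : Cn n} (hξ : ‖ξ‖ = 1) {h : ℝ}
    (h0 : 0 < h) (h1 : h ≤ 1) {M : ℝ} (hM0 : 0 ≤ M) (hM : 2 * (D : ℝ≥0∞) ≤ 2 ^ M) :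
    ENNReal.ofReal h ^ M * ν (unitBall n) ≤ 2 * D * ENNReal.ofReal h * ν (block ξ h) := by
  obtain ⟨k, hk, hk'⟩ := exists_nat_pow_near (x := 1 / h) (y := (2 : ℝ))
    ((one_le_div h0).2 h1) one_lt_two
  have hb : ν (unitBall n) ≤ D ^ (k + 1) * ν (block ξ h) := by
    rw [← block_of_one_le ξ (h := 2 ^ (k + 1) * h)]
    · exact H.doubling_pow hξ h0 _
    · rw [div_lt_iff₀ h0] at hk'; exact hk'.le
  have hh : ENNReal.ofReal h ≤ (2⁻¹ : ℝ≥0∞) ^ k := by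
    rw [le_div_iff₀ h0] at hk
    have : h ≤ (2⁻¹ : ℝ) ^ k := by
      rw [inv_pow, ← one_div, le_div_iff₀ (by positivity), mul_comm]; exact hk
    refine (ENNReal.ofReal_le_ofReal this).trans_eq ?_
    rw [ENNReal.ofReal_pow (by norm_num), ENNReal.ofReal_inv_of_pos (by norm_num),
      ENNReal.ofReal_ofNat]
  have hh2 : (2⁻¹ : ℝ≥0∞) ^ k ≤ 2 * ENNReal.ofReal h := by
    rw [div_lt_iff₀ h0] at hk'
    have : (2⁻¹ : ℝ) ^ k ≤ 2 * h := by
      rw [inv_pow, inv_le_iff_one_le_mul₀' (by positivity)]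
      rw [pow_succ] at hk'; linarith
    calc (2⁻¹ : ℝ≥0∞) ^ k = ENNReal.ofReal ((2⁻¹ : ℝ) ^ k) := by
          rw [ENNReal.ofReal_pow (by norm_num), ENNReal.ofReal_inv_of_pos (by norm_num),
            ENNReal.ofReal_ofNat]
      _ ≤ ENNReal.ofReal (2 * h) := ENNReal.ofReal_le_ofReal this
      _ = _ := by rw [ENNReal.ofReal_mul (by norm_num), ENNReal.ofReal_ofNat]
  have hDM := inv_two_rpow_mul_le hM
  calc ENNReal.ofReal h ^ M * ν (unitBall n)
      ≤ ((2⁻¹ : ℝ≥0∞) ^ k) ^ M * (D ^ (k + 1) * ν (block ξ h)) :=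
        mul_le_mul' (ENNReal.rpow_le_rpow hh hM0) hb
    _ = D * ((2⁻¹ : ℝ≥0∞) ^ M * D) ^ k * ν (block ξ h) := by
        rw [← ENNReal.rpow_natCast (2⁻¹) k, ← ENNReal.rpow_mul, mul_comm (k : ℝ) M,
          ENNReal.rpow_mul, ENNReal.rpow_natCast, mul_pow, pow_succ]
        ring
    _ ≤ D * (2 * ENNReal.ofReal h) * ν (block ξ h) := by
        refine mul_le_mul_left (mul_le_mul_right ?_ _) _
        exact (pow_le_pow_left₀ zero_le hDM k).trans hh2
    _ = _ := by ring

/-- Normalized test functions concentrated on a block. -/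
lemma exists_normalized_testFun (hn : 1 ≤ n) (H : IsAdmissible ν D C) {p : ℝ} (hp : 0 < p) :
    ∃ L : ℝ≥0, 0 < L ∧ ∃ Λ : Cn n → ℝ≥0∞, (∀ z ∈ unitBall n, Λ z ≠ ∞) ∧
      ∀ ξ : Cn n, ‖ξ‖ = 1 → ∀ h, 0 < h → h ≤ 1 → ∃ F : Cn n → ℂ,
        DifferentiableOn ℂ F (unitBall n) ∧ ∫⁻ z, ‖F z‖ₑ ^ p ∂ν ≤ 1 ∧
        (∀ z ∈ block ξ h, (L * ν (block ξ h))⁻¹ ≤ ‖F z‖ₑ ^ p) ∧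
        ∀ z ∈ unitBall n, ‖F z‖ₑ ^ p ≤ Λ z * ENNReal.ofReal h := by
  obtain ⟨m, hm0, hm⟩ := exists_exponent D hp
  have hm0' : (0 : ℝ) < m := by exact_mod_cast hm0
  have hmp : 0 < m * p := by positivity
  have hD0 : (D : ℝ≥0∞) ≠ 0 := by
    have := H.one_le; exact_mod_cast (zero_lt_one.trans_le this).ne'
  have hB1 : ν (unitBall n) ≠ ∞ := ((measure_mono (subset_univ _)).trans_lt H.finite).ne
  set K : ℝ≥0∞ := 2 * D ^ 3 with hK
  have hK0 : K ≠ 0 := by rw [hK]; positivity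
  have hKt : K ≠ ∞ := by rw [hK]; finiteness
  -- On the block |1 - ⟨z, a⟩| ≤ 3h, so the kernel is at least 1/3 there; 2D³ is the constant in the
  -- norm of the kernel.
  set L : ℝ≥0 := 3 ^ (m * p) * (2 * D ^ 3) with hL
  have hLc : (L : ℝ≥0∞) = 3 ^ (m * p) * K := by
    rw [hL, hK]; push_cast
    rw [ENNReal.coe_rpow_of_nonneg _ hmp.le]; norm_num
  -- Λ comes from |1 - ⟨z, a⟩| ≥ 1 - ‖z‖, with the normalizing mass of the block absorbed by
  -- `rpow_mul_measure_ball_le`. It does not depend on the block.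
  refine ⟨L, ?_, fun z => (K * ν (unitBall n))⁻¹ * (2 * D) *
    ENNReal.ofReal (1 - ‖z‖)⁻¹ ^ (m * p), fun z hz => ?_, fun ξ hξ h h0 h1 => ?_⟩
  · have : 0 < D := zero_lt_one.trans_le H.one_le
    positivity
  · have hb : ν (unitBall n) ≠ 0 := by
      have hξ : ‖(EuclideanSpace.single ⟨0, hn⟩ 1 : Cn n)‖ = 1 := by simp
      have := H.block_pos _ hξ 1 one_pos
      rw [block_of_one_le _ le_rfl] at this
      exact this.ne'
    have h1 : (K * ν (unitBall n))⁻¹ ≠ ∞ := ENNReal.inv_ne_top.2 (mul_ne_zero hK0 hb)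
    have h2 : ENNReal.ofReal (1 - ‖z‖)⁻¹ ^ (m * p) ≠ ∞ :=
      ENNReal.rpow_ne_top_of_nonneg hmp.le ENNReal.ofReal_ne_top
    finiteness
  · set B := ν (block ξ h) with hB
    have hB0 : B ≠ 0 := (H.block_pos ξ hξ h h0).ne'
    have hBt : B ≠ ∞ := H.block_ne_top ξ h
    have hKB0 : K * B ≠ 0 := mul_ne_zero hK0 hB0
    have hKBt : K * B ≠ ∞ := ENNReal.mul_ne_top hKt hBt
    set c : ℝ := ((K * B)⁻¹ ^ (1 / p)).toReal with hc
    have hce : ‖(c : ℂ)‖ₑ ^ p = (K * B)⁻¹ := by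
      have ht : (K * B)⁻¹ ^ (1 / p) ≠ ∞ :=
        ENNReal.rpow_ne_top_of_nonneg (by positivity) (ENNReal.inv_ne_top.2 hKB0)
      rw [← ofReal_norm, Complex.norm_real, Real.norm_of_nonneg ENNReal.toReal_nonneg,
        ENNReal.ofReal_toReal ht, ← ENNReal.rpow_mul, one_div_mul_cancel hp.ne', ENNReal.rpow_one]
    have hFe : ∀ z, ‖(c : ℂ) * testFun ξ h m z‖ₑ ^ p = (K * B)⁻¹ * ‖testFun ξ h m z‖ₑ ^ p :=
      fun z => by rw [enorm_mul, ENNReal.mul_rpow_of_nonneg _ _ hp.le, hce]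
    refine ⟨fun z => c * testFun ξ h m z,
      (differentiableOn_testFun hξ h0 h1 m).const_mul _, ?_, fun z hz => ?_, fun z hz => ?_⟩
    · simp_rw [hFe]
      rw [lintegral_const_mul' _ _ (ENNReal.inv_ne_top.2 hKB0)]
      refine (mul_le_mul_right (H.lintegral_testFun_le hξ h0 h1 hm0 hp hm) _).trans_eq ?_
      exact ENNReal.inv_mul_cancel hKB0 hKBt
    · rw [hFe, enorm_testFun_rpow h0]
      have hN := norm_one_sub_inner_le_three_mul hξ h0 h1 hz
      have hz1 : ‖z‖ < 1 := by simpa using block_subset_unitBall hξ h0 hz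
      have hN0 : 0 < ‖1 - inner ℂ z ((1 - h) • ξ)‖ :=
        h0.trans_le (le_norm_one_sub_inner hξ h1 hz1.le)
      have h3 : (3 : ℝ≥0∞)⁻¹ ≤ ENNReal.ofReal (h / ‖1 - inner ℂ z ((1 - h) • ξ)‖) := by
        have e3 : (3⁻¹ : ℝ≥0∞) = ENNReal.ofReal (3⁻¹) := by
          rw [ENNReal.ofReal_inv_of_pos (by norm_num), ENNReal.ofReal_ofNat]
        rw [e3]
        refine ENNReal.ofReal_le_ofReal ?_
        rw [le_div_iff₀ hN0]; linarith
      have h30 : (3 : ℝ≥0∞) ^ (m * p) ≠ 0 := by simp [ENNReal.rpow_eq_zero_iff]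
      have h3t : (3 : ℝ≥0∞) ^ (m * p) ≠ ∞ :=
        ENNReal.rpow_ne_top_of_nonneg hmp.le (by norm_num)
      rw [hLc, mul_assoc, ENNReal.mul_inv (Or.inl h30) (Or.inl h3t), mul_comm, ← ENNReal.inv_rpow]
      exact mul_le_mul_right (ENNReal.rpow_le_rpow h3 hmp.le) _
    · rw [hFe, enorm_testFun_rpow h0]
      have hz1 : ‖z‖ < 1 := by simpa using hz
      have hN : 1 - ‖z‖ ≤ ‖1 - inner ℂ z ((1 - h) • ξ)‖ := by
        refine le_trans ?_ one_sub_le_norm_one_sub_inner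
        rw [norm_smul, hξ, Real.norm_of_nonneg (by linarith)]
        nlinarith [norm_nonneg z]
      have hN0 : 0 < 1 - ‖z‖ := by linarith
      have hq : ENNReal.ofReal (h / ‖1 - inner ℂ z ((1 - h) • ξ)‖) ^ (m * p) ≤
          ENNReal.ofReal h ^ (m * p) * ENNReal.ofReal (1 - ‖z‖)⁻¹ ^ (m * p) := by
        rw [← ENNReal.mul_rpow_of_nonneg _ _ hmp.le, ← ENNReal.ofReal_mul h0.le]
        refine ENNReal.rpow_le_rpow (ENNReal.ofReal_le_ofReal ?_) hmp.le
        rw [← div_eq_mul_inv]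
        gcongr
      have hb := H.rpow_mul_measure_ball_le hξ h0 h1 hmp.le hm
      have hb1 : ν (unitBall n) ≠ 0 := fun h => by
        refine hB0 (le_antisymm ?_ zero_le)
        rw [← h]; exact measure_mono (block_subset_unitBall hξ h0)
      have hb2 : ENNReal.ofReal h ^ (m * p) ≤
          (ν (unitBall n))⁻¹ * (2 * D * ENNReal.ofReal h * B) := by
        rw [mul_comm (ν (unitBall n))⁻¹, ← div_eq_mul_inv,
          ENNReal.le_div_iff_mul_le (Or.inl hb1) (Or.inl hB1)]
        exact hb
      calc _ ≤ (K * B)⁻¹ * ((ν (unitBall n))⁻¹ * (2 * D * ENNReal.ofReal h * B) *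
            ENNReal.ofReal (1 - ‖z‖)⁻¹ ^ (m * p)) :=
            mul_le_mul_right (hq.trans (mul_le_mul_left hb2 _)) _
        _ = (K⁻¹ * (ν (unitBall n))⁻¹) * (2 * D) * ENNReal.ofReal (1 - ‖z‖)⁻¹ ^ (m * p) *
              ENNReal.ofReal h * (B⁻¹ * B) := by
            rw [ENNReal.mul_inv (Or.inl hK0) (Or.inl hKt)]; ring
        _ = _ := by
            rw [ENNReal.inv_mul_cancel hB0 hBt, mul_one,
              ENNReal.mul_inv (Or.inl hK0) (Or.inl hKt)]

end IsAdmissible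

end TestFunctions

/-! ### Carleson measures and the operator norm -/

section Bounded

variable {n : ℕ} {ω : ℝ → ℝ} {p q : ℝ}

lemma bergmanNorm_rpow (hp : 0 < p) (f : Cn n → ℂ) :
    bergmanNorm n ω p f ^ p = ∫⁻ z, ‖f z‖ₑ ^ p ∂(weightMeasure n ω) :=
  eLpNorm_ofReal_rpow _ _ hp

lemma lintegral_ne_top_of_mem_bergmanSpace (hp : 0 < p) {f : Cn n → ℂ}
    (hf : f ∈ bergmanSpace n ω p) : ∫⁻ z, ‖f z‖ₑ ^ p ∂(weightMeasure n ω) ≠ ∞ := by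
  rw [← bergmanNorm_rpow hp]
  exact ENNReal.rpow_ne_top_of_nonneg hp.le hf.2.ne

lemma mem_bergmanSpace_of_lintegral_le (hp : 0 < p) {f : Cn n → ℂ}
    (hf : DifferentiableOn ℂ f (unitBall n)) {c : ℝ≥0∞} (hc : c ≠ ∞)
    (h : ∫⁻ z, ‖f z‖ₑ ^ p ∂(weightMeasure n ω) ≤ c) :
    f ∈ bergmanSpace n ω p ∧ bergmanNorm n ω p f ≤ c ^ (1 / p) := by
  rw [← bergmanNorm_rpow hp, ← le_rpow_one_div_iff hp] at h
  exact ⟨⟨hf, h.trans_lt (ENNReal.rpow_ne_top_of_nonneg (by positivity) hc).lt_top⟩, h⟩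

lemma IsAdmissible.blockBound_of_blockRatio_le {D C : ℝ≥0}
    (H : IsAdmissible (weightMeasure n ω) D C) {μ : Measure (Cn n)} {A : ℝ≥0∞}
    (hr : 0 < q / p) (hA : ∀ a ∈ unitBall n, blockRatio ω p q μ a ≤ A) :
    BlockBound μ (weightMeasure n ω) A (q / p) := by
  intro ξ hξ h h0
  obtain ⟨a, ha, -, hab⟩ := block_eq_carlesonBlock hξ h0
  have := hA a ha
  rw [blockRatio, hab] at this
  have hB0 := (H.block_pos ξ hξ h h0).ne'
  have hBt := H.block_ne_top ξ h
  refine (ENNReal.div_le_iff ?_ ?_).1 this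
  · simp [ENNReal.rpow_eq_zero_iff, hB0, hBt]
  · exact ENNReal.rpow_ne_top_of_nonneg hr.le hBt

lemma aestronglyMeasurable_of_continuousOn {μ : Measure (Cn n)} (hμ : IsMeasureOnBall μ)
    {f : Cn n → ℂ} (hf : ContinuousOn f (unitBall n)) : AEStronglyMeasurable f μ := by
  have h := hf.aestronglyMeasurable (μ := μ) measurableSet_ball
  rwa [Measure.restrict_eq_self_of_ae_mem] at h
  rw [ae_iff]; exact hμ

/-- The mass of a block is controlled by a normalized test function. -/
lemma measure_block_le {μ ν : Measure (Cn n)} {r : ℝ} (hr : 0 < r) {F : Cn n → ℂ} {L : ℝ≥0}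
    (hL : 0 < L) {ξ : Cn n} (hξ : ‖ξ‖ = 1) {h : ℝ} (h0 : 0 < h) (hB0 : ν (block ξ h) ≠ 0)
    (hBt : ν (block ξ h) ≠ ∞) (hF : ∀ z ∈ block ξ h, (L * ν (block ξ h))⁻¹ ≤ ‖F z‖ₑ ^ p) :
    μ (block ξ h) / ν (block ξ h) ^ r ≤ (L : ℝ≥0∞) ^ r * ∫⁻ z, ‖F z‖ₑ ^ (p * r) ∂μ := by
  set B := ν (block ξ h)
  have hL0 : (L : ℝ≥0∞) ≠ 0 := by exact_mod_cast hL.ne'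
  have hLB0 : (L * B) ≠ 0 := mul_ne_zero hL0 hB0
  have hLBt : (L * B) ≠ ∞ := ENNReal.mul_ne_top ENNReal.coe_ne_top hBt
  have hx0 : (L * B) ^ r ≠ 0 := by simp [ENNReal.rpow_eq_zero_iff, hLB0, hLBt]
  have hxt : (L * B) ^ r ≠ ∞ := ENNReal.rpow_ne_top_of_nonneg hr.le hLBt
  have hB0' : B ^ r ≠ 0 := by simp [ENNReal.rpow_eq_zero_iff, hB0, hBt]
  have hBt' : B ^ r ≠ ∞ := ENNReal.rpow_ne_top_of_nonneg hr.le hBt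
  have h1 : ((L * B) ^ r)⁻¹ * μ (block ξ h) ≤ ∫⁻ z, ‖F z‖ₑ ^ (p * r) ∂μ := by
    calc ((L * B) ^ r)⁻¹ * μ (block ξ h) = ∫⁻ _ in block ξ h, ((L * B) ^ r)⁻¹ ∂μ := by
          rw [setLIntegral_const]
      _ ≤ ∫⁻ z in block ξ h, ‖F z‖ₑ ^ (p * r) ∂μ := by
          refine setLIntegral_mono' (measurableSet_block hξ h0) fun z hz => ?_
          rw [ENNReal.rpow_mul, ← ENNReal.inv_rpow]
          exact ENNReal.rpow_le_rpow (hF z hz) hr.le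
      _ ≤ _ := setLIntegral_le_lintegral _ _
  rw [ENNReal.div_le_iff hB0' hBt']
  calc μ (block ξ h) = (L * B) ^ r * (((L * B) ^ r)⁻¹ * μ (block ξ h)) := by
        rw [← mul_assoc, ENNReal.mul_inv_cancel hx0 hxt, one_mul]
    _ ≤ (L * B) ^ r * ∫⁻ z, ‖F z‖ₑ ^ (p * r) ∂μ := mul_le_mul_right h1 _
    _ = _ := by rw [ENNReal.mul_rpow_of_nonneg _ _ hr.le]; ring

lemma exists_iSup_blockRatio_le (hn : 1 ≤ n) (hp : 0 < p) (hpq : p ≤ q)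
    (hω : IsDoublingWeight n ω) : ∃ K : ℝ≥0, ∀ μ : Measure (Cn n),
      (⨆ a ∈ unitBall n, blockRatio ω p q μ a) ≤ K * idNorm ω p q μ ^ q := by
  obtain ⟨D, C, H⟩ := exists_isAdmissible_weightMeasure hn hω
  obtain ⟨L, hL, Λ, -, hF⟩ := H.exists_normalized_testFun hn hp
  have hq : 0 < q := hp.trans_le hpq
  have hr : 0 < q / p := by positivity
  refine ⟨L ^ (q / p), fun μ => iSup₂_le fun a ha => ?_⟩
  obtain ⟨ξ, hξ, h, h0, h1, -, -, hab⟩ := exists_block_eq hn ha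
  obtain ⟨F, hFd, hFn, hFl, -⟩ := hF ξ hξ h h0 h1
  rw [blockRatio, hab]
  refine (measure_block_le (μ := μ) hr hL hξ h0 (H.block_pos ξ hξ h h0).ne' (H.block_ne_top ξ h)
    hFl).trans ?_
  rw [mul_div_cancel₀ _ hp.ne', ENNReal.coe_rpow_of_nonneg _ hr.le, ← eLpNorm_ofReal_rpow μ F hq]
  refine mul_le_mul_right (ENNReal.rpow_le_rpow ?_ hq.le) _
  obtain ⟨m1, m2⟩ := mem_bergmanSpace_of_lintegral_le hp hFd ENNReal.one_ne_top hFn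
  rw [ENNReal.one_rpow] at m2
  exact le_iSup₂_of_le F ⟨m1, m2⟩ le_rfl

/-- The embedding with constants, in terms of the block ratios. -/
lemma exists_eLpNorm_rpow_le (hn : 1 ≤ n) (hp : 0 < p) (hpq : p ≤ q)
    (hω : IsDoublingWeight n ω) : ∃ K : ℝ≥0, ∀ μ : Measure (Cn n), IsMeasureOnBall μ →
      ∀ A : ℝ≥0∞, A ≠ ∞ → BlockBound μ (weightMeasure n ω) A (q / p) →
        ∀ f ∈ bergmanSpace n ω p,
          eLpNorm f (ENNReal.ofReal q) μ ^ q ≤ K * A * bergmanNorm n ω p f ^ q := by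
  obtain ⟨D, C, H⟩ := exists_isAdmissible_weightMeasure hn hω
  have hq : 0 < q := hp.trans_le hpq
  have hr : 1 ≤ q / p := (one_le_div hp).2 hpq
  obtain ⟨K, hK⟩ := H.exists_lintegral_le hn hp hr
  refine ⟨K, fun μ hμ A hA hb f hf => ?_⟩
  have := hK μ A hμ hA hb f hf.1 (lintegral_ne_top_of_mem_bergmanSpace hp hf)
  rwa [mul_div_cancel₀ _ hp.ne', ← eLpNorm_ofReal_rpow μ f hq, ← bergmanNorm_rpow hp,
    ← ENNReal.rpow_mul, mul_div_cancel₀ _ hp.ne'] at this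

lemma IsCarleson.idNorm_lt_top {μ : Measure (Cn n)} (h : IsCarleson ω p q μ) :
    idNorm ω p q μ < ∞ := by
  obtain ⟨C, hC⟩ := h
  refine lt_of_le_of_lt (iSup₂_le fun f hf => ?_) (ENNReal.coe_lt_top (r := C))
  exact (hC f hf.1).2.trans (mul_le_of_le_one_right zero_le hf.2)

lemma isCarleson_of_blockBound (hn : 1 ≤ n) (hp : 0 < p) (hpq : p ≤ q)
    (hω : IsDoublingWeight n ω) {μ : Measure (Cn n)} (hμ : IsMeasureOnBall μ) {A : ℝ≥0∞}
    (hA : A ≠ ∞) (hb : BlockBound μ (weightMeasure n ω) A (q / p)) : IsCarleson ω p q μ := by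
  obtain ⟨K, hK⟩ := exists_eLpNorm_rpow_le hn hp hpq hω
  have hq : 0 < q := hp.trans_le hpq
  have hKA : ((K : ℝ≥0∞) * A) ^ (1 / q) ≠ ∞ :=
    ENNReal.rpow_ne_top_of_nonneg (by positivity) (by finiteness)
  refine ⟨(((K : ℝ≥0∞) * A) ^ (1 / q)).toNNReal, fun f hf => ?_⟩
  rw [ENNReal.coe_toNNReal hKA]
  have h1 : eLpNorm f (ENNReal.ofReal q) μ ≤ ((K : ℝ≥0∞) * A) ^ (1 / q) * bergmanNorm n ω p f := by
    have := hK μ hμ A hA hb f hf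
    rwa [← le_rpow_one_div_iff hq, ENNReal.mul_rpow_of_nonneg _ _ (by positivity),
      ← ENNReal.rpow_mul _ q, mul_one_div_cancel hq.ne', ENNReal.rpow_one] at this
  exact ⟨⟨aestronglyMeasurable_of_continuousOn hμ hf.1.continuousOn,
    h1.trans_lt (ENNReal.mul_lt_top hKA.lt_top hf.2)⟩, h1⟩

theorem isCarleson_iff (hn : 1 ≤ n) (hp : 0 < p) (hpq : p ≤ q) (hω : IsDoublingWeight n ω)
    {μ : Measure (Cn n)} (hμ : IsMeasureOnBall μ) :
    IsCarleson ω p q μ ↔ (⨆ a ∈ unitBall n, blockRatio ω p q μ a) < ∞ := by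
  have hq : 0 < q := hp.trans_le hpq
  constructor
  · intro h
    obtain ⟨K, hK⟩ := exists_iSup_blockRatio_le hn hp hpq hω
    exact (hK μ).trans_lt (ENNReal.mul_lt_top ENNReal.coe_lt_top
      (ENNReal.rpow_ne_top_of_nonneg hq.le h.idNorm_lt_top.ne).lt_top)
  · intro h
    obtain ⟨D, C, H⟩ := exists_isAdmissible_weightMeasure hn hω
    exact isCarleson_of_blockBound hn hp hpq hω hμ h.ne
      (H.blockBound_of_blockRatio_le (by positivity) fun a ha => le_iSup₂_of_le a ha le_rfl)

theorem exists_idNorm_comparison (hn : 1 ≤ n) (hp : 0 < p) (hpq : p ≤ q)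
    (hω : IsDoublingWeight n ω) : ∃ C : ℝ≥0, 0 < C ∧ ∀ μ : Measure (Cn n), IsMeasureOnBall μ →
      IsCarleson ω p q μ →
        idNorm ω p q μ ^ q ≤ C * ⨆ a ∈ unitBall n, blockRatio ω p q μ a ∧
        (⨆ a ∈ unitBall n, blockRatio ω p q μ a) ≤ C * idNorm ω p q μ ^ q := by
  have hq : 0 < q := hp.trans_le hpq
  obtain ⟨D, C, H⟩ := exists_isAdmissible_weightMeasure hn hω
  obtain ⟨K₁, hK₁⟩ := exists_iSup_blockRatio_le hn hp hpq hω
  obtain ⟨K₂, hK₂⟩ := exists_eLpNorm_rpow_le hn hp hpq hω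
  refine ⟨K₁ + K₂ + 1, by positivity, fun μ hμ hc => ⟨?_, (hK₁ μ).trans ?_⟩⟩
  · set A := ⨆ a ∈ unitBall n, blockRatio ω p q μ a with hA
    have hAt : A ≠ ∞ := ((isCarleson_iff hn hp hpq hω hμ).1 hc).ne
    have hb : BlockBound μ (weightMeasure n ω) A (q / p) :=
      H.blockBound_of_blockRatio_le (by positivity) fun a ha => le_iSup₂_of_le a ha le_rfl
    have h1 : idNorm ω p q μ ^ q ≤ K₂ * A := by
      rw [← le_rpow_one_div_iff hq]
      refine iSup₂_le fun f hf => ?_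
      rw [le_rpow_one_div_iff hq]
      exact (hK₂ μ hμ A hAt hb f hf.1).trans
        (mul_le_of_le_one_right zero_le (ENNReal.rpow_le_one hf.2 hq.le))
    refine h1.trans (mul_le_mul_left ?_ _)
    exact_mod_cast (le_add_self.trans le_self_add : K₂ ≤ K₁ + K₂ + 1)
  · refine mul_le_mul_left ?_ _
    exact_mod_cast (le_self_add.trans le_self_add : K₁ ≤ K₁ + K₂ + 1)

end Bounded

/-- A locally bounded sequence of holomorphic functions has a pointwise convergent subsequence. -/
lemma exists_subseq_tendsto {E : Type*} [NormedAddCommGroup E] [NormedSpace ℂ E]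
    [TopologicalSpace.SeparableSpace E] {U : Set E} {f : ℕ → E → ℂ}
    (hf : ∀ k, DifferentiableOn ℂ (f k) U)
    (hb : ∀ z ∈ U, ∃ δ > 0, Metric.ball z δ ⊆ U ∧
      ∃ B : ℝ, ∀ k, ∀ w ∈ Metric.ball z δ, ‖f k w‖ ≤ B) :
    ∃ φ : ℕ → ℕ, StrictMono φ ∧ ∃ g : E → ℂ, ∀ z ∈ U,
      Tendsto (fun j => f (φ j) z) atTop (𝓝 (g z)) := by
  obtain ⟨S, hSc, hSd⟩ := TopologicalSpace.exists_countable_dense E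
  have hSU : (S ∩ U).Countable := hSc.mono inter_subset_left
  have : Countable ↥(S ∩ U) := hSU.to_subtype
  have hB : ∀ t : ↥(S ∩ U), ∃ B : ℝ, ∀ k, ‖f k t‖ ≤ B := fun t => by
    obtain ⟨δ, hδ, -, B, hB⟩ := hb t t.2.2
    exact ⟨B, fun k => hB k t (Metric.mem_ball_self hδ)⟩
  choose B hB using hB
  -- Values on a countable dense set range in a countable product of discs, whose sequential
  -- compactness replaces a diagonal argument.
  have hK : IsCompact (univ.pi fun t : ↥(S ∩ U) => Metric.closedBall (0 : ℂ) (B t)) :=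
    isCompact_univ_pi fun t => isCompact_closedBall _ _
  obtain ⟨G, -, φ, hφ, hG⟩ := hK.isSeqCompact (x := fun k t => f k t)
    fun k t _ => by simpa using hB t k
  rw [tendsto_pi_nhds] at hG
  have hc : ∀ z ∈ U, ∃ w, Tendsto (fun j => f (φ j) z) atTop (𝓝 w) := fun z hz => by
    obtain ⟨δ, hδ, hδU, B, hB⟩ := hb z hz
    have hB0 : 0 ≤ B := (norm_nonneg _).trans (hB 0 z (Metric.mem_ball_self hδ))
    -- Schwarz's lemma turns the uniform local bound into a Lipschitz bound independent of k, which
    -- spreads convergence from the dense set to z.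
    have hlip : ∀ k, ∀ w ∈ Metric.ball z δ, dist (f k w) (f k z) ≤ 2 * B / δ * dist w z := by
      intro k w hw
      refine Complex.dist_le_div_mul_dist_of_mapsTo_ball ((hf k).mono hδU) (fun v hv => ?_) hw
      rw [Metric.mem_closedBall, dist_eq_norm]
      have := norm_sub_le (f k v) (f k z)
      linarith [hB k v hv, hB k z (Metric.mem_ball_self hδ)]
    refine cauchySeq_tendsto_of_complete (Metric.cauchySeq_iff.2 fun ε hε => ?_)
    have hL : 0 ≤ 2 * B / δ := by positivity
    set η := min δ (ε / (3 * (2 * B / δ + 1))) with hη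
    have hη0 : 0 < η := by positivity
    obtain ⟨t, htS, ht⟩ := Metric.dense_iff.1 hSd z η hη0
    have htδ : t ∈ Metric.ball z δ := Metric.ball_subset_ball (min_le_left _ _) htS
    have hLt : 2 * B / δ * dist t z < ε / 3 := by
      have h1 : dist t z < ε / (3 * (2 * B / δ + 1)) :=
        (Metric.mem_ball.1 htS).trans_le (min_le_right _ _)
      rw [lt_div_iff₀ (by positivity)] at h1
      nlinarith [dist_nonneg (x := t) (y := z)]
    obtain ⟨N, hN⟩ := Metric.cauchySeq_iff.1 (hG ⟨t, ht, hδU htδ⟩).cauchySeq (ε / 3) (by positivity)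
    refine ⟨N, fun i hi j hj => ?_⟩
    have h1 := hlip (φ i) t htδ
    have h2 := hlip (φ j) t htδ
    have h3 : dist (f (φ i) t) (f (φ j) t) < ε / 3 := hN i hi j hj
    have h4 := dist_triangle4 (f (φ i) z) (f (φ i) t) (f (φ j) t) (f (φ j) z)
    rw [dist_comm] at h1
    linarith
  choose! g hg using hc
  exact ⟨φ, hφ, g, hg⟩

lemma enorm_sub_rpow_le (a b : ℂ) {s : ℝ} (hs : 0 < s) :
    ‖a - b‖ₑ ^ s ≤ 2 ^ s * (‖a‖ₑ ^ s + ‖b‖ₑ ^ s) := by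
  have h1 : ‖a - b‖ₑ ≤ 2 * max ‖a‖ₑ ‖b‖ₑ := by
    rw [two_mul]
    exact (enorm_sub_le).trans (add_le_add (le_max_left _ _) (le_max_right _ _))
  refine (ENNReal.rpow_le_rpow h1 hs.le).trans ?_
  rw [ENNReal.mul_rpow_of_nonneg _ _ hs.le]
  refine mul_le_mul_right ?_ _
  rcases le_total ‖a‖ₑ ‖b‖ₑ with h | h
  · rw [max_eq_right h]; exact le_add_self
  · rw [max_eq_left h]; exact le_self_add

/-! ### Normal families and boundary shells -/

section Vanishing

variable {n : ℕ} {μ ν : Measure (Cn n)} {D C : ℝ≥0}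

namespace IsAdmissible

lemma exists_measure_ball_le (H : IsAdmissible ν D C) {k : ℝ} (k0 : 0 < k) :
    ∃ c : ℝ≥0, ∀ ξ : Cn n, ‖ξ‖ = 1 → ∀ h, k ≤ h → ν (unitBall n) ≤ c * ν (block ξ h) := by
  obtain ⟨j, hj⟩ := pow_unbounded_of_one_lt k⁻¹ (one_lt_two (α := ℝ))
  refine ⟨D ^ j, fun ξ hξ h hh => ?_⟩
  have h0 : 0 < h := k0.trans_le hh
  have h1 : 1 ≤ 2 ^ j * h := by
    rw [inv_lt_iff_one_lt_mul₀ k0] at hj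
    nlinarith [pow_pos (two_pos (α := ℝ)) j]
  rw [← block_of_one_le ξ h1]
  push_cast
  exact H.doubling_pow hξ h0 j

/-- Functions in a ball of the Bergman space are uniformly bounded on smaller balls. -/
lemma exists_norm_le (hn : 1 ≤ n) (H : IsAdmissible ν D C) {p : ℝ} (hp : 0 < p) {M : ℝ≥0∞}
    (hM : M ≠ ∞) {k : ℝ} (k0 : 0 < k) : ∃ B : ℝ≥0, ∀ f : Cn n → ℂ,
      DifferentiableOn ℂ f (unitBall n) → ∫⁻ z, ‖f z‖ₑ ^ p ∂ν ≤ M →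
        ∀ z : Cn n, ‖z‖ < 1 → ‖z‖ ≤ 1 - k → ‖f z‖ₑ ≤ B := by
  obtain ⟨c, hc⟩ := H.exists_measure_ball_le k0
  set b := ν (unitBall n) with hb
  have hb0 : b ≠ 0 := by
    have hξ : ‖(EuclideanSpace.single ⟨0, hn⟩ 1 : Cn n)‖ = 1 := by simp
    have := H.block_pos _ hξ 1 one_pos
    rw [block_of_one_le _ le_rfl] at this
    exact this.ne'
  have hbt : b ≠ ∞ := ((measure_mono (subset_univ _)).trans_lt H.finite).ne
  have hq : ((c : ℝ≥0∞) * (C * M) / b) ^ (1 / p) ≠ ∞ :=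
    ENNReal.rpow_ne_top_of_nonneg (by positivity) (ENNReal.div_ne_top (by finiteness) hb0)
  refine ⟨(((c : ℝ≥0∞) * (C * M) / b) ^ (1 / p)).toNNReal, fun f hf hfM z hz1 hz => ?_⟩
  rw [ENNReal.coe_toNNReal hq, le_rpow_one_div_iff hp, ENNReal.le_div_iff_mul_le (Or.inl hb0)
    (Or.inl hbt)]
  obtain ⟨ξ, hξ, h, h0, h1, hzh, hz', -⟩ := exists_block_eq hn (a := z) (by simpa using hz1)
  have hg := H.growth p f hp hf ξ hξ h h0 h1
  rw [← hz'] at hg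
  calc ‖f z‖ₑ ^ p * b ≤ ‖f z‖ₑ ^ p * (c * ν (block ξ h)) :=
        mul_le_mul_right (hc ξ hξ h (by linarith)) _
    _ = c * (‖f z‖ₑ ^ p * ν (block ξ h)) := by ring
    _ ≤ c * (C * M) := mul_le_mul_right (hg.trans (mul_le_mul_right hfM _)) _

/-- A bounded sequence in the Bergman space has a pointwise convergent subsequence. -/
lemma exists_subseq_tendsto (hn : 1 ≤ n) (H : IsAdmissible ν D C) {p : ℝ} (hp : 0 < p) {M : ℝ≥0∞}
    (hM : M ≠ ∞) {f : ℕ → Cn n → ℂ} (hf : ∀ k, DifferentiableOn ℂ (f k) (unitBall n))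
    (hfM : ∀ k, ∫⁻ z, ‖f k z‖ₑ ^ p ∂ν ≤ M) :
    ∃ φ : ℕ → ℕ, StrictMono φ ∧ ∃ g : Cn n → ℂ, ∀ z ∈ unitBall n,
      Tendsto (fun j => f (φ j) z) atTop (𝓝 (g z)) := by
  refine BergmanBall.exists_subseq_tendsto hf fun z hz => ?_
  have hz1 : ‖z‖ < 1 := by simpa using hz
  have hw : ∀ w ∈ Metric.ball z ((1 - ‖z‖) / 2), ‖w‖ ≤ 1 - (1 - ‖z‖) / 2 := fun w hw => by
    rw [Metric.mem_ball, dist_eq_norm] at hw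
    have := norm_le_norm_add_norm_sub' w z
    linarith
  obtain ⟨B, hB⟩ := H.exists_norm_le hn hp hM (k := (1 - ‖z‖) / 2) (by linarith)
  refine ⟨(1 - ‖z‖) / 2, by linarith, fun w hw' => ?_, B, fun k w hw' => ?_⟩
  · have := hw w hw'
    rw [mem_ball_zero_iff]; linarith
  · have h1 := hw w hw'
    have := hB (f k) (hf k) (hfM k) w (by linarith) h1
    rw [← ofReal_norm, ← ENNReal.ofReal_coe_nnreal] at this
    exact (ENNReal.ofReal_le_ofReal_iff B.2).1 this

variable {r : ℝ}

/-- A bound on small blocks gives a block bound for the restriction to a shell. -/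
lemma blockBound_restrict_shell (H : IsAdmissible ν D C) (hr : 1 ≤ r) {A : ℝ≥0∞} {k : ℝ}
    (k0 : 0 < k) (k1 : k < 1)
    (hμ : ∀ η : Cn n, ‖η‖ = 1 → ∀ h, 0 < h → h ≤ k → μ (block η h) ≤ A * ν (block η h) ^ r) :
    BlockBound (μ.restrict {z | 1 - k < ‖z‖}) ν (A * ((D ^ 4) ^ r * (D ^ 4) ^ r)) r := by
  intro ξ hξ h h0
  rw [Measure.restrict_apply (measurableSet_block hξ h0)]
  rcases le_total k h with hk | hk
  · refine (H.measure_block_inter_shell_le hr k0 k1 (fun η hη => hμ η hη k k0 le_rfl) hξ hk).trans ?_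
    simp only [mul_assoc]
    exact le_rfl
  · refine (measure_mono inter_subset_left).trans ((hμ ξ hξ h h0 hk).trans ?_)
    refine mul_le_mul_left (le_mul_of_one_le_right zero_le ?_) _
    have hD : (1 : ℝ≥0∞) ≤ D := by exact_mod_cast H.one_le
    have : (1 : ℝ≥0∞) ≤ (D ^ 4) ^ r := ENNReal.one_le_rpow (one_le_pow₀ hD) (by linarith)
    exact one_le_mul this this

/-- Blocks of size at most k miss the compact part, and larger blocks have mass comparable to that
of the whole ball, so the finite mass of the compact part is absorbed into the constant. -/
lemma exists_blockBound (hn : 1 ≤ n) (H : IsAdmissible ν D C) (hr : 1 ≤ r) {A : ℝ≥0∞} (hA : A ≠ ∞)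
    {k : ℝ} (k0 : 0 < k) (k1 : k < 1) (hc : μ {z | ‖z‖ ≤ 1 - k} ≠ ∞)
    (hs : BlockBound (μ.restrict {z | 1 - k < ‖z‖}) ν A r) :
    ∃ A' : ℝ≥0∞, A' ≠ ∞ ∧ BlockBound μ ν A' r := by
  obtain ⟨c, hcb⟩ := H.exists_measure_ball_le k0
  set b := ν (unitBall n) with hb
  have hb0 : b ≠ 0 := by
    have hξ : ‖(EuclideanSpace.single ⟨0, hn⟩ 1 : Cn n)‖ = 1 := by simp
    have := H.block_pos _ hξ 1 one_pos
    rw [block_of_one_le _ le_rfl] at this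
    exact this.ne'
  have hbt : b ≠ ∞ := ((measure_mono (subset_univ _)).trans_lt H.finite).ne
  have hr0 : 0 ≤ r := by linarith
  have hcr : ((c : ℝ≥0∞) / b) ^ r ≠ ∞ :=
    ENNReal.rpow_ne_top_of_nonneg hr0 (ENNReal.div_ne_top ENNReal.coe_ne_top hb0)
  refine ⟨A + μ {z | ‖z‖ ≤ 1 - k} * ((c : ℝ≥0∞) / b) ^ r, by finiteness, fun ξ hξ h h0 => ?_⟩
  have hS := hs ξ hξ h h0
  rw [Measure.restrict_apply (measurableSet_block hξ h0)] at hS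
  have hsplit : block ξ h = block ξ h ∩ {z | 1 - k < ‖z‖} ∪ block ξ h ∩ {z | ‖z‖ ≤ 1 - k} := by
    rw [← inter_union_distrib_left]
    refine (inter_eq_left.2 fun z _ => ?_).symm
    exact lt_or_ge (1 - k) ‖z‖
  rw [add_mul]
  refine (measure_mono hsplit.le).trans ((measure_union_le _ _).trans (add_le_add hS ?_))
  rcases le_total h k with hk | hk
  · have : block ξ h ∩ {z | ‖z‖ ≤ 1 - k} ⊆ ∅ := by
      rintro z ⟨hz, hz'⟩
      have h1 := ((mem_block hξ h0 (hk.trans_lt k1)).1 hz).1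
      rw [mem_ofPred_eq] at hz'
      linarith
    rw [subset_empty_iff.1 this]; simp
  · refine (measure_mono inter_subset_right).trans ?_
    rw [mul_assoc, ← ENNReal.mul_rpow_of_nonneg _ _ hr0]
    refine le_mul_of_one_le_right zero_le (ENNReal.one_le_rpow ?_ (by linarith))
    rw [mul_comm, ← mul_div_assoc, ENNReal.le_div_iff_mul_le (Or.inl hb0) (Or.inl hbt), one_mul,
      mul_comm]
    exact hcb ξ hξ h hk

end IsAdmissible

end Vanishing

/-! ### Compactness and vanishing block ratios -/

section Compact

variable {n : ℕ} {ω : ℝ → ℝ} {p q : ℝ} {μ : Measure (Cn n)}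

lemma exists_measure_block_le_of_tendsto {D C : ℝ≥0} (H : IsAdmissible (weightMeasure n ω) D C)
    (hr : 0 < q / p) (ht : Tendsto (fun a => blockRatio ω p q μ a)
      (comap (fun a : Cn n => ‖a‖) (𝓝[<] 1)) (𝓝 0)) {ε : ℝ≥0∞} (hε : 0 < ε) :
    ∃ k : ℝ, 0 < k ∧ k < 1 ∧ ∀ η : Cn n, ‖η‖ = 1 → ∀ h, 0 < h → h ≤ k →
      μ (block η h) ≤ ε * weightMeasure n ω (block η h) ^ (q / p) := by
  have h1 := ht.eventually_le_const hε
  rw [eventually_comap] at h1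
  obtain ⟨l, hl1, hl⟩ := mem_nhdsLT_iff_exists_Ioo_subset.1 h1
  have hl1' : l < 1 := hl1
  refine ⟨min ((1 - l) / 2) (1 / 2), lt_min (by linarith) (by norm_num),
    (min_le_right _ _).trans_lt (by norm_num), fun η hη h h0 hh => ?_⟩
  have hh1 : h ≤ (1 - l) / 2 := hh.trans (min_le_left _ _)
  have hh2 : h ≤ 1 / 2 := hh.trans (min_le_right _ _)
  obtain ⟨a, -, ha, hab⟩ := block_eq_carlesonBlock hη h0
  rw [max_eq_left (by linarith)] at ha
  have h2 := hl (show 1 - h ∈ Ioo l 1 from ⟨by linarith, by linarith⟩) a ha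
  rw [blockRatio, hab] at h2
  have hB0 := (H.block_pos η hη h h0).ne'
  have hBt := H.block_ne_top η h
  refine (ENNReal.div_le_iff ?_ ?_).1 h2
  · simp [ENNReal.rpow_eq_zero_iff, hB0, hBt]
  · exact ENNReal.rpow_ne_top_of_nonneg hr.le hBt

lemma measure_norm_le_ne_top
    (hμ : ∀ K : Set (Cn n), IsCompact K → K ⊆ unitBall n → μ K < ∞) {k : ℝ} (k0 : 0 < k) :
    μ {z | ‖z‖ ≤ 1 - k} ≠ ∞ := by
  have : {z : Cn n | ‖z‖ ≤ 1 - k} = Metric.closedBall 0 (1 - k) := by ext; simp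
  rw [this]
  exact (hμ _ (isCompact_closedBall _ _) (Metric.closedBall_subset_ball (by linarith))).ne

lemma isCarleson_of_tendsto (hn : 1 ≤ n) (hp : 0 < p) (hpq : p ≤ q) (hω : IsDoublingWeight n ω)
    (hμ : IsMeasureOnBall μ) (hμc : ∀ K : Set (Cn n), IsCompact K → K ⊆ unitBall n → μ K < ∞)
    (ht : Tendsto (fun a => blockRatio ω p q μ a)
      (comap (fun a : Cn n => ‖a‖) (𝓝[<] 1)) (𝓝 0)) : IsCarleson ω p q μ := by
  obtain ⟨D, C, H⟩ := exists_isAdmissible_weightMeasure hn hω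
  have hr : 1 ≤ q / p := (one_le_div hp).2 hpq
  obtain ⟨k, k0, k1, hk⟩ := exists_measure_block_le_of_tendsto H (by linarith) ht one_pos
  have hD : ((D : ℝ≥0∞) ^ 4) ^ (q / p) ≠ ∞ :=
    ENNReal.rpow_ne_top_of_nonneg (by linarith) (by finiteness)
  obtain ⟨A, hA, hb⟩ := H.exists_blockBound hn hr (by finiteness) k0 k1
    (measure_norm_le_ne_top hμc k0) (H.blockBound_restrict_shell hr k0 k1 hk)
  exact isCarleson_of_blockBound hn hp hpq hω hμ hA hb

lemma ae_mem_unitBall (hμ : IsMeasureOnBall μ) : ∀ᵐ z ∂μ, z ∈ unitBall n := by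
  rw [ae_iff]; exact hμ

/-- Pointwise convergence of a bounded sequence in the Bergman space is convergence in `L^q(μ)`
when the block ratios of `μ` vanish at the boundary. -/
lemma tendsto_lintegral_sub (hn : 1 ≤ n) (hp : 0 < p) (hpq : p ≤ q) (hω : IsDoublingWeight n ω)
    (hμ : IsMeasureOnBall μ) (hμc : ∀ K : Set (Cn n), IsCompact K → K ⊆ unitBall n → μ K < ∞)
    (ht : Tendsto (fun a => blockRatio ω p q μ a)
      (comap (fun a : Cn n => ‖a‖) (𝓝[<] 1)) (𝓝 0))
    {f : ℕ → Cn n → ℂ} (hf : ∀ j, DifferentiableOn ℂ (f j) (unitBall n)) {M : ℝ≥0∞} (hM : M ≠ ∞)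
    (hfM : ∀ j, ∫⁻ z, ‖f j z‖ₑ ^ p ∂(weightMeasure n ω) ≤ M) {g : Cn n → ℂ}
    (hg : ∀ z ∈ unitBall n, Tendsto (fun j => f j z) atTop (𝓝 (g z))) :
    Tendsto (fun j => ∫⁻ z, ‖f j z - g z‖ₑ ^ q ∂μ) atTop (𝓝 0) := by
  obtain ⟨D, C, H⟩ := exists_isAdmissible_weightMeasure hn hω
  have hq : 0 < q := hp.trans_le hpq
  have hr : 1 ≤ q / p := (one_le_div hp).2 hpq
  have hr0 : 0 < q / p := by linarith
  obtain ⟨K, hK⟩ := H.exists_lintegral_le hn hp hr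
  have hm : ∀ j, AEStronglyMeasurable (f j) μ := fun j =>
    aestronglyMeasurable_of_continuousOn hμ (hf j).continuousOn
  have hgm : AEStronglyMeasurable g μ := aestronglyMeasurable_of_tendsto_ae atTop hm
    ((ae_mem_unitBall hμ).mono hg)
  have hD : ((D : ℝ≥0∞) ^ 4) ^ (q / p) ≠ ∞ :=
    ENNReal.rpow_ne_top_of_nonneg hr0.le (by finiteness)
  have h2 : (2 : ℝ≥0∞) ^ p ≠ ∞ := ENNReal.rpow_ne_top_of_nonneg hp.le (by norm_num)
  have h2M : (2 : ℝ≥0∞) ^ p * (M + M) ≠ ∞ := by finiteness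
  have h2Mr : ((2 : ℝ≥0∞) ^ p * (M + M)) ^ (q / p) ≠ ∞ :=
    ENNReal.rpow_ne_top_of_nonneg hr0.le h2M
  set T : ℝ≥0∞ := K * (((D : ℝ≥0∞) ^ 4) ^ (q / p) * (D ^ 4) ^ (q / p)) *
    (2 ^ p * (M + M)) ^ (q / p) with hT
  have hTt : T ≠ ∞ := by finiteness
  have hsub : ∀ i j, ∫⁻ z, ‖f j z - f i z‖ₑ ^ p ∂(weightMeasure n ω) ≤ 2 ^ p * (M + M) := by
    intro i j
    refine (lintegral_mono fun z => enorm_sub_rpow_le (f j z) (f i z) hp).trans ?_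
    rw [lintegral_const_mul' _ _ h2, lintegral_add_left'
      (H.aemeasurable_enorm_rpow (hf j).continuousOn p)]
    exact mul_le_mul_right (add_le_add (hfM j) (hfM i)) _
  rw [ENNReal.tendsto_atTop_zero]
  intro ε hε
  obtain ⟨δ, hδ0, hδ⟩ : ∃ δ : ℝ≥0∞, 0 < δ ∧ δ * T ≤ ε / 2 := by
    rcases eq_or_ne ε ∞ with rfl | hεt
    · exact ⟨1, one_pos, by simp [ENNReal.top_div]⟩
    · refine ⟨ε / 2 / (T + 1), ENNReal.div_pos (ENNReal.half_pos hε.ne').ne' (by finiteness), ?_⟩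
      refine (mul_le_mul_right (le_self_add (b := 1)) _).trans ?_
      exact (ENNReal.div_mul_cancel (by simp) (by finiteness)).le
  have hδt : min δ 1 ≠ ∞ := ((min_le_right _ _).trans_lt ENNReal.one_lt_top).ne
  obtain ⟨k, k0, k1, hk⟩ := exists_measure_block_le_of_tendsto H hr0 ht (lt_min hδ0 one_pos)
  have hbl := H.blockBound_restrict_shell hr k0 k1 hk
  set S : Set (Cn n) := {z | 1 - k < ‖z‖} with hS
  have hSm : MeasurableSet S := measurableSet_lt measurable_const measurable_norm
  have hμS : (μ.restrict S) (unitBall n)ᶜ = 0 :=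
    le_antisymm ((Measure.restrict_apply_le S _).trans hμ.le) zero_le
  have hshell : ∀ j, ∫⁻ z in S, ‖f j z - g z‖ₑ ^ q ∂μ ≤ ε / 2 := by
    intro j
    -- The limit g is known only pointwise, so the embedding is applied to the holomorphic
    -- differences f j - f i and Fatou's lemma lets i tend to infinity.
    have hlim : ∀ᵐ z ∂(μ.restrict S), ‖f j z - g z‖ₑ ^ q =
        liminf (fun i => ‖f j z - f i z‖ₑ ^ q) atTop := by
      filter_upwards [ae_restrict_of_ae (ae_mem_unitBall hμ)] with z hz
      exact ((((tendsto_const_nhds (x := f j z)).sub (hg z hz)).enorm).ennrpow_const q).liminf_eq.symm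
    rw [lintegral_congr_ae hlim]
    refine (lintegral_liminf_le' fun i =>
      (((hm j).sub (hm i)).enorm.pow_const q).restrict).trans ?_
    refine liminf_le_of_le (h := fun b hb => ?_)
    obtain ⟨i, hi⟩ := hb.exists
    refine hi.trans ?_
    have := hK (μ.restrict S) _ hμS (by finiteness) hbl (fun z => f j z - f i z)
      ((hf j).sub (hf i)) ((hsub i j).trans_lt h2M.lt_top).ne
    rw [mul_div_cancel₀ _ hp.ne'] at this
    refine this.trans ?_
    calc _ ≤ (K : ℝ≥0∞) * (δ * (((D : ℝ≥0∞) ^ 4) ^ (q / p) * (D ^ 4) ^ (q / p))) *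
          (2 ^ p * (M + M)) ^ (q / p) :=
          mul_le_mul' (mul_le_mul_right (mul_le_mul_left (min_le_left _ _) _) _)
            (ENNReal.rpow_le_rpow (hsub i j) hr0.le)
      _ = δ * T := by rw [hT]; ring
      _ ≤ ε / 2 := hδ
  -- Off the shell the sequence is uniformly bounded and the mass of μ is finite, so dominated
  -- convergence applies.
  have hcpt : Tendsto (fun j => ∫⁻ z in Sᶜ, ‖f j z - g z‖ₑ ^ q ∂μ) atTop (𝓝 0) := by
    obtain ⟨B, hB⟩ := H.exists_norm_le hn hp hM k0
    have hSc : ∀ z ∈ Sᶜ, ‖z‖ ≤ 1 - k := fun z hz => not_lt.1 hz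
    have hz : ∀ z ∈ Sᶜ, z ∈ unitBall n := fun z hz => by
      rw [mem_ball_zero_iff]; linarith [hSc z hz]
    have hfB : ∀ j, ∀ z ∈ Sᶜ, ‖f j z‖ₑ ≤ B := fun j z hzS =>
      hB (f j) (hf j) (hfM j) z (by linarith [hSc z hzS]) (hSc z hzS)
    have hgB : ∀ z ∈ Sᶜ, ‖g z‖ₑ ≤ B := fun z hzS =>
      le_of_tendsto (hg z (hz z hzS)).enorm (Eventually.of_forall fun j => hfB j z hzS)
    have hd := tendsto_lintegral_of_dominated_convergence' (μ := μ.restrict Sᶜ)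
      (F := fun j z => ‖f j z - g z‖ₑ ^ q) (f := fun _ => 0)
      (fun _ => 2 ^ q * ((B : ℝ≥0∞) ^ q + (B : ℝ≥0∞) ^ q))
      (fun j => (((hm j).sub hgm).enorm.pow_const q).restrict) (fun j => ?_) ?_ ?_
    · simpa using hd
    · filter_upwards [ae_restrict_mem hSm.compl] with z hzS
      exact (enorm_sub_rpow_le _ _ hq).trans (mul_le_mul_right (add_le_add
        (ENNReal.rpow_le_rpow (hfB j z hzS) hq.le) (ENNReal.rpow_le_rpow (hgB z hzS) hq.le)) _)
    · rw [lintegral_const, Measure.restrict_apply_univ]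
      have h3 : μ Sᶜ ≠ ∞ := by
        have : Sᶜ = {z : Cn n | ‖z‖ ≤ 1 - k} := by ext z; simp [hS]
        rw [this]; exact measure_norm_le_ne_top hμc k0
      have h4 : (2 : ℝ≥0∞) ^ q ≠ ∞ := ENNReal.rpow_ne_top_of_nonneg hq.le (by norm_num)
      have h5 : (B : ℝ≥0∞) ^ q ≠ ∞ := ENNReal.rpow_ne_top_of_nonneg hq.le ENNReal.coe_ne_top
      finiteness
    · filter_upwards [ae_restrict_mem hSm.compl] with z hzS
      have := (((hg z (hz z hzS)).sub (tendsto_const_nhds (x := g z))).enorm).ennrpow_const q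
      simpa [ENNReal.zero_rpow_of_pos hq] using this
  obtain ⟨N, hN⟩ := (ENNReal.tendsto_atTop_zero.1 hcpt) (ε / 2) (ENNReal.half_pos hε.ne')
  refine ⟨N, fun j hj => ?_⟩
  rw [← lintegral_add_compl _ hSm, ← ENNReal.add_halves ε]
  exact add_le_add (hshell j) (hN j hj)

lemma isVanishingCarleson_of_tendsto (hn : 1 ≤ n) (hp : 0 < p) (hpq : p ≤ q)
    (hω : IsDoublingWeight n ω) (hμ : IsMeasureOnBall μ)
    (hμc : ∀ K : Set (Cn n), IsCompact K → K ⊆ unitBall n → μ K < ∞)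
    (ht : Tendsto (fun a => blockRatio ω p q μ a)
      (comap (fun a : Cn n => ‖a‖) (𝓝[<] 1)) (𝓝 0)) : IsVanishingCarleson ω p q μ := by
  have hq : 0 < q := hp.trans_le hpq
  have hcar := isCarleson_of_tendsto hn hp hpq hω hμ hμc ht
  refine ⟨hcar, fun f hf ⟨M, hM⟩ => ?_⟩
  obtain ⟨D, C, H⟩ := exists_isAdmissible_weightMeasure hn hω
  have hMp : (M : ℝ≥0∞) ^ p ≠ ∞ := ENNReal.rpow_ne_top_of_nonneg hp.le ENNReal.coe_ne_top
  have hfM : ∀ k, ∫⁻ z, ‖f k z‖ₑ ^ p ∂(weightMeasure n ω) ≤ (M : ℝ≥0∞) ^ p := fun k => by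
    rw [← bergmanNorm_rpow hp]
    exact ENNReal.rpow_le_rpow (hM k) hp.le
  obtain ⟨φ, hφ, g, hg⟩ := H.exists_subseq_tendsto hn hp hMp (fun k => (hf k).1) hfM
  have hlim := tendsto_lintegral_sub hn hp hpq hω hμ hμc ht (fun j => (hf (φ j)).1) hMp
    (fun j => hfM (φ j)) hg
  have hlim' : Tendsto (fun j => eLpNorm (f (φ j) - g) (ENNReal.ofReal q) μ) atTop (𝓝 0) := by
    have h1 := hlim.ennrpow_const (1 / q)
    rw [ENNReal.zero_rpow_of_pos (by positivity)] at h1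
    refine h1.congr fun j => ?_
    have := eLpNorm_ofReal_rpow μ (f (φ j) - g) hq
    simp only [Pi.sub_apply] at this
    rw [← this, ← ENNReal.rpow_mul, mul_one_div_cancel hq.ne', ENNReal.rpow_one]
  have hfL : ∀ j, MemLp (f (φ j)) (ENNReal.ofReal q) μ := fun j =>
    (hcar.choose_spec _ (hf (φ j))).1
  have hgm : AEStronglyMeasurable g μ := aestronglyMeasurable_of_tendsto_ae atTop
    (fun j => (hfL j).1) ((ae_mem_unitBall hμ).mono hg)
  refine ⟨φ, hφ, g, ?_, hlim'⟩
  obtain ⟨j, hj⟩ := (hlim'.eventually_lt_const one_pos).exists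
  have hd : MemLp (f (φ j) - g) (ENNReal.ofReal q) μ :=
    ⟨(hfL j).1.sub hgm, hj.trans ENNReal.one_lt_top⟩
  simpa using (hfL j).sub hd

lemma tendsto_blockRatio_of_isVanishingCarleson (hn : 1 ≤ n) (hp : 0 < p) (hpq : p ≤ q)
    (hω : IsDoublingWeight n ω) (hμ : IsMeasureOnBall μ) (hv : IsVanishingCarleson ω p q μ) :
    Tendsto (fun a => blockRatio ω p q μ a)
      (comap (fun a : Cn n => ‖a‖) (𝓝[<] 1)) (𝓝 0) := by
  obtain ⟨D, C, H⟩ := exists_isAdmissible_weightMeasure hn hω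
  obtain ⟨L, hL, Λ, hΛ, hF⟩ := H.exists_normalized_testFun hn hp
  have hq : 0 < q := hp.trans_le hpq
  have hr : 0 < q / p := by positivity
  refine tendsto_of_subseq_tendsto fun ns hns => ?_
  rw [tendsto_comap_iff] at hns
  obtain ⟨N, hN⟩ := eventually_atTop.1 (hns.eventually self_mem_nhdsWithin)
  have hb : ∀ j, ns (j + N) ∈ unitBall n := fun j => by
    rw [mem_ball_zero_iff]; exact hN (j + N) (by lia)
  choose ξ hξ h h0 h1 hnh _ hab using fun j => exists_block_eq hn (hb j)
  choose F hFd hFn hFl hFs using fun j => hF (ξ j) (hξ j) (h j) (h0 j) (h1 j)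
  have hh : Tendsto h atTop (𝓝 0) := by
    have h2 : Tendsto (fun j => ‖ns (j + N)‖) atTop (𝓝 1) :=
      (tendsto_nhds_of_tendsto_nhdsWithin hns).comp (tendsto_add_atTop_nat N)
    have h3 := (tendsto_const_nhds (x := (1 : ℝ))).sub h2
    rw [sub_self] at h3
    exact h3.congr fun j => by rw [hnh]; ring
  have hFm : ∀ j, F j ∈ bergmanSpace n ω p ∧ bergmanNorm n ω p (F j) ≤ (1 : ℝ≥0∞) ^ (1 / p) :=
    fun j => mem_bergmanSpace_of_lintegral_le hp (hFd j) ENNReal.one_ne_top (hFn j)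
  obtain ⟨φ, hφ, g, hgL, hg⟩ := hv.2 F (fun j => (hFm j).1)
    ⟨1, fun j => by simpa using (hFm j).2⟩
  -- The spare factor h in the bound Λ(z) h makes the test functions vanish pointwise as the blocks
  -- shrink to the boundary.
  have hFz : ∀ z ∈ unitBall n, Tendsto (fun j => ‖F (φ j) z‖ₑ) atTop (𝓝 0) := fun z hz => by
    have h2 : Tendsto (fun j => Λ z * ENNReal.ofReal (h (φ j))) atTop (𝓝 0) := by
      have h3 := (ENNReal.tendsto_ofReal (hh.comp hφ.tendsto_atTop))
      have h4 := ENNReal.Tendsto.const_mul h3 (Or.inr (hΛ z hz))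
      simpa using h4
    have h3 := tendsto_of_tendsto_of_tendsto_of_le_of_le tendsto_const_nhds h2
      (fun _ => zero_le) (fun j => hFs (φ j) z hz)
    have h4 := h3.ennrpow_const (1 / p)
    rw [ENNReal.zero_rpow_of_pos (by positivity)] at h4
    refine h4.congr fun j => ?_
    rw [← ENNReal.rpow_mul, mul_one_div_cancel hp.ne', ENNReal.rpow_one]
  have hgq : Tendsto (fun j => ∫⁻ z, ‖F (φ j) z - g z‖ₑ ^ q ∂μ) atTop (𝓝 0) := by
    have h2 := hg.ennrpow_const q
    rw [ENNReal.zero_rpow_of_pos hq] at h2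
    exact h2.congr fun j => eLpNorm_ofReal_rpow μ _ hq
  have hm : ∀ j, AEStronglyMeasurable (F (φ j)) μ := fun j =>
    aestronglyMeasurable_of_continuousOn hμ (hFd _).continuousOn
  -- Fatou's lemma identifies the L^q limit g with the pointwise limit 0, so the test functions
  -- themselves tend to zero in L^q(μ); `measure_block_le` then gives the decay of the ratios.
  have hg0 : ∫⁻ z, ‖g z‖ₑ ^ q ∂μ = 0 := by
    have hlim : ∀ᵐ z ∂μ, ‖g z‖ₑ ^ q = liminf (fun j => ‖F (φ j) z - g z‖ₑ ^ q) atTop := by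
      filter_upwards [ae_mem_unitBall hμ] with z hz
      have h2 : Tendsto (fun j => F (φ j) z) atTop (𝓝 0) :=
        tendsto_zero_iff_enorm_tendsto_zero.2 (hFz z hz)
      have h3 := ((h2.sub (tendsto_const_nhds (x := g z))).enorm).ennrpow_const q
      rw [zero_sub, enorm_neg] at h3
      exact h3.liminf_eq.symm
    rw [lintegral_congr_ae hlim]
    refine le_antisymm ((lintegral_liminf_le' fun j =>
      ((hm j).sub hgL.1).enorm.pow_const q).trans hgq.liminf_eq.le) zero_le
  have hFq : Tendsto (fun j => ∫⁻ z, ‖F (φ j) z‖ₑ ^ q ∂μ) atTop (𝓝 0) := by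
    have hga : ∀ᵐ z ∂μ, ‖g z‖ₑ ^ q = 0 :=
      (lintegral_eq_zero_iff' (hgL.1.enorm.pow_const q)).1 hg0
    refine hgq.congr fun j => lintegral_congr_ae ?_
    filter_upwards [hga] with z hz
    rw [ENNReal.rpow_eq_zero_iff_of_pos hq, enorm_eq_zero] at hz
    rw [hz, sub_zero]
  refine ⟨fun j => φ j + N, ?_⟩
  have hLq : (L : ℝ≥0∞) ^ (q / p) ≠ ∞ := ENNReal.rpow_ne_top_of_nonneg hr.le ENNReal.coe_ne_top
  have hup := ENNReal.Tendsto.const_mul hFq (Or.inr hLq)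
  rw [mul_zero] at hup
  refine tendsto_of_tendsto_of_tendsto_of_le_of_le tendsto_const_nhds hup (fun _ => zero_le)
    fun j => ?_
  have := measure_block_le (μ := μ) hr hL (hξ (φ j)) (h0 (φ j))
    (H.block_pos _ (hξ _) _ (h0 (φ j))).ne' (H.block_ne_top _ _) (hFl (φ j))
  rw [mul_div_cancel₀ _ hp.ne'] at this
  simp only [blockRatio, hab]
  exact this

theorem isVanishingCarleson_iff (hn : 1 ≤ n) (hp : 0 < p) (hpq : p ≤ q)
    (hω : IsDoublingWeight n ω) (hμ : IsMeasureOnBall μ)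
    (hμc : ∀ K : Set (Cn n), IsCompact K → K ⊆ unitBall n → μ K < ∞) :
    IsVanishingCarleson ω p q μ ↔ Tendsto (fun a => blockRatio ω p q μ a)
      (comap (fun a : Cn n => ‖a‖) (𝓝[<] 1)) (𝓝 0) :=
  ⟨tendsto_blockRatio_of_isVanishingCarleson hn hp hpq hω hμ,
    isVanishingCarleson_of_tendsto hn hp hpq hω hμ hμc⟩

end Compact

end BergmanBall

end

theorem theorem3p1 (n : ℕ) (hn : 1 ≤ n) (p q : ℝ) (hp : 0 < p) (hpq : p ≤ q)
    (ω : ℝ → ℝ) (hω : BergmanBall.IsDoublingWeight n ω) :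
    (∀ μ : Measure (BergmanBall.Cn n), BergmanBall.IsMeasureOnBall μ →
      (BergmanBall.IsCarleson ω p q μ ↔
        (⨆ a ∈ BergmanBall.unitBall n, BergmanBall.blockRatio ω p q μ a) < ∞)) ∧
    (∃ C : ℝ≥0, 0 < C ∧ ∀ μ : Measure (BergmanBall.Cn n), BergmanBall.IsMeasureOnBall μ →
      BergmanBall.IsCarleson ω p q μ →
        BergmanBall.idNorm ω p q μ ^ q ≤
            C * ⨆ a ∈ BergmanBall.unitBall n, BergmanBall.blockRatio ω p q μ a ∧
        (⨆ a ∈ BergmanBall.unitBall n, BergmanBall.blockRatio ω p q μ a) ≤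
            C * BergmanBall.idNorm ω p q μ ^ q) ∧
    (∀ μ : Measure (BergmanBall.Cn n), BergmanBall.IsMeasureOnBall μ →
      (∀ K : Set (BergmanBall.Cn n), IsCompact K → K ⊆ BergmanBall.unitBall n → μ K < ∞) →
      (BergmanBall.IsVanishingCarleson ω p q μ ↔
        Tendsto (fun a => BergmanBall.blockRatio ω p q μ a)
          (comap (fun a : BergmanBall.Cn n => ‖a‖) (𝓝[<] 1)) (𝓝 0))) := by
  exact ⟨fun μ hμ => BergmanBall.isCarleson_iff hn hp hpq hω hμ,
    BergmanBall.exists_idNorm_comparison hn hp hpq hω,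
    fun μ hμ hμc => BergmanBall.isVanishingCarleson_iff hn hp hpq hω hμ hμc⟩
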